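/- **Definitions.** An instance of the *Stochastic Shortest Path* problem (SSP) consists of a finite set of states, a nonempty finite set of available actions in each state, and for every state $s$ and action $u$ available in $s$ a probability distribution $(P^u_{s,s'})_{s'}$ on the states and real transition costs $C^u_{s,s'}$. There is an absorbing, cost-free target state $\tau$ which, whichever actions are chosen, can be reached from every state along a path of positive probability. A policy chooses one available action in each state; its value at $s$ is the expected total cost incurred when starting from $s$. A policy is optimal if its value at every state is at most that of every other policy. The total number of available actions is the sum over the states of the numbers of actions available in them. An instance of the *Generalized PageRank Optimization* problem (GPRO) consists of a finite set of nodes, weights $W_{i,j}\ge 0$ (the edges are the pairs $(i,j)$ with $W_{i,j}>0$, and every node has an outgoing edge), real costs $K_{i,j}$, a set $F$ of edges called free (the others are fixed), a set of nodes carrying an *exclusivity constraint* (each such node has exactly two free outgoing edges and no fixed one), and a target node whose only outgoing edge is a fixed cost-free self-loop. A policy is a set $\mu\subseteq F$ of activated free edges such that every node has an outgoing edge that is fixed or activated, and exactly one edge is activated in every node with an exclusivity constraint. Under $\mu$ the process moves from $i$ along the fixed and activated edges with probabilities proportional to their weights, at cost $K_{i,j}$ per move. It is required that under every policy every node can reach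 the target. Values and optimal policies are defined as for SSP. A policy is called *single-choice* if it activates exactly one edge in every node whose outgoing edges are all free. "Polynomial time" is meant for both of the following cost measures at once: for arbitrary real data, with unit cost per arithmetic operation, in the number of data; and, for rational data, in the number of bits. **Theorem.** There is an absolute constant $c$ such that the following holds. (1) There are a polynomial-time algorithm that transforms every SSP instance $I$ with a total of $m$ available actions into a GPRO instance $G$ with at most $cm$ nodes and at most $cm$ free edges, all of which leave nodes with an exclusivity constraint, and a polynomial-time algorithm that translates every policy $\pi$ of $G$ into a policy $D(\pi)$ of $I$, such that: the states of $I$ correspond injectively to nodes of $G$, target to target; the value of $D(\pi)$ at each state equals the value of $\pi$ at the corresponding node; every policy of $I$ is some $D(\pi)$; if $\pi$ is optimal, so is $D(\pi)$; and every optimal policy of $I$ is $D(\pi)$ for some optimal $\pi$. (2) Conversely, there are a polynomial-time algorithm that transforms every GPRO instance $G$ with $n$ nodes and $f$ free edges into an SSP instance $I$ in which at most $cn$ states have a single available action, exactly $f$ states have two available actions, and there are no other states, and a polynomial-time algorithm that translates every policy $\pi$ of $I$ into a single-choice policy $D(\pi)$ of $G$, such that: the nodes of $G$ correspond injectively to states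 of $I$, target to target; the value of $D(\pi)$ at each node equals the value of $\pi$ at the corresponding state; every single-choice policy of $G$ is some $D(\pi)$; if $\pi$ is optimal, then $D(\pi)$ is optimal among all policies of $G$; and every optimal single-choice policy of $G$ is $D(\pi)$ for some optimal $\pi$. -/

import Mathlib

/-! ### Expected total cost of a finite Markov chain with transition costs -/

/-- Expected total cost of the Markov chain with transition matrix `Q`, started at `i`, when a
transition from `j` to `l` costs `K j l`: the sum over the times `t` of the expected cost of the
`t`-th transition. -/
noncomputable def expectedTotalCost {n : ℕ} (Q K : Matrix (Fin n) (Fin n) ℝ) (i : Fin n) : ℝ :=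
  ∑' t : ℕ, ∑ j, (Q ^ t) i j * ∑ l, Q j l * K j l

/-! ### Stochastic Shortest Path -/

/-- An instance of the Stochastic Shortest Path problem. The states are `0, …, n - 1`; the actions
available in state `s` are numbered `0, …, acts s - 1`. -/
structure SSP where
  n : ℕ
  target : Fin n
  acts : Fin n → ℕ
  /-- transition probabilities -/
  P : (s : Fin n) → Fin (acts s) → Fin n → ℝ
  /-- transition costs -/
  C : (s : Fin n) → Fin (acts s) → Fin n → ℝ
  acts_pos : ∀ s, 0 < acts s
  P_nonneg : ∀ s u s', 0 ≤ P s u s'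
  P_sum : ∀ s u, ∑ s', P s u s' = 1
  target_absorbing : ∀ u, P target u target = 1
  target_cost_free : ∀ u, C target u target = 0
  /-- whichever actions are chosen, every state reaches the target along a path of positive
  probability -/
  target_reachable : ∀ (μ : (s : Fin n) → Fin (acts s)) (s : Fin n),
    Relation.ReflTransGen (fun i j => 0 < P i (μ i) j) s target

namespace SSP

/-- A policy: one available action for each state. -/
abbrev Policy (I : SSP) : Type := (s : Fin I.n) → Fin (I.acts s)

/-- Total number of available actions. -/
def numActions (I : SSP) : ℕ := ∑ s, I.acts s

/-- Expected sum of the costs incurred from state `s` under the policy `μ`. (The target is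
absorbing and cost-free, so nothing is incurred after it is reached.) -/
noncomputable def value (I : SSP) (μ : I.Policy) (s : Fin I.n) : ℝ :=
  expectedTotalCost (Matrix.of fun i j => I.P i (μ i) j) (Matrix.of fun i j => I.C i (μ i) j) s

/-- `μ` is at least as good as every other policy, for every starting state. -/
def Optimal (I : SSP) (μ : I.Policy) : Prop :=
  ∀ (μ' : I.Policy) (s : Fin I.n), I.value μ s ≤ I.value μ' s

/-- Number of states with exactly `k` available actions. -/
def numStatesWith (I : SSP) (k : ℕ) : ℕ := (Finset.univ.filter fun s => I.acts s = k).card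

end SSP

/-! ### Generalized PageRank Optimization -/

/-- The data of a GPRO instance: the target node, the weights (positive exactly on the edges of
the support graph), the costs, the free edges, and the nodes that carry an exclusivity
constraint. -/
structure GPROData where
  n : ℕ
  target : Fin n
  W : Fin n → Fin n → ℝ
  K : Fin n → Fin n → ℝ
  F : Finset (Fin n × Fin n)
  X : Finset (Fin n)

namespace GPROData

/-- Weights in the configuration where `μ` is the set of activated free edges: a free edge that is
not activated gets weight zero. -/
def weight (G : GPROData) (μ : Finset (Fin G.n × Fin G.n)) (i j : Fin G.n) : ℝ :=
  if (i, j) ∈ G.F \ μ then 0 else G.W i j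

/-- Transition probabilities, proportional to the weights. -/
noncomputable def prob (G : GPROData) (μ : Finset (Fin G.n × Fin G.n)) (i j : Fin G.n) : ℝ :=
  G.weight μ i j / ∑ k, G.weight μ i k

/-- `μ` is a set of free edges that leaves every node with an outgoing edge and that respects the
exclusivity constraints. -/
def Admissible (G : GPROData) (μ : Finset (Fin G.n × Fin G.n)) : Prop :=
  μ ⊆ G.F ∧ (∀ i, ∃ j, 0 < G.weight μ i j) ∧ ∀ i ∈ G.X, ∃! j, (i, j) ∈ μ

/-- All the edges that leave `i` are free. -/
def AllFree (G : GPROData) (i : Fin G.n) : Prop := ∀ j, 0 < G.W i j → (i, j) ∈ G.F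

end GPROData

/-- An instance of the Generalized PageRank Optimization problem. -/
structure GPRO extends GPROData where
  W_nonneg : ∀ i j, 0 ≤ W i j
  /-- every node has an outgoing edge -/
  exists_edge : ∀ i, ∃ j, 0 < W i j
  /-- free edges are edges -/
  free_edge : ∀ i j, (i, j) ∈ F → 0 < W i j
  /-- exclusivity constraints are allowed only in nodes with exactly two free edges and no fixed
  edge going out -/
  exclusive : ∀ i ∈ X, (F.filter fun e => e.1 = i).card = 2 ∧ toGPROData.AllFree i
  /-- the only edge that leaves the target is a fixed self-loop, which is cost-free -/
  target_edge : ∀ j, 0 < W target j ↔ j = target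
  target_fixed : (target, target) ∉ F
  target_cost_free : K target target = 0
  /-- whatever the configuration, every node reaches the target -/
  target_reachable : ∀ μ, toGPROData.Admissible μ → ∀ i,
    Relation.ReflTransGen (fun i j => 0 < toGPROData.weight μ i j) i target

namespace GPRO

/-- A policy: an admissible set of activated free edges. -/
abbrev Policy (G : GPRO) : Type :=
  {μ : Finset (Fin G.n × Fin G.n) // G.toGPROData.Admissible μ}

/-- Expected sum of the costs incurred from node `i` under the policy `μ`. -/
noncomputable def value (G : GPRO) (μ : G.Policy) (i : Fin G.n) : ℝ :=
  expectedTotalCost (Matrix.of fun i j => G.toGPROData.prob μ.1 i j) (Matrix.of G.K) i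

/-- `μ` is at least as good as every other policy, for every starting node. -/
def Optimal (G : GPRO) (μ : G.Policy) : Prop :=
  ∀ (μ' : G.Policy) (i : Fin G.n), G.value μ i ≤ G.value μ' i

/-- In every node whose outgoing edges are all free, `μ` activates exactly one of them. -/
def SingleChoice (G : GPRO) (μ : G.Policy) : Prop :=
  ∀ i, G.toGPROData.AllFree i → ∃! j, (i, j) ∈ μ.1

end GPRO

/-! ### A programming language with a cost semantics -/

/-- Data: binary trees with numbers at some of the leaves. -/
inductive Data where
  | nil : Data
  | num (x : ℝ) : Data
  | cons (a b : Data) : Data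

namespace Data

/-- Size of a tree when a number `x` has length `w x`. -/
def size (w : ℝ → ℕ) : Data → ℕ
  | nil => 1
  | num x => w x + 1
  | cons a b => size w a + size w b + 1

/-- All the numbers in the tree are rational. -/
def IsRational : Data → Prop
  | nil => True
  | num x => ∃ q : ℚ, (q : ℝ) = x
  | cons a b => a.IsRational ∧ b.IsRational

def ofList : List Data → Data
  | [] => nil
  | a :: l => cons a (ofList l)

def ofBool : Bool → Data
  | false => nil
  | true => cons nil nil

/-- Natural numbers (used for indices) in unary. -/
def ofNat (k : ℕ) : Data := ofList (List.replicate k nil)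

/-- Right fold along the list stored in a tree. -/
def fold (step : Data → Data → Data) (init : Data) : Data → Data
  | cons a t => step a (fold step init t)
  | _ => init

/-- Total cost of the steps of a right fold. -/
def foldCost (step : Data → Data → Data) (stepCost : Data → Data → ℕ) (init : Data) : Data → ℕ
  | cons a t => foldCost step stepCost init t + stepCost a (fold step init t)
  | _ => 0

def fst : Data → Data
  | cons a _ => a
  | _ => nil

def snd : Data → Data
  | cons _ b => b
  | _ => nil

end Data

/-- The length of every number is one: arithmetic operations have unit cost. -/
def unitLength : ℝ → ℕ := fun _ => 1

open Classical in
/-- The binary length of a rational number (numerator, denominator and sign). It is used only for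
rational numbers; the value `0` at irrational numbers has no meaning. -/
noncomputable def bitLength (x : ℝ) : ℕ :=
  if h : ∃ q : ℚ, (q : ℝ) = x then h.choose.num.natAbs.size + h.choose.den.size + 1 else 0

/-- The arithmetic operations. -/
inductive ArithOp where
  | add | sub | mul | div

noncomputable def ArithOp.apply : ArithOp → ℝ → ℝ → ℝ
  | add, x, y => x + y
  | sub, x, y => x - y
  | mul, x, y => x * y
  | div, x, y => x / y

/-- An arithmetic operation on trees (`nil` when an argument is not a number). -/
noncomputable def Data.arith (op : ArithOp) : Data → Data → Data
  | num x, num y => num (op.apply x y)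
  | _, _ => nil

open Classical in
/-- Comparison of two numbers. -/
noncomputable def Data.lt : Data → Data → Data
  | num x, num y => ofBool (decide (x < y))
  | _, _ => nil

open Classical in
/-- Equality of two trees. -/
noncomputable def Data.eq (a b : Data) : Data := ofBool (decide (a = b))

/-- Programs; each of them transforms one tree into one tree. -/
inductive Prog where
  | id : Prog
  | nil : Prog
  | num (q : ℚ) : Prog
  | fst : Prog
  | snd : Prog
  | cons (f g : Prog) : Prog
  /-- first `g`, then `f` -/
  | comp (f g : Prog) : Prog
  /-- run `f` if the result of `c` is not `nil`, and `g` otherwise -/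
  | ite (c f g : Prog) : Prog
  /-- on the input `x`, loop from right to left through the list computed by `l`, starting with
  the result of `z`; the body `f` sees `x`, the current list entry and the accumulator -/
  | fold (f z l : Prog) : Prog
  | arith (op : ArithOp) (f g : Prog) : Prog
  | lt (f g : Prog) : Prog
  | eq (f g : Prog) : Prog

namespace Prog

/-- The result of a program. -/
noncomputable def eval : Prog → Data → Data
  | id, x => x
  | nil, _ => .nil
  | num q, _ => .num q
  | fst, x => x.fst
  | snd, x => x.snd
  | cons f g, x => .cons (eval f x) (eval g x)
  | comp f g, x => eval f (eval g x)
  | ite c f g, x =>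
    match eval c x with
    | .nil => eval g x
    | _ => eval f x
  | fold f z l, x =>
    Data.fold (fun a acc => eval f (.cons x (.cons a acc))) (eval z x) (eval l x)
  | arith op f g, x => Data.arith op (eval f x) (eval g x)
  | lt f g, x => Data.lt (eval f x) (eval g x)
  | eq f g, x => Data.eq (eval f x) (eval g x)

/-- The running time of a program when a number `x` has length `w x`. Every executed operation is
charged, together with the sizes of the trees that it reads or writes. -/
noncomputable def cost (w : ℝ → ℕ) : Prog → Data → ℕ
  | id, x => x.size w + 1
  | nil, _ => 2
  | num q, _ => w q + 2
  | fst, x => x.size w + 1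
  | snd, x => x.size w + 1
  | cons f g, x => cost w f x + cost w g x + 1
  | comp f g, x => cost w g x + cost w f (eval g x) + 1
  | ite c f g, x =>
    cost w c x + 1 +
      match eval c x with
      | .nil => cost w g x
      | _ => cost w f x
  | fold f z l, x =>
    cost w l x + cost w z x + 1 +
      Data.foldCost (fun a acc => eval f (.cons x (.cons a acc)))
        (fun a acc => cost w f (.cons x (.cons a acc)) +
          Data.size w (.cons x (.cons a acc)) + 1)
        (eval z x) (eval l x)
  | arith op f g, x =>
    cost w f x + cost w g x + (Data.arith op (eval f x) (eval g x)).size w + 1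
  | lt f g, x => cost w f x + cost w g x + 4
  | eq f g, x => cost w f x + cost w g x + 4

/-- On the input `x`, the program stays within the time bound `T` (a polynomial in the size of the
input), both when numbers are real and arithmetic has unit cost and, if all the numbers in the
input are rational, when numbers are written in binary and every bit is charged. -/
def RunsInTime (p : Prog) (T : Polynomial ℕ) (x : Data) : Prop :=
  p.cost unitLength x ≤ T.eval (x.size unitLength) ∧
  (x.IsRational → p.cost bitLength x ≤ T.eval (x.size bitLength))

end Prog

/-! ### Encodings of instances and policies -/

/-- An SSP instance: the target and, for each state, each action and each successor state, the
transition probability and the cost. -/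
def SSP.encode (I : SSP) : Data :=
  .cons (.ofNat I.target)
    (.ofList (List.ofFn fun s => .ofList (List.ofFn fun u => .ofList (List.ofFn fun s' =>
      .cons (.num (I.P s u s')) (.num (I.C s u s'))))))

/-- An SSP policy: the list of the chosen actions. -/
def SSP.encodePolicy (I : SSP) (μ : I.Policy) : Data :=
  .ofList (List.ofFn fun s => .ofNat (μ s))

/-- A GPRO instance: the target and, for each node, whether it carries an exclusivity constraint
and, for each pair of nodes, the weight, the cost and whether the edge is free. -/
def GPRO.encode (G : GPRO) : Data :=
  .cons (.ofNat G.target)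
    (.ofList (List.ofFn fun i => .cons (.ofBool (decide (i ∈ G.X)))
      (.ofList (List.ofFn fun j =>
        .cons (.num (G.W i j)) (.cons (.num (G.K i j)) (.ofBool (decide ((i, j) ∈ G.F))))))))

/-- A GPRO policy: the matrix that marks the activated free edges. -/
def GPRO.encodePolicy (G : GPRO) (μ : G.Policy) : Data :=
  .ofList (List.ofFn fun i => .ofList (List.ofFn fun j => .ofBool (decide ((i, j) ∈ μ.1))))

/-! # Stochastic Shortest Path and Generalized PageRank Optimization

Under a fixed policy, both problems ask for the total cost of a Markov chain that reaches an
absorbing, cost-free target from everywhere (`ProperChain`). By the maximum principle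
(`ProperChain.nonpos_of_le`) the value is the unique solution of the Bellman equation, and sub- and
supersolutions bound it. Hence a solution of the optimality equations certifies an optimal policy
(`SSP.optimal_of_bellman`, `GPRO.optimal_of_bellman`), and, conversely, the value of an optimal
policy satisfies them (`ProperChain.le_stepValue_of_update`). So it suffices to match Bellman
equations locally, gadget by gadget.

*From SSP to GPRO.* A state with `k` actions becomes a chain of binary choices with exclusivity
constraints: the `u`-th one either takes the action `u`, leading to a node whose fixed edges carry
it out, or passes on to the choice `u + 1`; the last one is forced. A policy of the GPRO instance
stands for the SSP policy that uses the first action taken. Values agree along the chain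
(`SSPToGPRO.value_toPolicy`). An optimal SSP policy is lifted to an optimal GPRO policy by
making also the choices after the chosen action, which the process never meets when it starts in a
state, optimally (`SSPToGPRO.exists_optimal`).

*From GPRO to SSP.* Each free edge becomes a state with two actions. Where all the outgoing edges
are free, these states form a chain as above. Where some edge is fixed, the process draws an edge as
if all the free edges were activated, and the state of a free edge either follows it or returns to
the node, at no cost, to draw again; conditioning on the draws that are not returned yields the
distribution proportional to the weights of the activated edges (`GPROToSSP.totalWeight_mul_sub`).
Policies with several activated edges in a node with only free edges are never needed, since their
values are averages of those of single choices (`GPROToSSP.optimal_of_singleChoice`).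

*Running times.* The instances and the policies are translated by programs that are built from list
operations. A loop is polynomial if one pass increases the size of the accumulator only by an amount
bounded in terms of the other inputs (`Prog.PolyIn.fold`). To treat both cost measures at once,
numbers are measured by a height that grows additively under arithmetic, such as the length of the
longer one of the numerator and the denominator (`CostModel`).
-/

/-! ### Total cost of a chain that reaches an absorbing, cost-free target -/

/-- A Markov chain with transition matrix `Q` and transition costs `K` that reaches the absorbing,
cost-free state `τ` from everywhere. -/
structure ProperChain {n : ℕ} (Q K : Matrix (Fin n) (Fin n) ℝ) (τ : Fin n) : Prop where
  nonneg : ∀ i j, 0 ≤ Q i j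
  row_sum : ∀ i, ∑ j, Q i j = 1
  absorbing : Q τ τ = 1
  cost_free : K τ τ = 0
  reach : ∀ i, Relation.ReflTransGen (fun i j => 0 < Q i j) i τ

/-- The Bellman operator: expected cost of one transition from `i` followed by the terminal
cost `w`. -/
def stepValue {n : ℕ} (Q K : Matrix (Fin n) (Fin n) ℝ) (w : Fin n → ℝ) (i : Fin n) : ℝ :=
  ∑ j, Q i j * (K i j + w j)

namespace ProperChain

variable {n : ℕ} {Q K : Matrix (Fin n) (Fin n) ℝ} {τ : Fin n}

lemma target_row (h : ProperChain Q K τ) {j : Fin n} (hj : j ≠ τ) : Q τ j = 0 := by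
  have h1 := h.row_sum τ
  rw [← Finset.add_sum_erase _ _ (Finset.mem_univ τ), h.absorbing] at h1
  have h2 : ∑ j ∈ Finset.univ.erase τ, Q τ j = 0 := by linarith
  exact (Finset.sum_eq_zero_iff_of_nonneg fun j _ => h.nonneg τ j).1 h2 j (by simp [hj])

lemma sum_target_row (h : ProperChain Q K τ) (f : Fin n → ℝ) : ∑ j, Q τ j * f j = f τ := by
  rw [Finset.sum_eq_single τ, h.absorbing, one_mul]
  · intro j _ hj
    rw [h.target_row hj, zero_mul]
  · simp

/-- Maximum principle: a subharmonic function is at most its value at the target. -/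
lemma nonpos_of_le (h : ProperChain Q K τ) {x : Fin n → ℝ} (h0 : x τ ≤ 0)
    (hx : ∀ i, i ≠ τ → x i ≤ ∑ j, Q i j * x j) (i : Fin n) : x i ≤ 0 := by
  obtain ⟨m, -, hm⟩ := Finset.exists_max_image Finset.univ x ⟨i, Finset.mem_univ i⟩
  refine (hm i (Finset.mem_univ i)).trans ?_
  -- the set where the maximum is attained is closed under possible transitions
  have key : ∀ k, Relation.ReflTransGen (fun i j => 0 < Q i j) m k → x k = x m := by
    intro k hk
    induction hk with
    | refl => rfl
    | @tail a b _ hab ih =>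
      by_cases ha : a = τ
      · subst ha
        by_cases hb : b = a
        · rw [hb, ih]
        · exact absurd hab (by rw [h.target_row hb]; exact lt_irrefl _)
      have h1 := hx a ha
      have h2 : ∑ j, Q a j * (x m - x j) = x m - ∑ j, Q a j * x j := by
        simp only [mul_sub, Finset.sum_sub_distrib, ← Finset.sum_mul, h.row_sum, one_mul]
      have h3 : ∑ j, Q a j * (x m - x j) = 0 := by
        refine le_antisymm (by rw [h2]; linarith) (Finset.sum_nonneg fun j _ => ?_)
        exact mul_nonneg (h.nonneg _ _) (sub_nonneg.2 (hm j (Finset.mem_univ j)))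
      have h4 := (Finset.sum_eq_zero_iff_of_nonneg fun j _ =>
        mul_nonneg (h.nonneg a j) (sub_nonneg.2 (hm j (Finset.mem_univ j)))).1 h3 b
          (Finset.mem_univ b)
      rcases mul_eq_zero.1 h4 with h5 | h5
      · exact absurd hab (by rw [h5]; exact lt_irrefl _)
      · linarith
  rw [← key τ (h.reach m)]
  exact h0

lemma pow_nonneg (h : ProperChain Q K τ) (t : ℕ) (i j : Fin n) : 0 ≤ (Q ^ t) i j := by
  induction t generalizing i j with
  | zero =>
    rw [pow_zero, Matrix.one_apply]
    split_ifs <;> norm_num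
  | succ t ih =>
    rw [pow_succ, Matrix.mul_apply]
    exact Finset.sum_nonneg fun k _ => mul_nonneg (ih i k) (h.nonneg k j)

/-- The expected time to absorption, as a solution of its linear system. By the maximum principle
the system is uniquely solvable and the solution is nonnegative. -/
lemma exists_hitting_time (h : ProperChain Q K τ) :
    ∃ u : Fin n → ℝ, (∀ i, 0 ≤ u i) ∧
      ∀ i, u i = (if i = τ then 0 else 1) + ∑ j, Q i j * u j := by
  let L : (Fin n → ℝ) →ₗ[ℝ] (Fin n → ℝ) :=
    { toFun := fun x i => if i = τ then x τ else x i - ∑ j, Q i j * x j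
      map_add' := fun x y => by
        ext i
        by_cases hi : i = τ <;> simp [hi, mul_add, Finset.sum_add_distrib]
        ring
      map_smul' := fun c x => by
        ext i
        by_cases hi : i = τ <;> simp [hi, mul_sub, Finset.mul_sum, mul_left_comm] }
  have hL : Function.Injective L := by
    rw [← LinearMap.ker_eq_bot, LinearMap.ker_eq_bot']
    intro x hx
    have hτ : x τ = 0 := by simpa [L] using congrFun hx τ
    have hi : ∀ i, i ≠ τ → x i = ∑ j, Q i j * x j := fun i hi => by
      have := congrFun hx i
      simp only [L, LinearMap.coe_mk, AddHom.coe_mk, hi, if_false, Pi.zero_apply] at this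
      linarith
    ext i
    refine le_antisymm (h.nonpos_of_le hτ.le (fun i h' => (hi i h').le) i) ?_
    have := h.nonpos_of_le (x := fun i => -x i) (by simp [hτ])
      (fun i h' => by simp [← hi i h']) i
    simpa using this
  obtain ⟨u, hu⟩ := (LinearMap.injective_iff_surjective.1 hL) fun i => if i = τ then 0 else 1
  have hτ : u τ = 0 := by simpa [L] using congrFun hu τ
  have hi : ∀ i, i ≠ τ → u i = 1 + ∑ j, Q i j * u j := fun i hi => by
    have := congrFun hu i
    simp only [L, LinearMap.coe_mk, AddHom.coe_mk, hi, if_false] at this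
    linarith
  refine ⟨u, fun i => ?_, fun i => ?_⟩
  · have := h.nonpos_of_le (x := fun i => -u i) (by simp [hτ])
      (fun i h' => by
        have := hi i h'
        simp only [mul_neg, Finset.sum_neg_distrib]
        linarith) i
    simpa using this
  · by_cases h' : i = τ
    · subst h'
      simp [h.sum_target_row]
    · simp [h', hi i h']

/-- The expected number of visits to a state other than the target is finite. -/
lemma summable_pow (h : ProperChain Q K τ) (i : Fin n) {j : Fin n} (hj : j ≠ τ) :
    Summable fun t => (Q ^ t) i j := by
  obtain ⟨u, hu0, hu⟩ := h.exists_hitting_time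
  have hpart : ∀ T i, ∑ t ∈ Finset.range T, (∑ k, (Q ^ t) i k * if k = τ then 0 else 1)
      + ∑ k, (Q ^ T) i k * u k = u i := by
    intro T i
    induction T with
    | zero => simp [Matrix.one_apply]
    | succ T ih =>
      rw [Finset.sum_range_succ, ← ih, add_assoc]
      congr 1
      have : ∑ k, (Q ^ (T + 1)) i k * u k = ∑ k, (Q ^ T) i k * ∑ l, Q k l * u l := by
        simp only [pow_succ, Matrix.mul_apply, Finset.sum_mul, Finset.mul_sum, mul_assoc]
        rw [Finset.sum_comm]
      rw [this, ← Finset.sum_add_distrib]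
      refine Finset.sum_congr rfl fun k _ => ?_
      rw [← mul_add, ← hu k]
  refine summable_of_sum_range_le (c := u i) (fun t => h.pow_nonneg t i j) fun T => ?_
  rw [← hpart T i]
  refine le_add_of_le_of_nonneg (Finset.sum_le_sum fun t _ => ?_)
    (Finset.sum_nonneg fun k _ => mul_nonneg (h.pow_nonneg _ _ _) (hu0 k))
  calc (Q ^ t) i j = (Q ^ t) i j * if j = τ then 0 else 1 := by simp [hj]
    _ ≤ _ := Finset.single_le_sum (f := fun k => (Q ^ t) i k * if k = τ then (0 : ℝ) else 1)
        (fun k _ => mul_nonneg (h.pow_nonneg _ _ _) (by split_ifs <;> norm_num))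
        (Finset.mem_univ j)

lemma summable_cost (h : ProperChain Q K τ) (i : Fin n) :
    Summable fun t => ∑ j, (Q ^ t) i j * ∑ l, Q j l * K j l := by
  refine summable_sum fun j _ => ?_
  by_cases hj : j = τ
  · subst hj
    simp [h.sum_target_row, h.cost_free]
  · exact (h.summable_pow i hj).mul_right _

lemma value_target (h : ProperChain Q K τ) : expectedTotalCost Q K τ = 0 := by
  have key : ∀ t : ℕ, ∑ j, (Q ^ t) τ j * ∑ l, Q j l * K j l = 0 := by
    intro t
    induction t with
    | zero => simp [Matrix.one_apply, h.sum_target_row, h.cost_free]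
    | succ t ih =>
      simp only [pow_succ', Matrix.mul_apply, h.sum_target_row]
      exact ih
  simp [expectedTotalCost, key]

/-- The value is a fixed point of the Bellman operator. -/
lemma value_eq (h : ProperChain Q K τ) (i : Fin n) :
    expectedTotalCost Q K i = stepValue Q K (expectedTotalCost Q K) i := by
  rw [expectedTotalCost, (h.summable_cost i).tsum_eq_zero_add]
  have h1 : ∀ t : ℕ, ∑ j, (Q ^ (t + 1)) i j * ∑ l, Q j l * K j l
      = ∑ k, Q i k * ∑ j, (Q ^ t) k j * ∑ l, Q j l * K j l := by
    intro t
    simp only [pow_succ', Matrix.mul_apply, Finset.sum_mul]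
    rw [Finset.sum_comm]
    simp only [Finset.mul_sum, mul_assoc]
  simp only [h1]
  rw [Summable.tsum_finsetSum fun k _ => (h.summable_cost k).mul_left _]
  simp only [tsum_mul_left, stepValue, mul_add, Finset.sum_add_distrib]
  simp [Matrix.one_apply, expectedTotalCost]

lemma stepValue_sub (Q K : Matrix (Fin n) (Fin n) ℝ) (w w' : Fin n → ℝ) (i : Fin n) :
    stepValue Q K w i - stepValue Q K w' i = ∑ j, Q i j * (w j - w' j) := by
  rw [stepValue, stepValue, ← Finset.sum_sub_distrib]
  exact Finset.sum_congr rfl fun j _ => by ring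

/-- A subsolution of the Bellman equation bounds the value from below. -/
lemma le_value (h : ProperChain Q K τ) {w : Fin n → ℝ} (h0 : w τ ≤ 0)
    (hw : ∀ i, i ≠ τ → w i ≤ stepValue Q K w i) (i : Fin n) : w i ≤ expectedTotalCost Q K i := by
  refine sub_nonpos.1 (h.nonpos_of_le (x := fun i => w i - expectedTotalCost Q K i)
    (by simpa [h.value_target] using h0) (fun i hi => ?_) i)
  rw [← stepValue_sub, ← h.value_eq]
  exact sub_le_sub_right (hw i hi) _

/-- A supersolution of the Bellman equation bounds the value from above. -/
lemma value_le (h : ProperChain Q K τ) {w : Fin n → ℝ} (h0 : 0 ≤ w τ)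
    (hw : ∀ i, i ≠ τ → stepValue Q K w i ≤ w i) (i : Fin n) : expectedTotalCost Q K i ≤ w i := by
  refine sub_nonpos.1 (h.nonpos_of_le (x := fun i => expectedTotalCost Q K i - w i)
    (by simpa [h.value_target] using h0) (fun i hi => ?_) i)
  rw [← stepValue_sub, ← h.value_eq]
  exact sub_le_sub_left (hw i hi) _

/-- The Bellman equation determines the value. -/
lemma value_unique (h : ProperChain Q K τ) {w : Fin n → ℝ} (h0 : w τ = 0)
    (hw : ∀ i, i ≠ τ → w i = stepValue Q K w i) (i : Fin n) : expectedTotalCost Q K i = w i :=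
  le_antisymm (h.value_le h0.ge (fun i hi => (hw i hi).ge) i)
    (h.le_value h0.le (fun i hi => (hw i hi).le) i)

/-- Policy improvement: if changing the transitions out of `i` does not lower the value anywhere,
then using the changed transitions only once does not lower it either. -/
lemma le_stepValue_of_update {Q' K' : Matrix (Fin n) (Fin n) ℝ} (h : ProperChain Q K τ)
    (h' : ProperChain Q' K' τ) (i : Fin n)
    (hrow : ∀ k, k ≠ i → ∀ j, Q' k j = Q k j ∧ (Q k j ≠ 0 → K' k j = K k j))
    (hle : ∀ k, expectedTotalCost Q K k ≤ expectedTotalCost Q' K' k) :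
    expectedTotalCost Q K i ≤ stepValue Q' K' (expectedTotalCost Q K) i := by
  by_contra! hlt
  have hrow' : ∀ k, k ≠ i → stepValue Q' K' (expectedTotalCost Q K) k
      = expectedTotalCost Q K k := by
    intro k hk
    rw [h.value_eq k]
    refine Finset.sum_congr rfl fun j _ => ?_
    rw [(hrow k hk j).1]
    by_cases h0 : Q k j = 0
    · simp [h0]
    · rw [(hrow k hk j).2 h0]
  have hge : ∀ k, expectedTotalCost Q' K' k ≤ expectedTotalCost Q K k := by
    refine h'.value_le h.value_target.ge fun k _ => ?_
    by_cases hk : k = i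
    · subst hk; exact hlt.le
    · exact (hrow' k hk).le
  have heq : expectedTotalCost Q K = expectedTotalCost Q' K' :=
    funext fun k => le_antisymm (hle k) (hge k)
  rw [heq, ← h'.value_eq] at hlt
  exact lt_irrefl _ hlt

end ProperChain

/-! ### Cost models and polynomial time -/

namespace Data

lemma size_pos (w : ℝ → ℕ) (x : Data) : 0 < x.size w := by
  cases x <;> simp [size]

lemma size_ofBool_le (w : ℝ → ℕ) (b : Bool) : (ofBool b).size w ≤ 3 := by
  cases b <;> simp [ofBool, size]

end Data

lemma Polynomial.eval_nat_mono (T : Polynomial ℕ) {a b : ℕ} (h : a ≤ b) : T.eval a ≤ T.eval b := by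
  rw [Polynomial.eval_eq_sum, Polynomial.eval_eq_sum]
  exact Finset.sum_le_sum fun i _ => Nat.mul_le_mul_left _ (Nat.pow_le_pow_left h i)

/-- What the running time analysis needs to know about a way `w` of measuring the length of
numbers: it is equivalent to a height `h` that grows additively under arithmetic. The predicate `R`
singles out the inputs on which `w` is meaningful. -/
structure CostModel where
  w : ℝ → ℕ
  h : ℝ → ℕ
  R : Data → Prop
  R_nil : R .nil
  R_num : ∀ q : ℚ, R (.num q)
  R_cons : ∀ a b, R (.cons a b) ↔ R a ∧ R b
  R_arith : ∀ op x y, R (.num x) → R (.num y) → R (.num (ArithOp.apply op x y))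
  h_le : ∀ x, R (.num x) → h x ≤ w x
  le_h : ∀ x, R (.num x) → w x ≤ 2 * h x + 1
  h_arith : ∀ op x y, R (.num x) → R (.num y) → h (ArithOp.apply op x y) ≤ h x + h y + 1

/-- Unit cost arithmetic. -/
def CostModel.unit : CostModel where
  w := unitLength
  h := fun _ => 1
  R := fun _ => True
  R_nil := trivial
  R_num _ := trivial
  R_cons _ _ := by simp
  R_arith _ _ _ _ _ := trivial
  h_le _ _ := le_rfl
  le_h _ _ := by simp [unitLength]
  h_arith _ _ _ _ _ := by norm_num

/-- Maximum of the binary lengths of the numerator and of the denominator. -/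
def Rat.bitHeight (q : ℚ) : ℕ := max q.num.natAbs.size q.den.size

lemma Rat.bitHeight_le_iff (q : ℚ) (k : ℕ) :
    q.bitHeight ≤ k ↔ q.num.natAbs < 2 ^ k ∧ q.den < 2 ^ k := by
  rw [Rat.bitHeight, max_le_iff, Nat.size_le, Nat.size_le]

lemma Rat.bitHeight_divInt_le (a b : ℤ) (k : ℕ) (ha : a.natAbs < 2 ^ k) (hb : b.natAbs < 2 ^ k)
    (hb0 : b ≠ 0) : ((a : ℚ) / b).bitHeight ≤ k := by
  rw [Rat.bitHeight_le_iff, ← Rat.divInt_eq_div]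
  constructor
  · by_cases h0 : a = 0
    · subst h0; simp
    · exact lt_of_le_of_lt (Nat.le_of_dvd (Int.natAbs_pos.2 h0)
        (Int.natAbs_dvd_natAbs.2 (Rat.num_dvd a hb0))) ha
  · have h1 := Int.natAbs_dvd_natAbs.2 (Rat.den_dvd a b)
    rw [Int.natAbs_natCast] at h1
    exact lt_of_le_of_lt (Nat.le_of_dvd (Int.natAbs_pos.2 hb0) h1) hb

lemma Rat.bitHeight_add_le (p q : ℚ) : (p + q).bitHeight ≤ p.bitHeight + q.bitHeight + 1 := by
  obtain ⟨hp, hp'⟩ := (p.bitHeight_le_iff _).1 le_rfl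
  obtain ⟨hq, hq'⟩ := (q.bitHeight_le_iff _).1 le_rfl
  have : p + q = ((p.num * q.den + q.num * p.den : ℤ) : ℚ) / ((p.den * q.den : ℤ) : ℚ) := by
    conv_lhs => rw [← Rat.num_div_den p, ← Rat.num_div_den q]
    have h1 : (p.den : ℚ) ≠ 0 := by exact_mod_cast p.den_nz
    have h2 : (q.den : ℚ) ≠ 0 := by exact_mod_cast q.den_nz
    push_cast
    field_simp
  rw [this]
  refine Rat.bitHeight_divInt_le _ _ _ ?_ ?_ (by simp)
  · refine lt_of_le_of_lt (Int.natAbs_add_le _ _) ?_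
    rw [Int.natAbs_mul, Int.natAbs_mul, Int.natAbs_natCast, Int.natAbs_natCast, pow_succ, pow_add]
    have h1 := Nat.mul_lt_mul'' hp hq'
    have h2 := Nat.mul_lt_mul'' hq hp'
    nlinarith
  · rw [Int.natAbs_mul, Int.natAbs_natCast, Int.natAbs_natCast, pow_succ, pow_add]
    have h1 := Nat.mul_lt_mul'' hp' hq'
    nlinarith

lemma Rat.bitHeight_mul_le (p q : ℚ) : (p * q).bitHeight ≤ p.bitHeight + q.bitHeight := by
  obtain ⟨hp, hp'⟩ := (p.bitHeight_le_iff _).1 le_rfl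
  obtain ⟨hq, hq'⟩ := (q.bitHeight_le_iff _).1 le_rfl
  have : p * q = ((p.num * q.num : ℤ) : ℚ) / ((p.den * q.den : ℤ) : ℚ) := by
    conv_lhs => rw [← Rat.num_div_den p, ← Rat.num_div_den q]
    push_cast
    rw [div_mul_div_comm]
  rw [this]
  refine Rat.bitHeight_divInt_le _ _ _ ?_ ?_ (by simp)
  · rw [Int.natAbs_mul, pow_add]
    exact Nat.mul_lt_mul'' hp hq
  · rw [Int.natAbs_mul, Int.natAbs_natCast, Int.natAbs_natCast, pow_add]
    exact Nat.mul_lt_mul'' hp' hq'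

lemma Rat.bitHeight_neg (p : ℚ) : (-p).bitHeight = p.bitHeight := by
  simp [Rat.bitHeight]

lemma Rat.bitHeight_inv_le (p : ℚ) : p⁻¹.bitHeight ≤ p.bitHeight := by
  by_cases h0 : p = 0
  · subst h0; simp
  obtain ⟨hp, hp'⟩ := (p.bitHeight_le_iff _).1 le_rfl
  have : p⁻¹ = ((p.den : ℤ) : ℚ) / (p.num : ℚ) := by
    conv_lhs => rw [← Rat.num_div_den p]
    rw [inv_div]; rfl
  rw [this]
  exact Rat.bitHeight_divInt_le _ _ _ (by simpa using hp') hp (by simpa using h0)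

lemma bitLength_ratCast (q : ℚ) : bitLength q = q.num.natAbs.size + q.den.size + 1 := by
  have h : ∃ r : ℚ, (r : ℝ) = (q : ℝ) := ⟨q, rfl⟩
  have h' : h.choose = q := Rat.cast_injective h.choose_spec
  rw [bitLength, dif_pos h, h']

open Classical in
/-- The bit height of a rational number, as a function on the reals; as for `bitLength`, the value
`0` at irrational numbers has no meaning. -/
noncomputable def realBitHeight (x : ℝ) : ℕ :=
  if h : ∃ q : ℚ, (q : ℝ) = x then h.choose.bitHeight else 0

lemma realBitHeight_ratCast (q : ℚ) : realBitHeight q = q.bitHeight := by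
  have h : ∃ r : ℚ, (r : ℝ) = (q : ℝ) := ⟨q, rfl⟩
  rw [realBitHeight, dif_pos h, Rat.cast_injective h.choose_spec]

/-- Binary encoding of rational numbers. -/
noncomputable def CostModel.bit : CostModel where
  w := bitLength
  h := realBitHeight
  R := Data.IsRational
  R_nil := trivial
  R_num q := ⟨q, rfl⟩
  R_cons _ _ := Iff.rfl
  R_arith op x y := by
    rintro ⟨p, rfl⟩ ⟨q, rfl⟩
    cases op
    · exact ⟨p + q, by simp [ArithOp.apply]⟩
    · exact ⟨p - q, by simp [ArithOp.apply]⟩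
    · exact ⟨p * q, by simp [ArithOp.apply]⟩
    · exact ⟨p / q, by simp [ArithOp.apply]⟩
  h_le x := by
    rintro ⟨q, rfl⟩
    rw [bitLength_ratCast, realBitHeight_ratCast, Rat.bitHeight]
    omega
  le_h x := by
    rintro ⟨q, rfl⟩
    rw [bitLength_ratCast, realBitHeight_ratCast, Rat.bitHeight]
    omega
  h_arith op x y := by
    rintro ⟨p, rfl⟩ ⟨q, rfl⟩
    rw [realBitHeight_ratCast, realBitHeight_ratCast]
    cases op <;> simp only [ArithOp.apply]
    · rw [← Rat.cast_add, realBitHeight_ratCast]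
      exact Rat.bitHeight_add_le p q
    · rw [← Rat.cast_sub, realBitHeight_ratCast, sub_eq_add_neg, ← Rat.bitHeight_neg q]
      exact Rat.bitHeight_add_le p (-q)
    · rw [← Rat.cast_mul, realBitHeight_ratCast]
      exact (Rat.bitHeight_mul_le p q).trans (Nat.le_succ _)
    · rw [← Rat.cast_div, realBitHeight_ratCast, div_eq_mul_inv]
      have := Rat.bitHeight_mul_le p q⁻¹
      have := Rat.bitHeight_inv_le q
      omega

namespace CostModel

variable (M : CostModel)

lemma R_fst {x : Data} (h : M.R x) : M.R x.fst := by
  cases x with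
  | cons a b => exact ((M.R_cons a b).1 h).1
  | _ => exact M.R_nil

lemma R_snd {x : Data} (h : M.R x) : M.R x.snd := by
  cases x with
  | cons a b => exact ((M.R_cons a b).1 h).2
  | _ => exact M.R_nil

lemma R_ofBool (b : Bool) : M.R (Data.ofBool b) := by
  cases b
  · exact M.R_nil
  · exact (M.R_cons _ _).2 ⟨M.R_nil, M.R_nil⟩

lemma R_fold {step : Data → Data → Data} {init d : Data} (hi : M.R init) (hd : M.R d)
    (hs : ∀ a acc, M.R a → M.R acc → M.R (step a acc)) : M.R (Data.fold step init d) := by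
  induction d with
  | nil => exact hi
  | num x => exact hi
  | cons a t _ ih =>
    rw [M.R_cons] at hd
    exact hs _ _ hd.1 (ih hd.2)

/-- Programs do not leave the domain of the cost model, as the constants in them are rational. -/
lemma R_eval (p : Prog) {x : Data} (h : M.R x) : M.R (p.eval x) := by
  induction p generalizing x with
  | id => exact h
  | nil => exact M.R_nil
  | num q => exact M.R_num q
  | fst => exact M.R_fst h
  | snd => exact M.R_snd h
  | cons f g hf hg => exact (M.R_cons _ _).2 ⟨hf h, hg h⟩
  | comp f g hf hg => exact hf (hg h)
  | ite c f g _ hf hg =>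
    simp only [Prog.eval]
    split
    · exact hg h
    · exact hf h
  | fold f z l hf hz hl =>
    exact M.R_fold (hz h) (hl h) fun a acc ha hacc =>
      hf ((M.R_cons _ _).2 ⟨h, (M.R_cons _ _).2 ⟨ha, hacc⟩⟩)
  | arith op f g hf hg =>
    simp only [Prog.eval]
    have h1 := hf h
    have h2 := hg h
    cases hf' : f.eval x <;> cases hg' : g.eval x <;>
      first
      | exact M.R_nil
      | exact M.R_arith op _ _ (hf' ▸ h1) (hg' ▸ h2)
  | lt f g _ _ =>
    simp only [Prog.eval]
    cases f.eval x <;> cases g.eval x <;> first | exact M.R_nil | exact M.R_ofBool _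
  | eq f g _ _ => exact M.R_ofBool _

/-- The size of a tree when numbers are measured by their height. Unlike the size, it grows
additively when numbers are summed up. -/
def height : Data → ℕ := Data.size M.h

lemma height_cons (a b : Data) : M.height (.cons a b) = M.height a + M.height b + 1 := rfl

lemma height_le {x : Data} (hx : M.R x) : M.height x ≤ x.size M.w := by
  induction x with
  | nil => exact le_rfl
  | num x => exact Nat.succ_le_succ (M.h_le x hx)
  | cons a b iha ihb =>
    rw [M.R_cons] at hx
    have := iha hx.1; have := ihb hx.2
    simp only [height, Data.size] at *; omega

lemma le_height {x : Data} (hx : M.R x) : x.size M.w ≤ 2 * M.height x := by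
  induction x with
  | nil => simp [height, Data.size]
  | num x => have := M.le_h x hx; simp only [Data.size, height]; omega
  | cons a b iha ihb =>
    rw [M.R_cons] at hx
    have := iha hx.1; have := ihb hx.2
    simp only [height, Data.size] at *; omega

lemma height_arith (op : ArithOp) {x y : Data} (hx : M.R x) (hy : M.R y) :
    M.height (Data.arith op x y) ≤ M.height x + M.height y + 1 := by
  cases x <;> cases y <;>
    first
    | (simp only [Data.arith, height, Data.size]; omega)
    | skip
  have := M.h_arith op _ _ hx hy
  simp only [Data.arith, height, Data.size]
  omega

end CostModel

namespace Prog

/-- The running time of `p` is bounded by a polynomial of the size of the input. -/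
def PolyIn (M : CostModel) (p : Prog) : Prop :=
  ∃ T : Polynomial ℕ, ∀ x, M.R x → p.cost M.w x ≤ T.eval (x.size M.w)

/-- The output has to be written down, so its size is at most the running time. -/
lemma size_eval_le_cost (w : ℝ → ℕ) (p : Prog) (x : Data) :
    (p.eval x).size w ≤ p.cost w x := by
  induction p generalizing x with
  | id => simp [eval, cost]
  | nil => simp [eval, cost, Data.size]
  | num q => simp [eval, cost, Data.size]
  | fst =>
    cases x <;> simp only [eval, cost, Data.fst, Data.size] <;> omega
  | snd =>
    cases x <;> simp only [eval, cost, Data.snd, Data.size] <;> omega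
  | cons f g hf hg =>
    have := hf x; have := hg x
    simp only [eval, cost, Data.size]; omega
  | comp f g hf hg =>
    have := hf (g.eval x)
    simp only [eval, cost]; omega
  | ite c f g _ hf hg =>
    have := hf x; have := hg x
    simp only [eval, cost]
    split <;> omega
  | fold f z l hf hz hl =>
    simp only [eval, cost]
    have h0 := hz x
    cases l.eval x with
    | nil => simp only [Data.fold]; omega
    | num => simp only [Data.fold]; omega
    | cons a t =>
      simp only [Data.fold, Data.foldCost]
      have := hf (.cons x (.cons a (Data.fold (fun a acc => f.eval (.cons x (.cons a acc)))
        (z.eval x) t)))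
      omega
  | arith op f g _ _ => simp only [eval, cost]; omega
  | lt f g _ _ =>
    simp only [eval, cost]
    cases f.eval x <;> cases g.eval x <;> simp only [Data.lt, Data.size] <;> try omega
    exact (Data.size_ofBool_le _ _).trans (by omega)
  | eq f g _ _ =>
    simp only [eval, cost, Data.eq]
    exact (Data.size_ofBool_le _ _).trans (by omega)

namespace PolyIn

variable {M : CostModel} {f g c z l : Prog}

lemma size_eval (h : PolyIn M f) :
    ∃ T : Polynomial ℕ, ∀ x, M.R x → (f.eval x).size M.w ≤ T.eval (x.size M.w) := by
  obtain ⟨T, hT⟩ := h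
  exact ⟨T, fun x hx => (size_eval_le_cost _ _ _).trans (hT x hx)⟩

lemma id : PolyIn M .id := ⟨.X + 1, fun x _ => by simp [cost]⟩
lemma nil : PolyIn M .nil := ⟨2, fun x _ => by simp [cost]⟩
lemma num (q : ℚ) : PolyIn M (.num q) := ⟨.C (M.w q + 2), fun x _ => by simp [cost]⟩
lemma fst : PolyIn M .fst := ⟨.X + 1, fun x _ => by simp [cost]⟩
lemma snd : PolyIn M .snd := ⟨.X + 1, fun x _ => by simp [cost]⟩

lemma cons (hf : PolyIn M f) (hg : PolyIn M g) : PolyIn M (.cons f g) := by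
  obtain ⟨T, hT⟩ := hf
  obtain ⟨U, hU⟩ := hg
  refine ⟨T + U + 1, fun x hx => ?_⟩
  have := hT x hx; have := hU x hx
  simp only [cost, Polynomial.eval_add, Polynomial.eval_one]; omega

lemma comp (hf : PolyIn M f) (hg : PolyIn M g) : PolyIn M (.comp f g) := by
  obtain ⟨T, hT⟩ := hf
  obtain ⟨U, hU⟩ := hg
  refine ⟨U + T.comp U + 1, fun x hx => ?_⟩
  have h1 := hU x hx
  have h2 := hT _ (M.R_eval g hx)
  have h3 := T.eval_nat_mono ((size_eval_le_cost M.w g x).trans h1)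
  simp only [cost, Polynomial.eval_add, Polynomial.eval_one, Polynomial.eval_comp]; omega

lemma ite (hc : PolyIn M c) (hf : PolyIn M f) (hg : PolyIn M g) : PolyIn M (.ite c f g) := by
  obtain ⟨S, hS⟩ := hc
  obtain ⟨T, hT⟩ := hf
  obtain ⟨U, hU⟩ := hg
  refine ⟨S + T + U + 1, fun x hx => ?_⟩
  have := hT x hx; have := hU x hx; have := hS x hx
  simp only [cost, Polynomial.eval_add, Polynomial.eval_one]
  split <;> omega

lemma arith (op : ArithOp) (hf : PolyIn M f) (hg : PolyIn M g) : PolyIn M (.arith op f g) := by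
  obtain ⟨T, hT⟩ := hf
  obtain ⟨U, hU⟩ := hg
  refine ⟨3 * (T + U + 1), fun x hx => ?_⟩
  have h1 := hT x hx; have h2 := hU x hx
  have hRf := M.R_eval f hx
  have hRg := M.R_eval g hx
  have hR : M.R ((Prog.arith op f g).eval x) := M.R_eval _ hx
  have h3 := M.le_height hR
  have h4 := M.height_arith op hRf hRg
  have h5 := M.height_le hRf
  have h6 := M.height_le hRg
  have h7 := size_eval_le_cost M.w f x
  have h8 := size_eval_le_cost M.w g x
  simp only [eval] at h3
  simp only [cost, Polynomial.eval_add, Polynomial.eval_one, Polynomial.eval_mul,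
    Polynomial.eval_ofNat]
  omega

lemma lt (hf : PolyIn M f) (hg : PolyIn M g) : PolyIn M (.lt f g) := by
  obtain ⟨T, hT⟩ := hf
  obtain ⟨U, hU⟩ := hg
  refine ⟨T + U + 4, fun x hx => ?_⟩
  have := hT x hx; have := hU x hx
  simp only [cost, Polynomial.eval_add, Polynomial.eval_ofNat]; omega

lemma eq (hf : PolyIn M f) (hg : PolyIn M g) : PolyIn M (.eq f g) := by
  obtain ⟨T, hT⟩ := hf
  obtain ⟨U, hU⟩ := hg
  refine ⟨T + U + 4, fun x hx => ?_⟩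
  have := hT x hx; have := hU x hx
  simp only [cost, Polynomial.eval_add, Polynomial.eval_ofNat]; omega

/-- A loop takes polynomial time if its body does and if each pass through the body increases the
height of the accumulator only by an amount that is bounded in terms of the other inputs. -/
lemma fold (hf : PolyIn M f) (hz : PolyIn M z) (hl : PolyIn M l)
    (hgrow : ∃ β : Polynomial ℕ, ∀ x a acc, M.R x → M.R a → M.R acc →
      M.height (f.eval (.cons x (.cons a acc))) ≤
        M.height acc + β.eval (x.size M.w + a.size M.w)) :
    PolyIn M (.fold f z l) := by
  obtain ⟨F, hF⟩ := hf
  obtain ⟨Z, hZ⟩ := hz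
  obtain ⟨L, hL⟩ := hl
  obtain ⟨β, hβ⟩ := hgrow
  -- `B` bounds the accumulator, `A` the input of the body
  let B : Polynomial ℕ := 2 * (Z + L * β.comp (.X + L))
  let A : Polynomial ℕ := .X + L + B + 2
  refine ⟨L + Z + 1 + L * (F.comp A + A + 1), fun x hx => ?_⟩
  have hRl := M.R_eval l hx
  have hRz := M.R_eval z hx
  have hlsize := (size_eval_le_cost M.w l x).trans (hL x hx)
  have hzsize := (size_eval_le_cost M.w z x).trans (hZ x hx)
  have hRstep : ∀ a acc, M.R a → M.R acc → M.R (f.eval (.cons x (.cons a acc))) :=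
    fun a acc ha hacc => M.R_eval f ((M.R_cons _ _).2 ⟨hx, (M.R_cons _ _).2 ⟨ha, hacc⟩⟩)
  set s := x.size M.w with hs
  have hacc : ∀ d : Data, M.R d → d.size M.w ≤ L.eval s →
      M.height (Data.fold (fun a acc => f.eval (.cons x (.cons a acc))) (z.eval x) d) ≤
        Z.eval s + d.size M.w * β.eval (s + L.eval s) := by
    intro d hd hds
    have hz' := (M.height_le hRz).trans hzsize
    induction d with
    | nil => exact hz'.trans (Nat.le_add_right _ _)
    | num y => exact hz'.trans (Nat.le_add_right _ _)
    | cons a t _ ih =>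
      rw [M.R_cons] at hd
      simp only [Data.size] at hds
      have h1 := hβ x a _ hx hd.1 (M.R_fold (step := fun a acc => f.eval (.cons x (.cons a acc)))
        hRz hd.2 hRstep)
      have h2 := ih hd.2 (by omega)
      have h3 := β.eval_nat_mono (a := x.size M.w + a.size M.w) (b := s + L.eval s) (by omega)
      have h4 : (t.size M.w + 1) * β.eval (s + L.eval s) ≤
          (Data.cons a t).size M.w * β.eval (s + L.eval s) :=
        Nat.mul_le_mul_right _ (by simp only [Data.size]; omega)
      rw [add_mul, one_mul] at h4
      simp only [Data.fold]
      omega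
  have hcost : ∀ d : Data, M.R d → d.size M.w ≤ L.eval s →
      Data.foldCost (fun a acc => f.eval (.cons x (.cons a acc)))
        (fun a acc => cost M.w f (.cons x (.cons a acc)) +
          Data.size M.w (.cons x (.cons a acc)) + 1) (z.eval x) d ≤
        d.size M.w * ((F.comp A).eval s + A.eval s + 1) := by
    intro d hd hds
    induction d with
    | nil => exact Nat.zero_le _
    | num y => exact Nat.zero_le _
    | cons a t _ ih =>
      have hd' := (M.R_cons _ _).1 hd
      have hds' := hds
      simp only [Data.size] at hds'
      have h1 := ih hd'.2 (by omega)
      have hRacc := M.R_fold (step := fun a acc => f.eval (.cons x (.cons a acc)))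
        hRz hd'.2 hRstep
      have h2 := hacc t hd'.2 (by omega)
      have h3 := M.le_height hRacc
      simp only [Data.foldCost]
      set acc := Data.fold (fun a acc => f.eval (.cons x (.cons a acc))) (z.eval x) t
      have hB : B.eval s = 2 * (Z.eval s + L.eval s * β.eval (s + L.eval s)) := by
        simp [B]
      have hA : A.eval s = s + L.eval s + B.eval s + 2 := by simp [A]
      have h4 : t.size M.w * β.eval (s + L.eval s) ≤ L.eval s * β.eval (s + L.eval s) :=
        Nat.mul_le_mul_right _ (by omega)
      have h5 : Data.size M.w (.cons x (.cons a acc)) ≤ A.eval s := by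
        simp only [Data.size]; omega
      have h6 := hF (.cons x (.cons a acc))
        ((M.R_cons _ _).2 ⟨hx, (M.R_cons _ _).2 ⟨hd'.1, hRacc⟩⟩)
      have h7 := F.eval_nat_mono h5
      have h8 : (t.size M.w + 1) * ((F.comp A).eval s + A.eval s + 1) ≤
          (Data.cons a t).size M.w * ((F.comp A).eval s + A.eval s + 1) :=
        Nat.mul_le_mul_right _ (by simp only [Data.size]; omega)
      rw [add_mul, one_mul] at h8
      have h9 : (F.comp A).eval s = F.eval (A.eval s) := Polynomial.eval_comp
      omega
  have h1 := hcost _ hRl hlsize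
  have h2 : (l.eval x).size M.w * ((F.comp A).eval s + A.eval s + 1) ≤
      L.eval s * ((F.comp A).eval s + A.eval s + 1) := Nat.mul_le_mul_right _ hlsize
  have h3 : cost M.w l x ≤ L.eval s := hL x hx
  have h4 : cost M.w z x ≤ Z.eval s := hZ x hx
  simp only [cost, Polynomial.eval_add, Polynomial.eval_one, Polynomial.eval_mul]
  omega

end PolyIn

/-- A single polynomial bounds the running times of two programs in both cost models. -/
lemma exists_runsInTime {p q : Prog} (hp : ∀ M, PolyIn M p) (hq : ∀ M, PolyIn M q) :
    ∃ T : Polynomial ℕ, ∀ x, p.RunsInTime T x ∧ q.RunsInTime T x := by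
  obtain ⟨T1, h1⟩ := hp .unit
  obtain ⟨T2, h2⟩ := hp .bit
  obtain ⟨T3, h3⟩ := hq .unit
  obtain ⟨T4, h4⟩ := hq .bit
  refine ⟨T1 + T2 + T3 + T4, fun x => ⟨⟨?_, fun hx => ?_⟩, ?_, fun hx => ?_⟩⟩ <;>
    simp only [Polynomial.eval_add]
  · have : cost unitLength p x ≤ _ := h1 x trivial
    simp only [CostModel.unit] at this
    omega
  · have : cost bitLength p x ≤ _ := h2 x hx
    simp only [CostModel.bit] at this
    omega
  · have : cost unitLength q x ≤ _ := h3 x trivial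
    simp only [CostModel.unit] at this
    omega
  · have : cost bitLength q x ≤ _ := h4 x hx
    simp only [CostModel.bit] at this
    omega

end Prog

/-! ### List processing programs -/

namespace Data

lemma ofList_ne_nil_iff {l : List Data} : ofList l ≠ nil ↔ l ≠ [] := by
  cases l <;> simp [ofList]

lemma ofNat_zero : ofNat 0 = nil := rfl

lemma ofNat_succ (k : ℕ) : ofNat (k + 1) = cons nil (ofNat k) := rfl

lemma ofNat_injective : Function.Injective ofNat := by
  intro a b h
  induction a generalizing b with
  | zero => cases b with
    | zero => rfl
    | succ b => simp [ofNat_zero, ofNat_succ] at h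
  | succ a ih => cases b with
    | zero => simp [ofNat_zero, ofNat_succ] at h
    | succ b =>
      simp only [ofNat_succ, cons.injEq, true_and] at h
      rw [ih h]

@[simp] lemma ofNat_inj {a b : ℕ} : ofNat a = ofNat b ↔ a = b := ofNat_injective.eq_iff

@[simp] lemma ofBool_eq_nil {b : Bool} : ofBool b = nil ↔ b = false := by
  cases b <;> simp [ofBool]

lemma fold_ofList (step : Data → Data → Data) (init : Data) (l : List Data) :
    fold step init (ofList l) = l.foldr step init := by
  induction l with
  | nil => rfl
  | cons a l ih => simp only [ofList, fold, ih, List.foldr_cons]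

end Data

namespace Prog

/-! The body of a loop sees the pair of its surroundings and the current list entry. -/

/-- Inside the body of a fold: the surroundings and the current list entry. -/
def entry : Prog := cons fst (comp fst snd)

/-- Inside the body of a fold: the accumulator. -/
def acc : Prog := comp snd snd

/-- Truth: every tree other than `nil` counts as true. -/
def tt : Prog := cons nil nil

def not (c : Prog) : Prog := ite c nil tt

def and (c d : Prog) : Prog := ite c d nil

def or (c d : Prog) : Prog := ite c tt d

/-- Drop from the list `l` as many entries as the list `k` has. -/
def drop (k l : Prog) : Prog := fold (comp snd acc) l k

/-- The entry of the list `l` at the position `k`, a unary number. -/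
def nth (k l : Prog) : Prog := comp fst (drop k l)

/-- Apply `g` to every entry of `l`. -/
def map (g l : Prog) : Prog := fold (cons (comp g entry) acc) nil l

/-- The list `k` followed by the list `l`. -/
def append (k l : Prog) : Prog := fold (cons (comp fst snd) acc) l k

/-- The concatenation of the lists that `g` makes from the entries of `l`. -/
def flatMap (g l : Prog) : Prog :=
  fold (comp (append fst snd) (cons (comp g entry) acc)) nil l

/-- The test whether some entry of `l` passes the test `g`. -/
def any (g l : Prog) : Prog := fold (ite (comp g entry) tt acc) nil l

/-- The first entry of `l` that passes the test `g`, and `d` if there is none. -/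
def find (g d l : Prog) : Prog := fold (ite (comp g entry) (comp fst snd) acc) d l

/-- The sum of the numbers that `g` makes from the entries of `l`. -/
def sum (g l : Prog) : Prog := fold (arith .add (comp g entry) acc) (num 0) l

/-- The positions in the list `l`. With the length written as a unary number `N`, the position
before a suffix of length `k` is obtained by dropping `k + 1` entries from `N`. -/
def range (l : Prog) : Prog :=
  fold (cons (drop (cons nil acc) (map nil (comp l fst))) acc) nil l

section eval

variable {x : Data} {α : Type*} {L : List α} {code : α → Data}

lemma eval_ite (c f g : Prog) (x : Data) [Decidable (eval c x = .nil)] :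
    eval (ite c f g) x = if eval c x = .nil then eval g x else eval f x := by
  split_ifs with h
  · simp only [eval, h]
  · simp only [eval]

lemma eval_ite_of {c : Prog} {p : Prop} [Decidable p] (hc : eval c x ≠ .nil ↔ p) (f g : Prog) :
    eval (ite c f g) x = if p then eval f x else eval g x := by
  classical
  rw [eval_ite]
  by_cases hp : p
  · rw [if_pos hp, if_neg (hc.2 hp)]
  · rw [if_neg hp, if_pos (by by_contra h; exact hp (hc.1 h))]

lemma eval_not_ne_nil (c : Prog) : eval (not c) x ≠ .nil ↔ ¬ eval c x ≠ .nil := by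
  classical
  rw [not, eval_ite]
  by_cases h : eval c x = .nil <;> simp [h, eval, tt]

lemma eval_and_ne_nil (c d : Prog) :
    eval (and c d) x ≠ .nil ↔ eval c x ≠ .nil ∧ eval d x ≠ .nil := by
  classical
  rw [and, eval_ite]
  by_cases h : eval c x = .nil <;> simp [h, eval]

lemma eval_or_ne_nil (c d : Prog) :
    eval (or c d) x ≠ .nil ↔ eval c x ≠ .nil ∨ eval d x ≠ .nil := by
  classical
  rw [or, eval_ite]
  by_cases h : eval c x = .nil <;> simp [h, eval, tt]

lemma eval_eq_ne_nil (f g : Prog) : eval (eq f g) x ≠ .nil ↔ eval f x = eval g x := by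
  simp [eval, Data.eq]

lemma eval_cons (f g : Prog) : eval (cons f g) x = .cons (eval f x) (eval g x) := rfl
lemma eval_comp (f g : Prog) : eval (comp f g) x = eval f (eval g x) := rfl
lemma eval_snd (a b : Data) : eval snd (.cons a b) = b := rfl
lemma eval_num (q : ℚ) : eval (num q) x = .num q := rfl

lemma eval_bool {c : Prog} {p : Prop} [Decidable p] (hc : eval c x ≠ .nil ↔ p) :
    eval (ite c tt nil) x = .ofBool (decide p) := by
  rw [eval_ite_of hc]
  by_cases hp : p <;> simp [hp, Data.ofBool, eval, tt]

lemma eval_drop {k l : Prog} {K L : List Data} (hk : eval k x = .ofList K)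
    (hl : eval l x = .ofList L) : eval (drop k l) x = .ofList (L.drop K.length) := by
  simp only [drop, acc, eval, hk, hl, Data.fold_ofList]
  clear hk
  induction K with
  | nil => rfl
  | cons a K ih =>
    rw [List.foldr_cons, ih, List.length_cons, ← List.drop_drop, Data.snd.eq_def]
    cases L.drop K.length <;> rfl

lemma eval_drop_ofNat {k l : Prog} {K : ℕ} {L : List Data} (hk : eval k x = .ofNat K)
    (hl : eval l x = .ofList L) : eval (drop k l) x = .ofList (L.drop K) := by
  rw [eval_drop hk hl, List.length_replicate]

lemma eval_nth {k l : Prog} {n : ℕ} {c : Fin n → Data} (i : Fin n) (hk : eval k x = .ofNat i)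
    (hl : eval l x = .ofList (List.ofFn c)) : eval (nth k l) x = c i := by
  rw [nth, eval_comp, eval_drop_ofNat hk hl, List.drop_eq_getElem_cons (by simp)]
  simp [Data.ofList, eval, Data.fst]

lemma eval_map {g l : Prog} (hl : eval l x = .ofList (L.map code)) :
    eval (map g l) x = .ofList (L.map fun a => eval g (.cons x (code a))) := by
  simp only [map, entry, acc, eval, hl, Data.fold_ofList]
  clear hl
  induction L with
  | nil => rfl
  | cons a L ih =>
    simp only [List.map_cons, List.foldr_cons, ih]
    rfl

lemma eval_append {k l : Prog} {K L : List Data} (hk : eval k x = .ofList K)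
    (hl : eval l x = .ofList L) : eval (append k l) x = .ofList (K ++ L) := by
  simp only [append, acc, eval, hk, hl, Data.fold_ofList]
  clear hk
  induction K with
  | nil => rfl
  | cons a K ih =>
    rw [List.foldr_cons, ih]
    rfl

lemma eval_flatMap {g l : Prog} (hl : eval l x = .ofList (L.map code)) {G : α → List Data}
    (hg : ∀ a ∈ L, eval g (.cons x (code a)) = .ofList (G a)) :
    eval (flatMap g l) x = .ofList (L.flatMap G) := by
  simp only [flatMap, entry, acc, eval, hl, Data.fold_ofList]
  clear hl
  induction L with
  | nil => rfl
  | cons a L ih =>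
    rw [List.map_cons, List.foldr_cons, ih fun b hb => hg b (List.mem_cons_of_mem _ hb),
      List.flatMap_cons]
    refine eval_append ?_ rfl
    exact hg a List.mem_cons_self

lemma eval_any_ne_nil {g l : Prog} (hl : eval l x = .ofList (L.map code)) :
    eval (any g l) x ≠ .nil ↔ ∃ a ∈ L, eval g (.cons x (code a)) ≠ .nil := by
  classical
  rw [any, eval, hl, Data.fold_ofList]
  clear hl
  induction L with
  | nil => simp [eval]
  | cons a L ih =>
    rw [List.map_cons, List.foldr_cons, eval_ite, List.exists_mem_cons_iff, ← ih]
    simp only [entry, acc, tt, eval, Data.fst, Data.snd]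
    by_cases h : eval g (.cons x (code a)) = .nil <;> simp [h]

lemma eval_find {g d l : Prog} (hl : eval l x = .ofList (L.map code)) {p : α → Bool}
    (hp : ∀ a ∈ L, eval g (.cons x (code a)) ≠ .nil ↔ p a) :
    eval (find g d l) x = ((L.find? p).map code).getD (eval d x) := by
  classical
  rw [find, eval, hl, Data.fold_ofList]
  clear hl
  induction L with
  | nil => simp
  | cons a L ih =>
    rw [List.map_cons, List.foldr_cons, ih fun b hb => hp b (List.mem_cons_of_mem _ hb), eval_ite]
    have h1 := hp a List.mem_cons_self
    simp only [entry, acc, eval, Data.fst, Data.snd, List.find?_cons]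
    cases h : p a
    · rw [h] at h1
      rw [if_pos (by simpa using h1)]
    · rw [h] at h1
      rw [if_neg (by simpa using h1)]
      rfl

lemma eval_sum {g l : Prog} (hl : eval l x = .ofList (L.map code)) {v : α → ℝ}
    (hg : ∀ a ∈ L, eval g (.cons x (code a)) = .num (v a)) :
    eval (sum g l) x = .num (L.map v).sum := by
  rw [sum, eval, hl, Data.fold_ofList]
  clear hl
  induction L with
  | nil => simp [eval]
  | cons a L ih =>
    rw [List.map_cons, List.foldr_cons, ih fun b hb => hg b (List.mem_cons_of_mem _ hb)]
    simp only [eval, entry, acc, Data.fst, Data.snd, hg a List.mem_cons_self, Data.arith,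
      ArithOp.apply, List.map_cons, List.sum_cons]

lemma eval_range {l : Prog} {n : ℕ} {c : Fin n → Data}
    (hl : eval l x = .ofList (List.ofFn c)) :
    eval (range l) x = .ofList ((List.finRange n).map fun i : Fin n => .ofNat i) := by
  have key : ∀ m (L : List Data), L.length ≤ n → m = n - L.length →
      L.foldr (fun a acc' => eval (cons (drop (cons nil acc) (map nil (comp l fst))) acc)
        (.cons x (.cons a acc'))) .nil = .ofList ((List.range' m L.length).map Data.ofNat) := by
    intro m L hL hm
    induction L generalizing m with
    | nil => rfl
    | cons a L ih =>
      rw [List.length_cons] at hL hm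
      rw [List.foldr_cons, ih (m + 1) (by omega) (by omega), eval_cons, List.length_cons,
        List.range'_succ, List.map_cons, Data.ofList]
      congr 1
      have h1 : eval (map nil (comp l fst)) (.cons x (.cons a
          (.ofList ((List.range' (m + 1) L.length).map Data.ofNat)))) =
          .ofList (List.replicate n .nil) := by
        rw [eval_map (L := List.ofFn c) (code := _root_.id) (by simpa [eval, Data.fst] using hl)]
        simp [eval, Function.comp_def]
      rw [eval_drop (K := .nil :: (List.range' (m + 1) L.length).map Data.ofNat) rfl h1]
      simp only [List.length_cons, List.length_map, List.length_range', List.drop_replicate]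
      rw [Data.ofNat, hm]
  rw [range, eval, hl, Data.fold_ofList]
  refine (key 0 _ (by simp) (by simp)).trans ?_
  congr 1
  rw [List.length_ofFn, ← List.range_eq_range', ← List.map_coe_finRange_eq_range, List.map_map]
  rfl

end eval

namespace PolyIn

variable {M : CostModel} {f g c d z k l : Prog}

lemma entry : PolyIn M entry := .cons .fst (.comp .fst .snd)
lemma acc : PolyIn M acc := .comp .snd .snd
lemma tt : PolyIn M tt := .cons .nil .nil
lemma not (hc : PolyIn M c) : PolyIn M (not c) := .ite hc .nil .tt
lemma and (hc : PolyIn M c) (hd : PolyIn M d) : PolyIn M (and c d) := .ite hc hd .nil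
lemma or (hc : PolyIn M c) (hd : PolyIn M d) : PolyIn M (or c d) := .ite hc .tt hd

lemma height_snd_le (a : Data) : M.height a.snd ≤ M.height a := by
  cases a with
  | cons a b => simp only [Data.snd, M.height_cons]; omega
  | _ => exact Data.size_pos _ _

lemma drop (hk : PolyIn M k) (hl : PolyIn M l) : PolyIn M (drop k l) :=
  .fold (.comp .snd .acc) hl hk ⟨0, fun x a b _ _ _ => by
    simpa [eval, Prog.acc, Data.snd] using height_snd_le b⟩

lemma nth (hk : PolyIn M k) (hl : PolyIn M l) : PolyIn M (nth k l) := .comp .fst (.drop hk hl)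

/-- The growth condition for a loop in terms of what is known about the programs in its body. -/
lemma exists_growth (hg : PolyIn M g) :
    ∃ β : Polynomial ℕ, ∀ x a, M.R x → M.R a →
      M.height (eval g (.cons x a)) + a.size M.w + 5 ≤ β.eval (x.size M.w + a.size M.w) := by
  obtain ⟨T, hT⟩ := hg.size_eval
  refine ⟨T.comp (.X + 1) + .X + 5, fun x a hx ha => ?_⟩
  have h1 : M.R (.cons x a) := (M.R_cons _ _).2 ⟨hx, ha⟩
  have h2 := hT _ h1
  have h3 := M.height_le (M.R_eval g h1)
  simp only [Polynomial.eval_add, Polynomial.eval_comp, Polynomial.eval_X, Polynomial.eval_one,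
    Polynomial.eval_ofNat]
  simp only [Data.size] at h2
  omega

lemma map (hg : PolyIn M g) (hl : PolyIn M l) : PolyIn M (map g l) := by
  obtain ⟨β, hβ⟩ := hg.exists_growth
  refine .fold (.cons (.comp hg .entry) .acc) .nil hl ⟨β, fun x a b hx ha hb => ?_⟩
  have := hβ x a hx ha
  simp only [eval, Prog.entry, Prog.acc, Data.fst, Data.snd, M.height_cons]
  omega

lemma append (hk : PolyIn M k) (hl : PolyIn M l) : PolyIn M (append k l) := by
  refine .fold (.cons (.comp .fst .snd) .acc) hl hk ⟨.X + 1, fun x a b hx ha hb => ?_⟩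
  have := M.height_le ha
  simp only [eval, Prog.acc, Data.fst, Data.snd, M.height_cons, Polynomial.eval_add,
    Polynomial.eval_X, Polynomial.eval_one]
  omega

lemma height_append_le (a b : Data) :
    M.height (eval (Prog.append .fst .snd) (.cons a b)) ≤ M.height a + M.height b := by
  simp only [Prog.append, eval, Prog.acc, Data.fst, Data.snd]
  induction a with
  | cons a t _ ih =>
    simp only [Data.fold, M.height_cons]
    omega
  | _ => exact Nat.le_add_left _ _

lemma flatMap (hg : PolyIn M g) (hl : PolyIn M l) : PolyIn M (flatMap g l) := by
  obtain ⟨β, hβ⟩ := hg.exists_growth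
  refine .fold (.comp (.append .fst .snd) (.cons (.comp hg .entry) .acc)) .nil hl
    ⟨β, fun x a b hx ha hb => ?_⟩
  have := hβ x a hx ha
  rw [eval_comp, eval_cons]
  refine (height_append_le _ _).trans ?_
  simp only [eval, Prog.entry, Prog.acc, Data.fst, Data.snd]
  omega

lemma any (hg : PolyIn M g) (hl : PolyIn M l) : PolyIn M (any g l) := by
  classical
  refine .fold (.ite (.comp hg .entry) .tt .acc) .nil hl ⟨3, fun x a b hx ha hb => ?_⟩
  rw [eval_ite]
  split_ifs
  · simp [eval, Prog.acc, Data.snd]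
  · simp [eval, Prog.tt, CostModel.height, Data.size]

lemma find (hg : PolyIn M g) (hd : PolyIn M d) (hl : PolyIn M l) : PolyIn M (find g d l) := by
  classical
  refine .fold (.ite (.comp hg .entry) (.comp .fst .snd) .acc) hd hl
    ⟨.X, fun x a b hx ha hb => ?_⟩
  rw [eval_ite]
  split_ifs
  · simp [eval, Prog.acc, Data.snd]
  · have := M.height_le ha
    simp only [eval, Data.fst, Data.snd, Polynomial.eval_X]
    omega

lemma sum (hg : PolyIn M g) (hl : PolyIn M l) : PolyIn M (sum g l) := by
  obtain ⟨β, hβ⟩ := hg.exists_growth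
  refine .fold (.arith .add (.comp hg .entry) .acc) (.num 0) hl ⟨β, fun x a b hx ha hb => ?_⟩
  have h1 := hβ x a hx ha
  have h2 := M.height_arith .add (M.R_eval g ((M.R_cons _ _).2 ⟨hx, ha⟩)) hb
  simp only [eval, Prog.entry, Prog.acc, Data.fst, Data.snd]
  omega

lemma height_drop_le (k : Prog) (l : Prog) (x : Data) :
    M.height (eval (Prog.drop k l) x) ≤ M.height (eval l x) := by
  simp only [Prog.drop, eval, Prog.acc]
  induction eval k x with
  | cons a t _ ih => exact (height_snd_le _).trans ih
  | _ => exact le_rfl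

lemma range (hl : PolyIn M l) : PolyIn M (range l) := by
  have h0 : PolyIn M (.map .nil (.comp l .fst)) := .map .nil (.comp hl .fst)
  obtain ⟨β, hβ⟩ := (PolyIn.map (M := M) .nil hl).size_eval
  refine .fold (.cons (.drop (.cons .nil .acc) h0) .acc) .nil hl
    ⟨β + 1, fun x a b hx ha hb => ?_⟩
  have h1 := height_drop_le (M := M) (.cons .nil Prog.acc) (.map .nil (.comp l .fst))
    (.cons x (.cons a b))
  have h2 : eval (Prog.map .nil (.comp l .fst)) (.cons x (.cons a b)) =
      eval (Prog.map .nil l) x := by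
    simp [Prog.map, eval, Data.fst, Prog.acc, Data.snd]
  rw [h2] at h1
  have h3 := hβ x hx
  have h4 := M.height_le (M.R_eval (Prog.map .nil l) hx)
  have h5 := β.eval_nat_mono (Nat.le_add_right (x.size M.w) (a.size M.w))
  rw [eval_cons, M.height_cons]
  simp only [Polynomial.eval_add, Polynomial.eval_one]
  have h6 : eval Prog.acc (.cons x (.cons a b)) = b := rfl
  rw [h6]
  omega

end PolyIn

end Prog

/-! ### Values of GPRO policies and SSP policies -/

lemma List.find?_finRange_eq_some_iff {n : ℕ} {p : Fin n → Bool} {i : Fin n} :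
    (List.finRange n).find? p = some i ↔ p i ∧ ∀ j < i, ¬ p j := by
  rw [List.find?_eq_some_iff_getElem]
  refine and_congr_right fun _ => ⟨?_, fun h => ⟨i, by simp, by simp, fun j hj => ?_⟩⟩
  · rintro ⟨k, hk, rfl, h⟩ j hj
    have := h j (by simpa [Fin.lt_def] using hj)
    simpa using this
  · have := h ⟨j, hj.trans i.2⟩ (by simpa [Fin.lt_def] using hj)
    simpa using this

namespace SSP

variable (I : SSP)

lemma properChain (μ : I.Policy) :
    ProperChain (Matrix.of fun i j => I.P i (μ i) j) (Matrix.of fun i j => I.C i (μ i) j)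
      I.target where
  nonneg _ _ := I.P_nonneg _ _ _
  row_sum _ := I.P_sum _ _
  absorbing := I.target_absorbing _
  cost_free := I.target_cost_free _
  reach i := I.target_reachable μ i

/-- Expected cost of using the action `u` in `s` once, followed by the terminal cost `w`. -/
def actionValue (w : Fin I.n → ℝ) (s : Fin I.n) (u : Fin (I.acts s)) : ℝ :=
  ∑ s', I.P s u s' * (I.C s u s' + w s')

variable {I}

lemma value_eq (μ : I.Policy) (s : Fin I.n) :
    I.value μ s = I.actionValue (I.value μ) s (μ s) :=
  (I.properChain μ).value_eq s

lemma value_target (μ : I.Policy) : I.value μ I.target = 0 := (I.properChain μ).value_target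

lemma value_unique (μ : I.Policy) {w : Fin I.n → ℝ} (h0 : w I.target = 0)
    (hw : ∀ s, s ≠ I.target → w s = I.actionValue w s (μ s)) (s : Fin I.n) : I.value μ s = w s :=
  (I.properChain μ).value_unique h0 hw s

lemma le_value (μ : I.Policy) {w : Fin I.n → ℝ} (h0 : w I.target = 0)
    (hw : ∀ s, s ≠ I.target → w s ≤ I.actionValue w s (μ s)) (s : Fin I.n) : w s ≤ I.value μ s :=
  (I.properChain μ).le_value h0.le hw s

/-- A solution of the optimality equations certifies that the policy attaining the minima is
optimal. -/
lemma optimal_of_bellman (μ : I.Policy) {w : Fin I.n → ℝ} (h0 : w I.target = 0)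
    (hw : ∀ s, s ≠ I.target → w s = I.actionValue w s (μ s))
    (hle : ∀ s, s ≠ I.target → ∀ u, w s ≤ I.actionValue w s u) : I.Optimal μ := fun μ' s => by
  rw [value_unique μ h0 hw]
  exact le_value μ' h0 (fun s hs => hle s hs _) s

/-- The value of an optimal policy satisfies the optimality equations. -/
lemma Optimal.le_actionValue {μ : I.Policy} (h : I.Optimal μ) (s : Fin I.n)
    (u : Fin (I.acts s)) : I.value μ s ≤ I.actionValue (I.value μ) s u := by
  have := (I.properChain μ).le_stepValue_of_update (I.properChain (Function.update μ s u)) s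
    (fun k hk j => by simp [hk]) (fun k => h _ k)
  simpa [stepValue, actionValue, value] using this

end SSP

namespace GPROData

variable {G : GPROData}

lemma weight_pos_iff {μ : Finset (Fin G.n × Fin G.n)} {i j : Fin G.n} :
    0 < G.weight μ i j ↔ 0 < G.W i j ∧ ((i, j) ∈ G.F → (i, j) ∈ μ) := by
  rw [GPROData.weight]
  by_cases h : (i, j) ∈ G.F <;> by_cases h' : (i, j) ∈ μ <;> simp [h, h']

end GPROData

namespace GPRO

variable {G : GPRO}

lemma weight_nonneg (μ : Finset (Fin G.n × Fin G.n)) (i j : Fin G.n) : 0 ≤ G.weight μ i j := by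
  rw [GPROData.weight]
  split_ifs
  · exact le_rfl
  · exact G.W_nonneg i j

lemma sum_weight_pos (π : G.Policy) (i : Fin G.n) : 0 < ∑ k, G.weight π.1 i k := by
  obtain ⟨j, hj⟩ := π.2.2.1 i
  exact Finset.sum_pos' (fun k _ => weight_nonneg _ _ _) ⟨j, Finset.mem_univ j, hj⟩

lemma prob_pos_iff (π : G.Policy) {i j : Fin G.n} :
    0 < G.prob π.1 i j ↔ 0 < G.weight π.1 i j := by
  rw [GPROData.prob, div_pos_iff_of_pos_right (sum_weight_pos π i)]

lemma weight_target (μ : Finset (Fin G.n × Fin G.n)) {j : Fin G.n} (hj : j ≠ G.target) :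
    G.weight μ G.target j = 0 := by
  by_contra h
  exact hj ((G.target_edge j).1
    (GPROData.weight_pos_iff.1 (lt_of_le_of_ne (weight_nonneg μ G.target j) (Ne.symm h))).1)

lemma properChain (π : G.Policy) :
    ProperChain (Matrix.of fun i j => G.prob π.1 i j) (Matrix.of G.K) G.target where
  nonneg i j := div_nonneg (weight_nonneg _ _ _) (sum_weight_pos π i).le
  row_sum i := by
    simp only [Matrix.of_apply, GPROData.prob]
    rw [← Finset.sum_div, div_self (sum_weight_pos π i).ne']
  absorbing := by
    have h := sum_weight_pos π G.target
    have h1 : ∑ k, G.weight π.1 G.target k = G.weight π.1 G.target G.target :=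
      Finset.sum_eq_single _ (fun j _ hj => weight_target _ hj) (by simp)
    rw [h1] at h
    simp only [Matrix.of_apply, GPROData.prob, h1]
    exact div_self h.ne'
  cost_free := G.target_cost_free
  reach i := Relation.ReflTransGen.mono (fun i j h => by simpa [prob_pos_iff] using h) _ _
    (G.target_reachable π.1 π.2 i)

/-- Expected cost of one transition from `i` under `π`, followed by the terminal cost `w`. -/
noncomputable def nodeValue (π : G.Policy) (w : Fin G.n → ℝ) (i : Fin G.n) : ℝ :=
  ∑ j, G.prob π.1 i j * (G.K i j + w j)

lemma value_eq (π : G.Policy) (i : Fin G.n) :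
    G.value π i = nodeValue π (G.value π) i := (G.properChain π).value_eq i

lemma value_target (π : G.Policy) : G.value π G.target = 0 := (G.properChain π).value_target

lemma value_unique (π : G.Policy) {w : Fin G.n → ℝ} (h0 : w G.target = 0)
    (hw : ∀ i, i ≠ G.target → w i = nodeValue π w i) (i : Fin G.n) : G.value π i = w i :=
  (G.properChain π).value_unique h0 hw i

lemma le_value (π : G.Policy) {w : Fin G.n → ℝ} (h0 : w G.target = 0)
    (hw : ∀ i, i ≠ G.target → w i ≤ nodeValue π w i) (i : Fin G.n) : w i ≤ G.value π i :=
  (G.properChain π).le_value h0.le hw i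

lemma optimal_of_bellman (π : G.Policy) {w : Fin G.n → ℝ} (h0 : w G.target = 0)
    (hw : ∀ i, i ≠ G.target → w i = nodeValue π w i)
    (hle : ∀ π' : G.Policy, ∀ i, i ≠ G.target → w i ≤ nodeValue π' w i) : G.Optimal π :=
  fun π' i => by
    rw [value_unique π h0 hw]
    exact le_value π' h0 (hle π') i

/-- Multiplied by the total weight, the one-step equation involves only the weights. -/
lemma sum_weight_mul_nodeValue (π : G.Policy) (w : Fin G.n → ℝ) (i : Fin G.n) :
    (∑ j, G.weight π.1 i j) * nodeValue π w i = ∑ j, G.weight π.1 i j * (G.K i j + w j) := by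
  rw [nodeValue, Finset.mul_sum]
  refine Finset.sum_congr rfl fun j _ => ?_
  rw [GPROData.prob, ← mul_assoc, mul_div_cancel₀ _ (sum_weight_pos π i).ne']

/-- In a node with a single active edge the process follows it. -/
lemma nodeValue_of_unique (π : G.Policy) (w : Fin G.n → ℝ) {i j₀ : Fin G.n}
    (h : ∀ j, 0 < G.weight π.1 i j ↔ j = j₀) : nodeValue π w i = G.K i j₀ + w j₀ := by
  have h0 : ∀ j, j ≠ j₀ → G.weight π.1 i j = 0 := fun j hj =>
    le_antisymm (not_lt.1 fun h' => hj ((h j).1 h')) (weight_nonneg _ _ _)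
  have h1 := sum_weight_mul_nodeValue π w i
  rw [Finset.sum_eq_single j₀ (fun j _ hj => h0 j hj) (by simp),
    Finset.sum_eq_single j₀ (fun j _ hj => by rw [h0 j hj, zero_mul]) (by simp)] at h1
  exact mul_left_cancel₀ ((h j₀).2 rfl).ne' h1

end GPRO

/-! ### From SSP to GPRO: the instance -/

namespace SSPToGPRO

/-- A state together with an action available in it. -/
abbrev Action (I : SSP) : Type := (s : Fin I.n) × Fin (I.acts s)

/-- The nodes of the GPRO instance: the states; for each action, a binary choice whether to take
this action or to consider the next one of the same state; and, for each action, a node whose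
outgoing edges carry out the action. -/
inductive Node (I : SSP) where
  | state (s : Fin I.n) : Node I
  | choice (p : Action I) : Node I
  | act (p : Action I) : Node I

variable {I : SSP}

/-- The first action of a state. -/
def start (s : Fin I.n) : Action I := ⟨s, ⟨0, I.acts_pos s⟩⟩

/-- The next action of the same state. -/
def succ (p : Action I) : Option (Action I) :=
  if h : p.2.val + 1 < I.acts p.1 then some ⟨p.1, ⟨p.2.val + 1, h⟩⟩ else none

lemma succ_eq_some_iff {p q : Action I} :
    succ p = some q ↔ q.1 = p.1 ∧ q.2.val = p.2.val + 1 := by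
  obtain ⟨s, u⟩ := p
  obtain ⟨t, v⟩ := q
  rw [succ]
  constructor
  · intro h
    split_ifs at h
    cases h
    exact ⟨rfl, rfl⟩
  · rintro ⟨h1, h2⟩
    dsimp only at h1 h2
    subst h1
    have := v.2
    rw [dif_pos (by dsimp only; omega)]
    congr
    exact h2.symm

lemma isSome_succ_iff {p : Action I} : (succ p).isSome ↔ p.2.val + 1 < I.acts p.1 := by
  rw [succ]
  split_ifs with h <;> simp [h]

open Classical in
/-- Edge weights. A state other than the target leads to the choice about its first action. The
last action of a state leaves no choice. -/
noncomputable def W : Node I → Node I → ℝ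
  | .state s, .state t => if s = I.target ∧ t = I.target then 1 else 0
  | .state s, .choice q => if s ≠ I.target ∧ q = start s then 1 else 0
  | .choice p, .choice q => if succ p = some q then 1 else 0
  | .choice p, .act q => if q = p then 1 else 0
  | .act p, .state t => I.P p.1 p.2 t
  | _, _ => 0

/-- Edge costs. -/
def K : Node I → Node I → ℝ
  | .act p, .state t => I.C p.1 p.2 t
  | _, _ => 0

/-- The free edges. -/
def Free : Node I → Node I → Prop
  | .choice p, .choice q => succ p = some q
  | .choice p, .act q => q = p ∧ (succ p).isSome
  | _, _ => False

/-- The nodes with an exclusivity constraint. -/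
def Excl : Node I → Prop
  | .choice p => (succ p).isSome
  | _ => False

/-- All the actions, state by state. -/
def actions (I : SSP) : List (Action I) :=
  (List.finRange I.n).sigma fun s => List.finRange (I.acts s)

/-- The enumeration of the nodes. The states come first, with their own numbers. -/
def nodes (I : SSP) : List (Node I) :=
  (List.finRange I.n).map .state ++ ((actions I).map .choice ++ (actions I).map .act)

lemma mem_actions (p : Action I) : p ∈ actions I := by
  obtain ⟨s, u⟩ := p
  simp [actions]

lemma nodup_actions : (actions I).Nodup :=
  (List.nodup_finRange _).sigma fun _ => List.nodup_finRange _

lemma mem_nodes (a : Node I) : a ∈ nodes I := by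
  cases a <;> simp [nodes, mem_actions]

lemma nodup_nodes : (nodes I).Nodup := by
  rw [nodes, List.nodup_append', List.nodup_append']
  refine ⟨(List.nodup_finRange _).map fun a b h => by cases h; rfl,
    ⟨nodup_actions.map fun a b h => by cases h; rfl, nodup_actions.map fun a b h => by cases h; rfl,
      ?_⟩, ?_⟩
  · intro a ha hb
    simp only [List.mem_map] at ha hb
    obtain ⟨p, -, rfl⟩ := ha
    obtain ⟨q, -, h⟩ := hb
    cases h
  · intro a ha hb
    simp only [List.mem_map, List.mem_append] at ha hb
    obtain ⟨p, -, rfl⟩ := ha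
    rcases hb with ⟨q, -, h⟩ | ⟨q, -, h⟩ <;> cases h

lemma length_actions : (actions I).length = I.numActions := by
  simp [actions, List.length_sigma, SSP.numActions, Fin.sum_univ_def]

lemma n_le_numActions : I.n ≤ I.numActions := by
  have : ∑ _s : Fin I.n, 1 ≤ I.numActions := Finset.sum_le_sum fun s _ => I.acts_pos s
  simpa using this

lemma length_nodes_le : (nodes I).length ≤ 3 * I.numActions := by
  have := n_le_numActions (I := I)
  simp only [nodes, List.length_append, List.length_map, length_actions, List.length_finRange]
  omega

open Classical in
/-- The numbering of the nodes. -/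
noncomputable def e (I : SSP) : Fin (nodes I).length ≃ Node I :=
  nodup_nodes.getEquivOfForallMemList _ mem_nodes

lemma e_apply (i : Fin (nodes I).length) : e I i = (nodes I)[i] := rfl

lemma val_symm_state (s : Fin I.n) : ((e I).symm (.state s)).val = s.val := by
  have h : s.val < (nodes I).length := by
    simp only [nodes, List.length_append, List.length_map, List.length_finRange]
    omega
  have : (e I).symm (.state s) = ⟨s.val, h⟩ := by
    rw [Equiv.symm_apply_eq, e_apply]
    simp [nodes, List.getElem_append_left]
  rw [this]

/-- A conditional number is positive exactly when its condition holds. -/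
lemma ite_pos {p : Prop} [Decidable p] : (0 : ℝ) < (if p then 1 else 0) ↔ p := by
  split_ifs with h <;> simp [h]

open Classical in
/-- The data of the GPRO instance. -/
noncomputable def data (I : SSP) : GPROData where
  n := (nodes I).length
  target := (e I).symm (.state I.target)
  W i j := W (e I i) (e I j)
  K i j := K (e I i) (e I j)
  F := Finset.univ.filter fun x => Free (e I x.1) (e I x.2)
  X := Finset.univ.filter fun i => Excl (e I i)

/-- The numbering of the nodes, as nodes of the instance. -/
noncomputable def node (I : SSP) : Fin (data I).n ≃ Node I := e I

lemma W_eq (i j : Fin (data I).n) : (data I).W i j = W (node I i) (node I j) := rfl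

lemma K_eq (i j : Fin (data I).n) : (data I).K i j = K (node I i) (node I j) := rfl

lemma mem_F {i j : Fin (data I).n} : (i, j) ∈ (data I).F ↔ Free (node I i) (node I j) := by
  classical exact Finset.mem_filter_univ _

lemma mem_X {i : Fin (data I).n} : i ∈ (data I).X ↔ Excl (node I i) := by
  classical exact Finset.mem_filter_univ _

lemma target_eq : (data I).target = (node I).symm (.state I.target) := rfl

/-- A set of pairs of numbers of nodes, such as a set of activated edges. -/
abbrev EdgeSet (I : SSP) : Type := Finset (Fin (data I).n × Fin (data I).n)

/-- The edge from `a` to `b` can be used in the configuration `μ`. -/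
def Active (μ : EdgeSet I) (a b : Node I) : Prop :=
  0 < (data I).weight μ ((node I).symm a) ((node I).symm b)

lemma active_iff {μ : EdgeSet I} {a b : Node I} :
    Active μ a b ↔ 0 < W a b ∧ (Free a b → ((node I).symm a, (node I).symm b) ∈ μ) := by
  rw [Active, GPROData.weight_pos_iff, mem_F, W_eq]
  simp

lemma W_nonneg (a b : Node I) : 0 ≤ W a b := by
  cases a <;> cases b <;> simp only [W] <;>
    first
    | exact I.P_nonneg _ _ _
    | exact le_rfl
    | split_ifs <;> norm_num

lemma W_pos_of_free {a b : Node I} (h : Free a b) : 0 < W a b := by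
  cases a <;> cases b <;> simp only [Free] at h <;> simp [W, h]

/-- The action `p` is taken when it is considered. -/
def Takes (μ : EdgeSet I) (p : Action I) : Prop := Active μ (.choice p) (.act p)

lemma takes_iff {μ : EdgeSet I} {p : Action I} : Takes μ p ↔
    succ p = none ∨ ((node I).symm (.choice p), (node I).symm (.act p)) ∈ μ := by
  rw [Takes, active_iff]
  cases h : succ p <;> simp [Free, W, h]

lemma active_choice_iff {μ : EdgeSet I} (hμ : (data I).Admissible μ) {p : Action I} {b : Node I} :
    Active μ (.choice p) b ↔
      Takes μ p ∧ b = .act p ∨ ¬ Takes μ p ∧ ∃ q, succ p = some q ∧ b = .choice q := by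
  have hfree : ∀ {j}, ((node I).symm (.choice p), j) ∈ μ → Free (.choice p) (node I j) := by
    intro j hj
    simpa [mem_F] using hμ.1 hj
  cases hs : succ p with
  | none =>
    have hT : Takes μ p := takes_iff.2 (.inl hs)
    cases b <;> simp [active_iff, W, Free, hs, hT]
    aesop
  | some q =>
    have hX : (node I).symm (.choice p) ∈ (data I).X := by simp [mem_X, Excl, hs]
    obtain ⟨j, hj, huniq⟩ := hμ.2.2 _ hX
    have hj' := hfree hj
    cases b with
    | state t => simp [active_iff, W]
    | act q' =>
      rw [active_iff]
      by_cases hq : q' = p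
      · subst hq
        simp [W, takes_iff, hs, Free]
      · simp [W, hq]
    | choice q' =>
      rw [active_iff]
      by_cases hq : q' = q
      · subst hq
        simp only [W, hs, takes_iff, Free]
        simp only [if_true, zero_lt_one, true_and, forall_const, reduceCtorEq, false_or, and_false,
          Option.some.injEq, Node.choice.injEq, exists_eq_left', and_true]
        constructor
        · intro h1 h2
          have := (huniq _ h1).trans (huniq _ h2).symm
          simp at this
        · intro h
          have : j = (node I).symm (.choice q') := by
            rw [Equiv.eq_symm_apply]
            cases hb : node I j with
            | state t => rw [hb] at hj'; exact hj'.elim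
            | act r =>
              rw [hb] at hj'
              obtain ⟨rfl, -⟩ := hj'
              exact (h (by rw [← hb, Equiv.symm_apply_apply]; exact hj)).elim
            | choice r =>
              rw [hb, Free, hs] at hj'
              cases hj'
              rfl
          exact this ▸ hj
      · have : ¬ q = q' := fun h => hq h.symm
        simp [W, hs, this, hq]

lemma active_state_iff {μ : EdgeSet I} {s : Fin I.n} {b : Node I} :
    Active μ (.state s) b ↔ if s = I.target then b = .state s else b = .choice (start s) := by
  rw [active_iff]
  by_cases hs : s = I.target <;> cases b <;> simp [W, Free, hs, ite_pos]

lemma active_act_iff {μ : EdgeSet I} {p : Action I} {b : Node I} :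
    Active μ (.act p) b ↔ ∃ t, 0 < I.P p.1 p.2 t ∧ b = .state t := by
  rw [active_iff]
  cases b <;> simp [W, Free]

open Classical in
/-- The action chosen in the state `s`: the first one that is taken when it is considered. -/
noncomputable def decode (μ : EdgeSet I) : I.Policy := fun s =>
  ((List.finRange (I.acts s)).find? fun u => Takes μ ⟨s, u⟩).getD ⟨0, I.acts_pos s⟩

lemma decode_eq_iff {μ : EdgeSet I} {s : Fin I.n} {u : Fin (I.acts s)} :
    decode μ s = u ↔ Takes μ ⟨s, u⟩ ∧ ∀ v < u, ¬ Takes μ ⟨s, v⟩ := by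
  classical
  have hex : ∃ v, (List.finRange (I.acts s)).find? (fun u => decide (Takes μ ⟨s, u⟩)) = some v := by
    rw [← Option.isSome_iff_exists, List.find?_isSome]
    have h := I.acts_pos s
    refine ⟨⟨I.acts s - 1, by omega⟩, List.mem_finRange _, ?_⟩
    rw [decide_eq_true_iff, takes_iff]
    left
    rw [← Option.not_isSome_iff_eq_none, isSome_succ_iff]
    dsimp only
    omega
  obtain ⟨v, hv⟩ := hex
  have hv' := hv
  rw [List.find?_finRange_eq_some_iff] at hv'
  simp only [decide_eq_true_iff] at hv'
  rw [decode, hv, Option.getD_some]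
  constructor
  · rintro rfl
    exact hv'
  · intro h
    exact le_antisymm (not_lt.1 fun hlt => hv'.2 _ hlt h.1) (not_lt.1 fun hlt => h.2 _ hlt hv'.1)

/-- Induction along the sequence of choices that leads to the chosen action. -/
lemma decode_induction {μ : EdgeSet I} {motive : Action I → Prop} (s : Fin I.n)
    (base : motive ⟨s, decode μ s⟩)
    (step : ∀ p q, succ p = some q → ¬ Takes μ p → motive q → motive p) : motive (start s) := by
  have key : ∀ k, ∀ u : Fin (I.acts s), u.val + k = (decode μ s).val → motive ⟨s, u⟩ := by
    intro k
    induction k with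
    | zero =>
      intro u hu
      have : u = decode μ s := Fin.ext (by omega)
      rwa [this]
    | succ k ih =>
      intro u hu
      have h1 := (decode μ s).2
      refine step _ ⟨s, ⟨u.val + 1, by omega⟩⟩ (succ_eq_some_iff.2 ⟨rfl, rfl⟩) ?_
        (ih _ (by dsimp only; omega))
      exact (decode_eq_iff.1 rfl).2 u (by rw [Fin.lt_def]; omega)
  exact key _ ⟨0, I.acts_pos s⟩ (Nat.zero_add _)

/-- Induction along the sequence of all choices in a state, from the last to the first. -/
lemma action_induction {motive : Action I → Prop} (last : ∀ p, succ p = none → motive p)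
    (step : ∀ p q, succ p = some q → motive q → motive p) (p : Action I) : motive p := by
  obtain ⟨s, u⟩ := p
  have key : ∀ k, ∀ u : Fin (I.acts s), u.val + k + 1 = I.acts s → motive ⟨s, u⟩ := by
    intro k
    induction k with
    | zero =>
      intro u hu
      refine last _ ?_
      rw [← Option.not_isSome_iff_eq_none, isSome_succ_iff]
      dsimp only
      omega
    | succ k ih =>
      intro u hu
      exact step _ ⟨s, ⟨u.val + 1, by omega⟩⟩ (succ_eq_some_iff.2 ⟨rfl, rfl⟩)
        (ih _ (by dsimp only; omega))
  have := u.2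
  exact key (I.acts s - 1 - u.val) u (by omega)

lemma reaches_target {μ : EdgeSet I} (hμ : (data I).Admissible μ) (a : Node I) :
    Relation.ReflTransGen (Active μ) a (.state I.target) := by
  have hstate : ∀ s, Relation.ReflTransGen (Active μ) (.state s) (.state I.target) := by
    intro s
    induction I.target_reachable (decode μ) s using Relation.ReflTransGen.head_induction_on with
    | refl => exact .refl
    | @head s t hst _ ih =>
      by_cases hs : s = I.target
      · rw [hs]
      refine .head (active_state_iff.2 (by rw [if_neg hs])) ?_
      refine decode_induction (μ := μ)
        (motive := fun p => Relation.ReflTransGen (Active μ) (.choice p) (.state I.target)) s ?_ ?_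
      · refine .head ((active_choice_iff hμ).2 (.inl ⟨(decode_eq_iff.1 rfl).1, rfl⟩)) ?_
        exact .head (active_act_iff.2 ⟨t, hst, rfl⟩) ih
      · intro p q hpq hp ih'
        exact .head ((active_choice_iff hμ).2 (.inr ⟨hp, q, hpq, rfl⟩)) ih'
  have hact : ∀ p, Relation.ReflTransGen (Active μ) (.act p) (.state I.target) := by
    intro p
    obtain ⟨t, -, ht⟩ : ∃ t ∈ Finset.univ, 0 < I.P p.1 p.2 t := by
      apply Finset.exists_lt_of_sum_lt
      simp [I.P_sum]
    exact .head (active_act_iff.2 ⟨t, ht, rfl⟩) (hstate t)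
  cases a with
  | state s => exact hstate s
  | act p => exact hact p
  | choice p =>
    induction p using action_induction with
    | last p hp =>
      exact .head ((active_choice_iff hμ).2 (.inl ⟨takes_iff.2 (.inl hp), rfl⟩)) (hact p)
    | step p q hpq ih =>
      by_cases hp : Takes μ p
      · exact .head ((active_choice_iff hμ).2 (.inl ⟨hp, rfl⟩)) (hact p)
      · exact .head ((active_choice_iff hμ).2 (.inr ⟨hp, q, hpq, rfl⟩)) ih

lemma allFree_of_excl {a : Node I} (h : Excl a) : (data I).AllFree ((node I).symm a) := by
  intro j hj
  rw [mem_F]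
  rw [W_eq] at hj
  simp only [Equiv.apply_symm_apply] at hj ⊢
  cases a <;> simp only [Excl] at h
  revert hj
  cases node I j <;> simp [W, Free, h]
  all_goals split_ifs <;> simp [*]

lemma card_free_of_excl {a : Node I} (h : Excl a) :
    ((data I).F.filter fun x => x.1 = (node I).symm a).card = 2 := by
  cases a with
  | state s => exact h.elim
  | act p => exact h.elim
  | choice p =>
    obtain ⟨q, hq⟩ := Option.isSome_iff_exists.1 (show (succ p).isSome from h)
    have : (data I).F.filter (fun x => x.1 = (node I).symm (.choice p)) =
        {((node I).symm (.choice p), (node I).symm (.choice q)),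
          ((node I).symm (.choice p), (node I).symm (.act p))} := by
      ext ⟨i, j⟩
      obtain ⟨a, rfl⟩ := (node I).symm.surjective i
      obtain ⟨b, rfl⟩ := (node I).symm.surjective j
      rw [Finset.mem_filter, mem_F]
      simp only [Equiv.apply_symm_apply, EmbeddingLike.apply_eq_iff_eq, Finset.mem_insert,
        Finset.mem_singleton,
        Prod.mk.injEq]
      constructor
      · rintro ⟨h1, rfl⟩
        cases b with
        | state t => exact h1.elim
        | act r => exact .inr ⟨rfl, by rw [h1.1]⟩
        | choice r =>
          rw [Free, hq] at h1
          cases h1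
          exact .inl ⟨rfl, rfl⟩
      · rintro (⟨rfl, rfl⟩ | ⟨rfl, rfl⟩)
        · exact ⟨hq, rfl⟩
        · exact ⟨⟨rfl, h⟩, rfl⟩
    rw [this, Finset.card_pair]
    simp

/-- The GPRO instance. -/
noncomputable abbrev gpro (I : SSP) : GPRO where
  toGPROData := data I
  W_nonneg _ _ := W_nonneg _ _
  exists_edge i := by
    obtain ⟨a, rfl⟩ := (node I).symm.surjective i
    suffices ∃ b, 0 < W a b by
      obtain ⟨b, hb⟩ := this
      exact ⟨(node I).symm b, by simpa [W_eq] using hb⟩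
    cases a with
    | state s =>
      by_cases hs : s = I.target
      · exact ⟨.state I.target, by simp [W, hs]⟩
      · exact ⟨.choice (start s), by simp [W, hs]⟩
    | choice p => exact ⟨.act p, by simp [W]⟩
    | act p =>
      obtain ⟨t, -, ht⟩ : ∃ t ∈ Finset.univ, 0 < I.P p.1 p.2 t := by
        apply Finset.exists_lt_of_sum_lt
        simp [I.P_sum]
      exact ⟨.state t, ht⟩
  free_edge i j h := W_pos_of_free (mem_F.1 h)
  exclusive i hi := by
    obtain ⟨a, rfl⟩ := (node I).symm.surjective i
    rw [mem_X, Equiv.apply_symm_apply] at hi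
    exact ⟨card_free_of_excl hi, allFree_of_excl hi⟩
  target_edge j := by
    obtain ⟨a, rfl⟩ := (node I).symm.surjective j
    rw [W_eq, target_eq]
    cases a <;> simp [W, ite_pos]
  target_fixed := by
    rw [mem_F, target_eq, Equiv.apply_symm_apply]
    exact fun h => h
  target_cost_free := by simp [K_eq, target_eq, K]
  target_reachable μ hμ i := by
    obtain ⟨a, rfl⟩ := (node I).symm.surjective i
    exact (reaches_target hμ a).lift (node I).symm fun _ _ h => h

end SSPToGPRO

/-! ### From SSP to GPRO: policies and values -/

namespace SSPToGPRO

variable {I : SSP}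

/-- The terminal costs `f`, as a function on the numbers of the nodes. -/
noncomputable def onNode (f : Node I → ℝ) : Fin (gpro I).n → ℝ := fun i => f (node I i)

@[simp] lemma onNode_symm (f : Node I → ℝ) (a : Node I) : onNode f ((node I).symm a) = f a := by
  simp [onNode]

lemma onNode_eq (w : Fin (gpro I).n → ℝ) : onNode (fun a => w ((node I).symm a)) = w := by
  funext i
  simp [onNode]

lemma nodeValue_of_unique (π : (gpro I).Policy) (f : Node I → ℝ) {a b : Node I}
    (h : ∀ c, Active π.1 a c ↔ c = b) :
    GPRO.nodeValue π (onNode f) ((node I).symm a) = K a b + f b := by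
  rw [GPRO.nodeValue_of_unique π (onNode f) (j₀ := (node I).symm b)]
  · rw [onNode_symm, K_eq, Equiv.apply_symm_apply, Equiv.apply_symm_apply]
  · intro j
    obtain ⟨c, rfl⟩ := (node I).symm.surjective j
    rw [EmbeddingLike.apply_eq_iff_eq]
    exact h c

lemma nodeValue_state (π : (gpro I).Policy) (f : Node I → ℝ) {s : Fin I.n} (hs : s ≠ I.target) :
    GPRO.nodeValue π (onNode f) ((node I).symm (.state s)) = f (.choice (start s)) := by
  rw [nodeValue_of_unique π f (b := .choice (start s))
    fun c => by rw [active_state_iff, if_neg hs]]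
  simp [K]

lemma nodeValue_choice_of_takes (π : (gpro I).Policy) (f : Node I → ℝ) {p : Action I}
    (hp : Takes π.1 p) :
    GPRO.nodeValue π (onNode f) ((node I).symm (.choice p)) = f (.act p) := by
  rw [nodeValue_of_unique π f (b := .act p)
    fun c => by simp [active_choice_iff π.2, hp]]
  simp [K]

lemma nodeValue_choice_of_not_takes (π : (gpro I).Policy) (f : Node I → ℝ) {p q : Action I}
    (hp : ¬ Takes π.1 p) (hq : succ p = some q) :
    GPRO.nodeValue π (onNode f) ((node I).symm (.choice p)) = f (.choice q) := by
  rw [nodeValue_of_unique π f (b := .choice q)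
    fun c => by simp [active_choice_iff π.2, hp, hq]]
  simp [K]

lemma nodeValue_act (π : (gpro I).Policy) (f : Node I → ℝ) (p : Action I) :
    GPRO.nodeValue π (onNode f) ((node I).symm (.act p)) =
      I.actionValue (fun s => f (.state s)) p.1 p.2 := by
  have hw : ∀ b, (gpro I).weight π.1 ((node I).symm (.act p)) ((node I).symm b) =
      W (.act p) b := by
    intro b
    rw [GPROData.weight, if_neg]
    · rw [W_eq, Equiv.apply_symm_apply, Equiv.apply_symm_apply]
    · rw [Finset.mem_sdiff, mem_F, Equiv.apply_symm_apply, Equiv.apply_symm_apply]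
      exact fun h => h.1
  have hsum : ∀ g : Node I → ℝ, ∑ j, (gpro I).weight π.1 ((node I).symm (.act p)) j *
      g (node I j) = ∑ s, I.P p.1 p.2 s * g (.state s) := by
    intro g
    symm
    refine Fintype.sum_of_injective (fun s => (node I).symm (.state s)) ?_ _ _ ?_ ?_
    · intro s t h
      simpa using h
    · intro j hj
      obtain ⟨b, rfl⟩ := (node I).symm.surjective j
      rw [hw]
      cases b with
      | state s => exact absurd ⟨s, rfl⟩ hj
      | _ => simp [W]
    · intro s
      rw [hw, Equiv.apply_symm_apply]
      rfl
  have h1 : ∑ j, (gpro I).weight π.1 ((node I).symm (.act p)) j = 1 := by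
    simpa [I.P_sum] using hsum fun _ => 1
  have h2 := GPRO.sum_weight_mul_nodeValue π (onNode f) ((node I).symm (.act p))
  rw [h1, one_mul] at h2
  rw [h2, SSP.actionValue]
  refine Eq.trans ?_ (hsum fun b => K (.act p) b + f b)
  refine Finset.sum_congr rfl fun j _ => ?_
  rw [K_eq, Equiv.apply_symm_apply]
  rfl

/-- The node of the instance that stands for the state `s`. -/
noncomputable def stateNode (s : Fin I.n) : Fin (gpro I).n := (node I).symm (.state s)

lemma stateNode_injective : Function.Injective (stateNode (I := I)) := fun s t h => by
  simpa [stateNode] using h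

lemma stateNode_target : stateNode I.target = (gpro I).target := rfl

/-- The policy of the SSP instance that a policy of the GPRO instance stands for. -/
noncomputable def toPolicy (π : (gpro I).Policy) : I.Policy := decode π.1

lemma value_toPolicy (π : (gpro I).Policy) (s : Fin I.n) :
    I.value (toPolicy π) s = (gpro I).value π (stateNode s) := by
  set f : Node I → ℝ := fun a => (gpro I).value π ((node I).symm a) with hf
  have hv : ∀ a, f a = GPRO.nodeValue π (onNode f) ((node I).symm a) := fun a => by
    rw [hf, onNode_eq]
    exact GPRO.value_eq π _
  refine SSP.value_unique (toPolicy π) (w := fun s => f (.state s)) (GPRO.value_target π)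
    (fun s hs => ?_) s
  rw [hv, nodeValue_state π f hs]
  refine decode_induction (μ := π.1)
    (motive := fun p => f (.choice p) = I.actionValue (fun s => f (.state s)) s (toPolicy π s))
    s ?_ ?_
  · rw [hv, nodeValue_choice_of_takes π f (decode_eq_iff.1 rfl).1, hv, nodeValue_act]
    rfl
  · intro p q hpq hp ih
    rw [hv, nodeValue_choice_of_not_takes π f hp hpq, ih]

/-! Policies of the GPRO instance are given by the set `T` of the actions that are taken when they
are considered. -/

/-- The activated edges if the actions in `T` are taken. -/
def Chosen (T : Action I → Prop) : Node I → Node I → Prop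
  | .choice p, .choice q => succ p = some q ∧ ¬ T p
  | .choice p, .act q => q = p ∧ (succ p).isSome ∧ T p
  | _, _ => False

open Classical in
/-- The edges in `Chosen T`, as a set of pairs of numbers of nodes. -/
noncomputable def edgeSet (T : Action I → Prop) : EdgeSet I :=
  Finset.univ.filter fun x => Chosen T (node I x.1) (node I x.2)

lemma mem_edgeSet {T : Action I → Prop} {i j : Fin (data I).n} :
    (i, j) ∈ edgeSet T ↔ Chosen T (node I i) (node I j) := by
  simp [edgeSet]

lemma free_of_chosen {T : Action I → Prop} {a b : Node I} (h : Chosen T a b) : Free a b := by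
  cases a <;> cases b <;> simp only [Chosen] at h
  · exact h.1
  · exact ⟨h.1, h.2.1⟩

lemma takes_edgeSet_iff {T : Action I → Prop} {p : Action I} :
    Takes (edgeSet T) p ↔ succ p = none ∨ T p := by
  rw [takes_iff]
  simp only [mem_edgeSet, Equiv.apply_symm_apply, Chosen]
  cases succ p <;> simp

lemma admissible_edgeSet (T : Action I → Prop) : (data I).Admissible (edgeSet T) := by
  refine ⟨?_, ?_, ?_⟩
  · rintro ⟨i, j⟩ h
    rw [mem_edgeSet] at h
    rw [mem_F]
    exact free_of_chosen h
  · intro i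
    obtain ⟨a, rfl⟩ := (node I).symm.surjective i
    suffices ∃ b, Active (edgeSet T) a b by
      obtain ⟨b, hb⟩ := this
      exact ⟨_, hb⟩
    cases a with
    | state s =>
      simp only [active_state_iff]
      split_ifs
      exacts [⟨_, rfl⟩, ⟨_, rfl⟩]
    | act p =>
      obtain ⟨t, -, ht⟩ : ∃ t ∈ Finset.univ, 0 < I.P p.1 p.2 t := by
        apply Finset.exists_lt_of_sum_lt
        simp [I.P_sum]
      exact ⟨.state t, active_act_iff.2 ⟨t, ht, rfl⟩⟩
    | choice p =>
      by_cases hp : Takes (edgeSet T) p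
      · exact ⟨.act p, hp⟩
      · rw [takes_edgeSet_iff, not_or] at hp
        obtain ⟨q, hq⟩ := Option.ne_none_iff_exists'.1 hp.1
        refine ⟨.choice q, active_iff.2 ⟨by simp [W, hq], fun _ => ?_⟩⟩
        rw [mem_edgeSet, Equiv.apply_symm_apply, Equiv.apply_symm_apply]
        exact ⟨hq, hp.2⟩
  · intro i hi
    obtain ⟨a, rfl⟩ := (node I).symm.surjective i
    rw [mem_X, Equiv.apply_symm_apply] at hi
    cases a with
    | state s => exact hi.elim
    | act p => exact hi.elim
    | choice p =>
      obtain ⟨q, hq⟩ := Option.isSome_iff_exists.1 (show (succ p).isSome from hi)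
      simp only [mem_edgeSet, Equiv.apply_symm_apply]
      by_cases hT : T p
      · refine ⟨(node I).symm (.act p), ?_, fun j hj => ?_⟩
        · dsimp only
          rw [Equiv.apply_symm_apply]
          exact ⟨rfl, hi, hT⟩
        · rw [Equiv.eq_symm_apply]
          dsimp only at hj
          revert hj
          generalize node I j = b
          cases b <;> simp +contextual [Chosen, hT]
      · refine ⟨(node I).symm (.choice q), ?_, fun j hj => ?_⟩
        · dsimp only
          rw [Equiv.apply_symm_apply]
          exact ⟨hq, hT⟩
        · rw [Equiv.eq_symm_apply]
          dsimp only at hj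
          revert hj
          generalize node I j = b
          cases b <;> simp +contextual [Chosen, hT, hq]

/-- The policy under which the actions in `T` are taken when they are considered. -/
noncomputable def policy (T : Action I → Prop) : (gpro I).Policy :=
  ⟨edgeSet T, admissible_edgeSet T⟩

lemma toPolicy_policy {T : Action I → Prop} {μ : I.Policy} (h1 : ∀ s, T ⟨s, μ s⟩)
    (h2 : ∀ s, ∀ u < μ s, ¬ T ⟨s, u⟩) : toPolicy (policy T) = μ := by
  funext s
  refine decode_eq_iff.2 ⟨takes_edgeSet_iff.2 (.inr (h1 s)), fun u hu h => ?_⟩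
  rcases takes_edgeSet_iff.1 h with h | h
  · rw [← Option.not_isSome_iff_eq_none, isSome_succ_iff] at h
    have := (μ s).2
    rw [Fin.lt_def] at hu
    exact h (by dsimp only; omega)
  · exact h2 s u hu h

lemma toPolicy_surjective : Function.Surjective (toPolicy (I := I)) := fun μ =>
  ⟨policy fun p => p.2 = μ p.1, toPolicy_policy (fun _ => rfl) fun _ _ hu => hu.ne⟩

lemma optimal_toPolicy {π : (gpro I).Policy} (h : (gpro I).Optimal π) :
    I.Optimal (toPolicy π) := fun μ s => by
  obtain ⟨π', rfl⟩ := toPolicy_surjective μ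
  rw [value_toPolicy, value_toPolicy]
  exact h π' _

/-- The least value of the action `p` and the later actions of its state. -/
noncomputable def bestValue (v : Fin I.n → ℝ) (p : Action I) : ℝ :=
  (Finset.Ici p.2).inf' ⟨p.2, Finset.mem_Ici.2 le_rfl⟩ (I.actionValue v p.1)

lemma bestValue_le (v : Fin I.n → ℝ) (p : Action I) : bestValue v p ≤ I.actionValue v p.1 p.2 :=
  Finset.inf'_le _ (Finset.mem_Ici.2 le_rfl)

lemma bestValue_succ (v : Fin I.n → ℝ) {p q : Action I} (h : succ p = some q) :
    bestValue v p = min (I.actionValue v p.1 p.2) (bestValue v q) := by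
  obtain ⟨s, u⟩ := p
  obtain ⟨t, u'⟩ := q
  obtain ⟨h1, h2⟩ := succ_eq_some_iff.1 h
  dsimp only at h1 h2
  subst h1
  refine le_antisymm (le_min (bestValue_le v _) ?_) ?_
  · refine Finset.le_inf' _ _ fun u₁ hu₁ => Finset.inf'_le _ ?_
    rw [Finset.mem_Ici, Fin.le_def] at hu₁ ⊢
    dsimp only at hu₁ ⊢
    omega
  · refine Finset.le_inf' _ _ fun u₁ hu₁ => ?_
    rw [Finset.mem_Ici, Fin.le_def] at hu₁
    dsimp only at hu₁
    rcases hu₁.eq_or_lt with he | hlt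
    · rw [← Fin.ext he]
      exact min_le_left _ _
    · refine (min_le_right _ _).trans (Finset.inf'_le _ ?_)
      rw [Finset.mem_Ici, Fin.le_def]
      dsimp only
      omega

lemma bestValue_of_last (v : Fin I.n → ℝ) {p : Action I} (h : succ p = none) :
    bestValue v p = I.actionValue v p.1 p.2 := by
  refine le_antisymm (bestValue_le v p) (Finset.le_inf' _ _ fun u hu => ?_)
  rw [← Option.not_isSome_iff_eq_none, isSome_succ_iff] at h
  rw [Finset.mem_Ici, Fin.le_def] at hu
  have : u = p.2 := Fin.ext (by omega)
  rw [this]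

/-- Every optimal policy of the SSP instance comes from an optimal policy of the GPRO instance. The
choices that are not reached in the state `s`, those after the action `μ s`, have to be made
optimally, too. -/
lemma exists_optimal {μ : I.Policy} (hμ : I.Optimal μ) :
    ∃ π : (gpro I).Policy, (gpro I).Optimal π ∧ toPolicy π = μ := by
  set v := I.value μ with hv
  have hle : ∀ s u, v s ≤ I.actionValue v s u := hμ.le_actionValue
  have heq : ∀ s, v s = I.actionValue v s (μ s) := SSP.value_eq μ
  have hbest : ∀ s, ∀ u ≤ μ s, bestValue v ⟨s, u⟩ = v s := by
    intro s u hu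
    refine le_antisymm ?_ (Finset.le_inf' _ _ fun u' _ => hle s u')
    rw [heq]
    exact Finset.inf'_le _ (Finset.mem_Ici.2 hu)
  -- the actions after `μ s` are taken exactly if no later one is better
  let T : Action I → Prop := fun p =>
    p.2 = μ p.1 ∨ μ p.1 < p.2 ∧ I.actionValue v p.1 p.2 = bestValue v p
  have hT : ∀ p, T p → bestValue v p = I.actionValue v p.1 p.2 := by
    rintro ⟨s, u⟩ (h | h)
    · dsimp only at h
      subst h
      rw [hbest s _ le_rfl]
      exact heq s
    · exact h.2.symm
  have hT' : ∀ p q, succ p = some q → ¬ T p → bestValue v p = bestValue v q := by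
    rintro ⟨s, u⟩ ⟨t, u'⟩ hs hp
    have hmin := bestValue_succ v hs
    obtain ⟨h1, h2⟩ := succ_eq_some_iff.1 hs
    dsimp only at h1 h2
    subst h1
    simp only [T, not_or, not_and] at hp
    rcases lt_or_gt_of_ne hp.1 with hlt | hgt
    · rw [hbest _ _ hlt.le, hbest]
      rw [Fin.lt_def] at hlt
      rw [Fin.le_def]
      omega
    · have := hp.2 hgt
      rcases min_choice (I.actionValue v t u) (bestValue v ⟨t, u'⟩) with h | h
      · exact absurd (hmin.trans h).symm this
      · exact hmin.trans h
  -- the solution of the optimality equations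
  let f : Node I → ℝ
    | .state s => v s
    | .choice p => bestValue v p
    | .act p => I.actionValue v p.1 p.2
  have hstate : ∀ s, f (.choice (start s)) = v s := fun s => hbest s _ (Nat.zero_le _)
  refine ⟨policy T, ?_, toPolicy_policy (fun s => .inl rfl) fun s u hu h => ?_⟩
  · refine GPRO.optimal_of_bellman (policy T) (w := onNode f) ?_ (fun i hi => ?_)
      fun π i hi => ?_
    · change onNode f ((node I).symm (.state I.target)) = 0
      rw [onNode_symm]
      exact SSP.value_target μ
    · obtain ⟨a, rfl⟩ := (node I).symm.surjective i
      rw [onNode_symm]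
      cases a with
      | state s =>
        rw [nodeValue_state _ _ fun h => hi (by rw [h]; rfl), hstate]
      | act p => rw [nodeValue_act]
      | choice p =>
        by_cases hp : Takes (policy T).1 p
        · rw [nodeValue_choice_of_takes _ _ hp]
          rcases takes_edgeSet_iff.1 hp with h | h
          · exact bestValue_of_last v h
          · exact hT p h
        · have hp' := hp
          rw [policy, takes_edgeSet_iff, not_or] at hp'
          obtain ⟨q, hq⟩ := Option.ne_none_iff_exists'.1 hp'.1
          rw [nodeValue_choice_of_not_takes _ _ hp hq]
          exact hT' p q hq hp'.2
    · obtain ⟨a, rfl⟩ := (node I).symm.surjective i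
      rw [onNode_symm]
      cases a with
      | state s =>
        rw [nodeValue_state _ _ fun h => hi (by rw [h]; rfl), hstate]
      | act p => rw [nodeValue_act]
      | choice p =>
        by_cases hp : Takes π.1 p
        · rw [nodeValue_choice_of_takes _ _ hp]
          exact bestValue_le v p
        · have hp' := hp
          rw [takes_iff, not_or] at hp'
          obtain ⟨q, hq⟩ := Option.ne_none_iff_exists'.1 hp'.1
          rw [nodeValue_choice_of_not_takes _ _ hp hq]
          exact (bestValue_succ v hq).trans_le (min_le_right _ _)
  · rcases h with h | h
    · exact hu.ne h
    · exact lt_asymm hu h.1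

lemma mem_X_of_mem_F {x : Fin (gpro I).n × Fin (gpro I).n} (h : x ∈ (gpro I).F) :
    x.1 ∈ (gpro I).X := by
  obtain ⟨i, j⟩ := x
  rw [mem_F] at h
  rw [mem_X]
  revert h
  cases node I i <;> cases node I j <;> simp +contextual [Free, Excl]

lemma card_F_le : (gpro I).F.card ≤ 6 * I.numActions := by
  rw [Finset.card_eq_sum_card_fiberwise (f := Prod.fst) (t := (gpro I).X) fun _ => mem_X_of_mem_F,
    Finset.sum_congr rfl fun i hi => ((gpro I).exclusive i hi).1, Finset.sum_const, smul_eq_mul]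
  have h1 := Finset.card_le_univ (gpro I).X
  rw [Fintype.card_fin] at h1
  have h2 : (gpro I).n ≤ 3 * I.numActions := length_nodes_le
  omega

end SSPToGPRO

/-! ### From SSP to GPRO: the programs -/

namespace Prog

section eval

variable {x : Data}

lemma eval_ite_eq (f g p q : Prog) [Decidable (eval f x = eval g x)] :
    eval (ite (eq f g) p q) x = if eval f x = eval g x then eval p x else eval q x :=
  eval_ite_of (eval_eq_ne_nil f g) p q

/-- This tests whether the list has an entry after the position `n`. -/
lemma eval_snd_drop_ne_nil {k l : Prog} {n : ℕ} {L : List Data} (hk : eval k x = .ofNat n)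
    (hl : eval l x = .ofList L) : eval (comp snd (drop k l)) x ≠ .nil ↔ n + 1 < L.length := by
  rw [eval_comp, eval_drop_ofNat hk hl]
  have h : ∀ K : List Data, eval snd (.ofList K) = .ofList (K.drop 1) := by
    intro K
    cases K <;> rfl
  rw [h, Data.ofList_ne_nil_iff, List.drop_drop, ne_eq, List.drop_eq_nil_iff]
  omega

end eval

/-- Look up whether the entry of the matrix `mat` at the row labelled `a` and the column labelled
`b` is not `nil`. -/
def lookup (labels mat a b : Prog) : Prog :=
  any (any (and (and (eq (nth (comp snd fst) (comp labels (comp fst fst))) (comp a (comp fst fst)))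
      (eq (nth snd (comp labels (comp fst fst))) (comp b (comp fst fst))))
    (nth snd (nth (comp snd fst) (comp mat (comp fst fst))))) (range (comp labels fst)))
    (range labels)

lemma eval_lookup_ne_nil {x : Data} {labels mat a b : Prog} {N : ℕ} {c : Fin N → Data}
    {m : Fin N → Fin N → Data} (hc : Function.Injective c)
    (hl : eval labels x = .ofList (List.ofFn c))
    (hm : eval mat x = .ofList (List.ofFn fun i => .ofList (List.ofFn (m i)))) {i j : Fin N}
    (ha : eval a x = c i) (hb : eval b x = c j) :
    eval (lookup labels mat a b) x ≠ .nil ↔ m i j ≠ .nil := by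
  have hfst : ∀ (p : Prog) (y : Data), eval (comp p fst) (.cons x y) = eval p x := fun _ _ => rfl
  have hfst2 : ∀ (p : Prog) (y z : Data),
      eval (comp p (comp fst fst)) (.cons (.cons x y) z) = eval p x := fun _ _ _ => rfl
  rw [lookup, eval_any_ne_nil (eval_range hl)]
  have inner : ∀ i' j' : Fin N, eval (and (and (eq (nth (comp snd fst)
      (comp labels (comp fst fst))) (comp a (comp fst fst)))
      (eq (nth snd (comp labels (comp fst fst))) (comp b (comp fst fst))))
      (nth snd (nth (comp snd fst) (comp mat (comp fst fst)))))
      (.cons (.cons x (.ofNat i')) (.ofNat j')) ≠ .nil ↔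
        (i' = i ∧ j' = j) ∧ m i' j' ≠ .nil := by
    intro i' j'
    rw [eval_and_ne_nil, eval_and_ne_nil, eval_eq_ne_nil, eval_eq_ne_nil,
      eval_nth i' rfl ((hfst2 _ _ _).trans hl), eval_nth j' rfl ((hfst2 _ _ _).trans hl),
      eval_nth j' rfl (eval_nth i' rfl ((hfst2 _ _ _).trans hm)), hfst2, hfst2, ha, hb,
      hc.eq_iff, hc.eq_iff]
  constructor
  · rintro ⟨i', -, h⟩
    rw [eval_any_ne_nil (eval_range ((hfst _ _).trans hl))] at h
    obtain ⟨j', -, h⟩ := h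
    rw [inner] at h
    obtain ⟨⟨rfl, rfl⟩, h⟩ := h
    exact h
  · intro h
    refine ⟨i, List.mem_finRange _, ?_⟩
    rw [eval_any_ne_nil (eval_range ((hfst _ _).trans hl))]
    refine ⟨j, List.mem_finRange _, ?_⟩
    rw [inner]
    exact ⟨⟨rfl, rfl⟩, h⟩

lemma PolyIn.lookup {M : CostModel} {labels mat a b : Prog} (hl : PolyIn M labels)
    (hm : PolyIn M mat) (ha : PolyIn M a) (hb : PolyIn M b) :
    PolyIn M (lookup labels mat a b) := by
  have h2 : ∀ {p}, PolyIn M p → PolyIn M (.comp p (.comp .fst .fst)) :=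
    fun hp => .comp hp (.comp .fst .fst)
  have h1 : PolyIn M (.comp .snd .fst) := .comp .snd .fst
  exact .any (.any (.and (.and (.eq (.nth h1 (h2 hl)) (h2 ha)) (.eq (.nth .snd (h2 hl)) (h2 hb)))
    (.nth .snd (.nth h1 (h2 hm)))) (.range (.comp hl .fst))) (.range hl)

end Prog

lemma List.ofFn_getElem_map {α β : Type*} (l : List α) (f : α → β) :
    List.ofFn (fun i : Fin l.length => f l[i]) = l.map f := by
  refine List.ext_getElem (by simp) fun i h1 h2 => ?_
  simp

lemma List.map_finRange {β : Type*} {n : ℕ} (f : Fin n → β) :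
    (List.finRange n).map f = List.ofFn f := by
  rw [List.ofFn_eq_map]

namespace SSPToGPRO

open Prog

variable {I : SSP}

/-- The label of a node in the computation: its kind and the numbers of its state and action. -/
def code : Node I → Data
  | .state s => .cons (.ofNat 0) (.cons (.ofNat s) .nil)
  | .choice p => .cons (.ofNat 1) (.cons (.ofNat p.1) (.ofNat p.2))
  | .act p => .cons (.ofNat 2) (.cons (.ofNat p.1) (.ofNat p.2))

lemma code_injective : Function.Injective (code (I := I)) := by
  intro a b h
  cases a with
  | state s =>
    cases b <;> simp [code, Fin.val_inj] at h ⊢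
    exact h
  | choice p =>
    cases b <;> simp [code] at h ⊢
    exact Sigma.ext (Fin.ext h.1) ((Fin.heq_ext_iff (by rw [Fin.ext h.1])).2 h.2)
  | act p =>
    cases b <;> simp [code] at h ⊢
    exact Sigma.ext (Fin.ext h.1) ((Fin.heq_ext_iff (by rw [Fin.ext h.1])).2 h.2)

/-! The arguments `x`, `s`, `u`, `t` of the following programs are programs that compute the SSP
instance and the numbers of a state, of an action and of a successor state. -/

/-- The list of the actions of a state. -/
def actsProg (x s : Prog) : Prog := nth s (comp snd x)

/-- The test whether `u` is not the last action of the state `s`. -/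
def hasNextProg (x s u : Prog) : Prog := comp snd (drop u (actsProg x s))

/-- The transition probability and cost. -/
def datumProg (x s u t : Prog) : Prog := nth t (nth u (actsProg x s))

/-- The label of a state; as a unary number, the kind `0` is `nil`. -/
def stateProg (s : Prog) : Prog := cons nil (cons s nil)

/-- The label of a choice; as a unary number, the kind `1` is `tt`. -/
def choiceProg (s u : Prog) : Prog := cons tt (cons s u)

/-- The label of a node that carries out an action. -/
def actProg (s u : Prog) : Prog := cons (cons nil tt) (cons s u)

/-- The list of the labels that `mk` makes from states and actions. -/
def actionsProg (mk : Prog → Prog → Prog) (x : Prog) : Prog :=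
  flatMap (map (mk (comp snd fst) snd) (range (actsProg (comp x fst) snd))) (range (comp snd x))

/-- The list of the labels of the nodes. -/
def nodesProg (x : Prog) : Prog :=
  append (map (stateProg snd) (range (comp snd x)))
    (append (actionsProg choiceProg x) (actionsProg actProg x))

section eval

variable {y : Data} {x s u t : Prog}

lemma eval_states (hx : eval x y = I.encode) : eval (comp snd x) y =
    .ofList (List.ofFn fun s => .ofList (List.ofFn fun u => .ofList (List.ofFn fun s' =>
      .cons (.num (I.P s u s')) (.num (I.C s u s'))))) := by
  rw [eval_comp, hx]
  rfl

lemma eval_actsProg (hx : eval x y = I.encode) (s' : Fin I.n) (hs : eval s y = .ofNat s') :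
    eval (actsProg x s) y = .ofList (List.ofFn fun u => .ofList (List.ofFn fun t =>
      .cons (.num (I.P s' u t)) (.num (I.C s' u t)))) :=
  eval_nth s' hs (eval_states hx)

lemma eval_hasNextProg (hx : eval x y = I.encode) (p : Action I) (hs : eval s y = .ofNat p.1)
    (hu : eval u y = .ofNat p.2) : eval (hasNextProg x s u) y ≠ .nil ↔ (succ p).isSome := by
  rw [hasNextProg, eval_snd_drop_ne_nil hu (eval_actsProg hx p.1 hs), List.length_ofFn,
    isSome_succ_iff]

lemma eval_datumProg (hx : eval x y = I.encode) (p : Action I) (t' : Fin I.n)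
    (hs : eval s y = .ofNat p.1) (hu : eval u y = .ofNat p.2) (ht : eval t y = .ofNat t') :
    eval (datumProg x s u t) y =
      .cons (.num (I.P p.1 p.2 t')) (.num (I.C p.1 p.2 t')) :=
  eval_nth t' ht (eval_nth p.2 hu (eval_actsProg hx p.1 hs))

lemma eval_actionsProg (hx : eval x y = I.encode) {mk : Prog → Prog → Prog} {f : Action I → Data}
    (hf : ∀ p : Action I, eval (mk (comp snd fst) snd)
      (.cons (.cons y (.ofNat p.1)) (.ofNat p.2)) = f p) :
    eval (actionsProg mk x) y = .ofList ((actions I).map f) := by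
  rw [actionsProg, eval_flatMap (eval_range (eval_states hx))
    (G := fun s => (List.finRange (I.acts s)).map fun u => f ⟨s, u⟩)]
  · congr 1
    simp [actions, List.sigma, List.map_flatMap, Function.comp_def]
  · intro s _
    rw [eval_map (eval_range (eval_actsProg (I := I) (x := comp x fst) (s := snd)
      (y := .cons y (.ofNat s)) hx s rfl))]
    congr 1
    exact List.map_congr_left fun u _ => hf ⟨s, u⟩

lemma eval_nodesProg (hx : eval x y = I.encode) :
    eval (nodesProg x) y = .ofList ((nodes I).map code) := by
  rw [nodesProg, eval_append (eval_map (eval_range (eval_states hx)))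
    (eval_append (eval_actionsProg hx (f := fun p => code (.choice p)) fun p => rfl)
      (eval_actionsProg hx (f := fun p => code (.act p)) fun p => rfl))]
  simp only [nodes, List.map_append, List.map_map]
  rfl

end eval

/-! In the matrix, the row label is `comp snd fst` and the column label is `snd`; the instance is
`comp fst fst`. -/

/-- In an entry of the matrix, apply `f` to the row label. -/
def sourceProg (f : Prog) : Prog := comp f (comp snd fst)

/-- The component of a label that is the number of its state. -/
def stateOf : Prog := comp fst snd

/-- The component of a label that is the number of its action. -/
def actionOf : Prog := comp snd snd

/-- The indicator of a test, as a number. -/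
def oneIf (c : Prog) : Prog := ite c (num 1) (num 0)

/-- The transition probability and cost from the action in the row label to the state in the
column label. -/
def entryProg : Prog :=
  datumProg (comp fst fst) (sourceProg stateOf) (sourceProg actionOf) (comp stateOf snd)

/-- The weight `W` of the edge. A unary number is increased by `cons nil`, so the choice about the
next action is compared with the label that would have the next number. -/
def weightProg : Prog :=
  ite (eq (sourceProg fst) nil)
    (ite (eq (sourceProg stateOf) (comp fst (comp fst fst)))
      (oneIf (eq snd (stateProg (sourceProg stateOf))))
      (oneIf (eq snd (choiceProg (sourceProg stateOf) nil))))
    (ite (eq (sourceProg fst) tt)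
      (oneIf (or (eq snd (actProg (sourceProg stateOf) (sourceProg actionOf)))
        (eq snd (choiceProg (sourceProg stateOf) (cons nil (sourceProg actionOf))))))
      (ite (eq (comp fst snd) nil) (comp fst entryProg) (num 0)))

/-- The cost `K` of the edge. -/
def costProg : Prog :=
  ite (and (eq (sourceProg fst) (cons nil tt)) (eq (comp fst snd) nil)) (comp snd entryProg) (num 0)

/-- The test for free edges. -/
def freeProg : Prog :=
  and (eq (sourceProg fst) tt)
    (or (and (eq snd (actProg (sourceProg stateOf) (sourceProg actionOf)))
        (hasNextProg (comp fst fst) (sourceProg stateOf) (sourceProg actionOf)))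
      (eq snd (choiceProg (sourceProg stateOf) (cons nil (sourceProg actionOf)))))

/-- The test for exclusivity constraints. -/
def exclProg : Prog :=
  and (eq (comp fst snd) tt) (hasNextProg fst (comp stateOf snd) (comp actionOf snd))

/-- The reduction. -/
def reduction : Prog :=
  cons fst (map (cons (ite exclProg tt nil)
    (map (cons weightProg (cons costProg (ite freeProg tt nil))) (nodesProg fst))) (nodesProg .id))

section eval

lemma eval_oneIf {c : Prog} {y : Data} {p : Prop} [Decidable p] (hc : eval c y ≠ .nil ↔ p) :
    eval (oneIf c) y = .num (if p then 1 else 0) := by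
  rw [oneIf, eval_ite_of hc]
  split_ifs <;> simp [eval]

lemma eval_entryProg (p : Action I) (t : Fin I.n) :
    eval entryProg (.cons (.cons I.encode (code (.act p))) (code (.state t))) =
      .cons (.num (I.P p.1 p.2 t)) (.num (I.C p.1 p.2 t)) :=
  eval_datumProg rfl p t rfl rfl rfl

lemma eval_weightProg (a b : Node I) :
    eval weightProg (.cons (.cons I.encode (code a)) (code b)) = .num (W a b) := by
  classical
  set y : Data := .cons (.cons I.encode (code a)) (code b) with hy
  rw [weightProg, eval_ite_eq]
  cases a with
  | state s =>
    rw [if_pos (by rfl), eval_ite_eq]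
    have h1 : eval (sourceProg stateOf) y = eval (comp fst (comp fst fst)) y ↔ s = I.target :=
      Data.ofNat_inj.trans Fin.val_inj
    have h2 : eval (stateProg (sourceProg stateOf)) y = code (.state s) := rfl
    have h3 : eval (choiceProg (sourceProg stateOf) nil) y = code (.choice (start s)) := rfl
    have h4 : eval snd y = code b := rfl
    by_cases hs : s = I.target
    · rw [if_pos (h1.2 hs), eval_oneIf (eval_eq_ne_nil _ _), h2, h4, code_injective.eq_iff]
      cases b <;> simp [W, hs]
    · rw [if_neg fun h => hs (h1.1 h), eval_oneIf (eval_eq_ne_nil _ _), h3, h4,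
        code_injective.eq_iff]
      cases b <;> simp [W, hs]
  | choice p =>
    rw [if_neg (by rintro ⟨⟩), eval_ite_eq, if_pos (by rfl),
      eval_oneIf ((eval_or_ne_nil _ _).trans (or_congr (eval_eq_ne_nil _ _) (eval_eq_ne_nil _ _)))]
    have h2 : eval (actProg (sourceProg stateOf) (sourceProg actionOf)) y = code (.act p) := rfl
    have h3 : eval (choiceProg (sourceProg stateOf) (cons nil (sourceProg actionOf))) y =
        .cons (.ofNat 1) (.cons (.ofNat p.1) (.ofNat (p.2 + 1))) := rfl
    have h4 : eval snd y = code b := rfl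
    rw [h2, h3, h4, code_injective.eq_iff]
    cases b <;> simp [code, W, succ_eq_some_iff, Fin.val_inj]
  | act p =>
    rw [if_neg (by rintro ⟨⟩), eval_ite_eq, if_neg (by rintro ⟨⟩), eval_ite_eq]
    cases b with
    | state t =>
      rw [if_pos (by rfl), eval_comp, eval_entryProg]
      rfl
    | choice q => rw [if_neg (by rintro ⟨⟩)]; simp [W, eval]
    | act q => rw [if_neg (by rintro ⟨⟩)]; simp [W, eval]

lemma eval_costProg (a b : Node I) :
    eval costProg (.cons (.cons I.encode (code a)) (code b)) = .num (K a b) := by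
  classical
  rw [costProg, eval_ite_of ((eval_and_ne_nil _ _).trans
    (and_congr (eval_eq_ne_nil _ _) (eval_eq_ne_nil _ _)))]
  cases a with
  | act p =>
    cases b with
    | state t =>
      rw [if_pos ⟨rfl, rfl⟩, eval_comp, eval_entryProg]
      rfl
    | _ => rw [if_neg (by rintro ⟨-, ⟨⟩⟩)]; simp [K, eval]
  | _ => rw [if_neg (by rintro ⟨⟨⟩, -⟩)]; simp [K, eval]

lemma eval_freeProg (a b : Node I) :
    eval freeProg (.cons (.cons I.encode (code a)) (code b)) ≠ .nil ↔ Free a b := by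
  set y : Data := .cons (.cons I.encode (code a)) (code b) with hy
  rw [freeProg, eval_and_ne_nil, eval_eq_ne_nil, eval_or_ne_nil, eval_and_ne_nil, eval_eq_ne_nil,
    eval_eq_ne_nil]
  cases a with
  | choice p =>
    have h1 : eval (sourceProg fst) y = eval tt y := rfl
    have h2 : eval (actProg (sourceProg stateOf) (sourceProg actionOf)) y = code (.act p) := rfl
    have h3 : eval (choiceProg (sourceProg stateOf) (cons nil (sourceProg actionOf))) y =
        .cons (.ofNat 1) (.cons (.ofNat p.1) (.ofNat (p.2 + 1))) := rfl
    have h4 : eval snd y = code b := rfl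
    rw [eval_hasNextProg (I := I) rfl p rfl rfl, h1, h2, h3, h4, code_injective.eq_iff]
    cases b <;> simp [code, Free, succ_eq_some_iff, Fin.val_inj]
  | _ => exact ⟨by rintro ⟨⟨⟩, -⟩, fun h => h.elim⟩

lemma eval_exclProg (a : Node I) :
    eval exclProg (.cons I.encode (code a)) ≠ .nil ↔ Excl a := by
  rw [exclProg, eval_and_ne_nil, eval_eq_ne_nil]
  cases a with
  | choice p =>
    rw [eval_hasNextProg (I := I) rfl p rfl rfl]
    exact ⟨fun h => h.2, fun h => ⟨rfl, h⟩⟩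
  | _ => exact ⟨by rintro ⟨⟨⟩, -⟩, fun h => h.elim⟩

open Classical in
lemma encode_gpro : (gpro I).encode = .cons (.ofNat I.target) (.ofList ((nodes I).map fun a =>
    .cons (.ofBool (decide (Excl a))) (.ofList ((nodes I).map fun b =>
      .cons (.num (W a b)) (.cons (.num (K a b)) (.ofBool (decide (Free a b)))))))) := by
  rw [GPRO.encode]
  congr 1
  · exact congrArg _ (val_symm_state I.target)
  · simp_rw [← List.ofFn_getElem_map (nodes I)]
    simp only [mem_X, mem_F]
    rfl

lemma eval_reduction : eval reduction I.encode = (gpro I).encode := by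
  classical
  rw [reduction, eval_cons, encode_gpro, eval_map (eval_nodesProg (I := I) rfl)]
  congr 2
  refine List.map_congr_left fun a _ => ?_
  rw [eval_cons, eval_bool (eval_exclProg a), eval_map (eval_nodesProg (I := I) rfl)]
  congr 2
  refine List.map_congr_left fun b _ => ?_
  rw [eval_cons, eval_cons, eval_weightProg, eval_costProg, eval_bool (eval_freeProg a b)]

end eval

/-- The translation of policies. In the loops, the input is `comp fst fst`, the state is
`comp snd fst` and the action is `snd`. -/
def decodeProg : Prog :=
  map (find (or (not (hasNextProg (comp fst (comp fst fst)) (comp snd fst) snd))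
      (lookup (nodesProg (comp fst (comp fst fst))) (comp snd (comp fst fst))
        (choiceProg (comp snd fst) snd) (actProg (comp snd fst) snd)))
    nil (range (actsProg (comp fst fst) snd))) (range (comp snd fst))

lemma eval_decodeProg (π : (gpro I).Policy) :
    eval decodeProg (.cons I.encode ((gpro I).encodePolicy π)) = I.encodePolicy (toPolicy π) := by
  classical
  rw [decodeProg, eval_map (eval_range (eval_states (I := I) rfl)), List.map_finRange,
    SSP.encodePolicy]
  congr 2
  funext s
  rw [eval_find (eval_range (eval_actsProg (I := I) rfl s rfl)) (p := fun u => Takes π.1 ⟨s, u⟩)]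
  · rw [toPolicy, decode]
    cases (List.finRange (I.acts s)).find? fun u => decide (Takes π.1 ⟨s, u⟩) <;> rfl
  · intro u _
    have hnodes : eval (nodesProg (comp fst (comp fst fst)))
        (.cons (.cons (.cons I.encode ((gpro I).encodePolicy π)) (.ofNat s)) (.ofNat u)) =
          .ofList (List.ofFn fun i => code (node I i)) := by
      rw [eval_nodesProg (I := I) rfl, ← List.ofFn_getElem_map]
      rfl
    rw [eval_or_ne_nil, eval_not_ne_nil, eval_hasNextProg (I := I) rfl ⟨s, u⟩ rfl rfl,
      eval_lookup_ne_nil (code_injective.comp (node I).injective) hnodes rfl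
        (i := (node I).symm (.choice ⟨s, u⟩)) (j := (node I).symm (.act ⟨s, u⟩)),
      decide_eq_true_iff, takes_iff, Option.not_isSome_iff_eq_none, ne_eq, Data.ofBool_eq_nil]
    · simp
    · simp only [Function.comp_apply, Equiv.apply_symm_apply]
      rfl
    · simp only [Function.comp_apply, Equiv.apply_symm_apply]
      rfl

section PolyIn

variable {M : CostModel} {x s u t : Prog}

lemma polyIn_actsProg (hx : PolyIn M x) (hs : PolyIn M s) : PolyIn M (actsProg x s) :=
  .nth hs (.comp .snd hx)

lemma polyIn_hasNextProg (hx : PolyIn M x) (hs : PolyIn M s) (hu : PolyIn M u) :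
    PolyIn M (hasNextProg x s u) :=
  .comp .snd (.drop hu (polyIn_actsProg hx hs))

lemma polyIn_stateProg (hs : PolyIn M s) : PolyIn M (stateProg s) := .cons .nil (.cons hs .nil)

lemma polyIn_choiceProg (hs : PolyIn M s) (hu : PolyIn M u) : PolyIn M (choiceProg s u) :=
  .cons .tt (.cons hs hu)

lemma polyIn_actProg (hs : PolyIn M s) (hu : PolyIn M u) : PolyIn M (actProg s u) :=
  .cons (.cons .nil .tt) (.cons hs hu)

lemma polyIn_sourceProg {f : Prog} (hf : PolyIn M f) : PolyIn M (sourceProg f) :=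
  .comp hf (.comp .snd .fst)

lemma polyIn_oneIf {c : Prog} (hc : PolyIn M c) : PolyIn M (oneIf c) := .ite hc (.num 1) (.num 0)

lemma polyIn_nodesProg (hx : PolyIn M x) : PolyIn M (nodesProg x) := by
  have h : PolyIn M (range (actsProg (comp x fst) snd)) :=
    .range (polyIn_actsProg (.comp hx .fst) .snd)
  exact .append (.map (polyIn_stateProg .snd) (.range (.comp .snd hx)))
    (.append (.flatMap (.map (polyIn_choiceProg (.comp .snd .fst) .snd) h) (.range (.comp .snd hx)))
      (.flatMap (.map (polyIn_actProg (.comp .snd .fst) .snd) h) (.range (.comp .snd hx))))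

lemma polyIn_reduction : PolyIn M reduction := by
  have hS : PolyIn M (sourceProg stateOf) := polyIn_sourceProg (.comp .fst .snd)
  have hA : PolyIn M (sourceProg actionOf) := polyIn_sourceProg (.comp .snd .snd)
  have hF : PolyIn M (sourceProg fst) := polyIn_sourceProg .fst
  have hff : PolyIn M (comp fst fst) := .comp .fst .fst
  have hfs : PolyIn M (comp fst snd) := .comp .fst .snd
  have hnext : PolyIn M (choiceProg (sourceProg stateOf) (cons nil (sourceProg actionOf))) :=
    polyIn_choiceProg hS (.cons .nil hA)
  have hdatum : PolyIn M entryProg :=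
    .nth (.comp hfs .snd) (.nth hA (polyIn_actsProg hff hS))
  have hweight : PolyIn M weightProg :=
    .ite (.eq hF .nil)
      (.ite (.eq hS (.comp .fst hff)) (polyIn_oneIf (.eq .snd (polyIn_stateProg hS)))
        (polyIn_oneIf (.eq .snd (polyIn_choiceProg hS .nil))))
      (.ite (.eq hF .tt)
        (polyIn_oneIf (.or (.eq .snd (polyIn_actProg hS hA)) (.eq .snd hnext)))
        (.ite (.eq hfs .nil) (.comp .fst hdatum) (.num 0)))
  have hcost : PolyIn M costProg :=
    .ite (.and (.eq hF (.cons .nil .tt)) (.eq hfs .nil)) (.comp .snd hdatum) (.num 0)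
  have hfree : PolyIn M freeProg :=
    .and (.eq hF .tt) (.or (.and (.eq .snd (polyIn_actProg hS hA)) (polyIn_hasNextProg hff hS hA))
      (.eq .snd hnext))
  have hexcl : PolyIn M exclProg :=
    .and (.eq hfs .tt) (polyIn_hasNextProg .fst (.comp hfs .snd) (.comp (.comp .snd .snd) .snd))
  exact .cons .fst (.map (.cons (.ite hexcl .tt .nil)
    (.map (.cons hweight (.cons hcost (.ite hfree .tt .nil))) (polyIn_nodesProg .fst)))
    (polyIn_nodesProg .id))

lemma polyIn_decodeProg : PolyIn M decodeProg := by
  have hff : PolyIn M (comp fst fst) := .comp .fst .fst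
  have hs : PolyIn M (comp snd fst) := .comp .snd .fst
  exact .map (.find (.or (.not (polyIn_hasNextProg (.comp .fst hff) hs .snd))
      (.lookup (polyIn_nodesProg (.comp .fst hff)) (.comp .snd hff) (polyIn_choiceProg hs .snd)
        (polyIn_actProg hs .snd)))
    .nil (.range (polyIn_actsProg hff .snd))) (.range (.comp .snd .fst))

end PolyIn

end SSPToGPRO

/-! ### From GPRO to SSP: the instance -/

namespace GPROToSSP

/-- A free edge. -/
abbrev Edge (G : GPRO) : Type := {x : Fin G.n × Fin G.n // x ∈ G.F}

/-- The states of the SSP instance: the nodes and, for each free edge, a binary choice. -/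
inductive Node (G : GPRO) where
  | node (i : Fin G.n) : Node G
  | edge (x : Edge G) : Node G

variable {G : GPRO}

/-- The first free edge that leaves `i` towards a node satisfying `p`. -/
def firstEdge (G : GPRO) (i : Fin G.n) (p : Fin G.n → Prop) [DecidablePred p] : Option (Edge G) :=
  ((List.finRange G.n).find? fun j => p j ∧ (i, j) ∈ G.F).pmap (fun j hj => ⟨(i, j), hj⟩)
    fun j hj => by
      have := List.find?_some hj
      simp only [decide_eq_true_eq] at this
      exact this.2

lemma firstEdge_eq_some_iff {i : Fin G.n} {p : Fin G.n → Prop} [DecidablePred p] {x : Edge G} :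
    firstEdge G i p = some x ↔
      x.1.1 = i ∧ p x.1.2 ∧ ∀ j < x.1.2, p j → (i, j) ∉ G.F := by
  obtain ⟨⟨i', j⟩, hx⟩ := x
  rw [firstEdge, Option.pmap_eq_some_iff]
  constructor
  · rintro ⟨j', hj', h, he⟩
    cases he
    rw [List.find?_finRange_eq_some_iff] at h
    simp only [decide_eq_true_eq, not_and] at h
    exact ⟨rfl, h.1.1, h.2⟩
  · rintro ⟨h1, h2, h3⟩
    dsimp only at h1 h2 h3
    subst h1
    refine ⟨j, hx, ?_, rfl⟩
    rw [List.find?_finRange_eq_some_iff]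
    simp only [decide_eq_true_eq, not_and]
    exact ⟨⟨h2, hx⟩, h3⟩

lemma firstEdge_eq_none_iff {i : Fin G.n} {p : Fin G.n → Prop} [DecidablePred p] :
    firstEdge G i p = none ↔ ∀ j, p j → (i, j) ∉ G.F := by
  rw [firstEdge, Option.pmap_eq_none_iff, List.find?_eq_none]
  simp

/-- The first free edge that leaves `i`. -/
def start (i : Fin G.n) : Option (Edge G) := firstEdge G i fun _ => True

/-- The next free edge that leaves the same node. -/
def next (x : Edge G) : Option (Edge G) := firstEdge G x.1.1 fun j => x.1.2 < j

lemma exists_start {i : Fin G.n} (h : G.AllFree i) : ∃ x, start i = some x := by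
  rw [← Option.ne_none_iff_exists', start, ne_eq, firstEdge_eq_none_iff]
  obtain ⟨j, hj⟩ := G.exists_edge i
  exact fun h' => h' j trivial (h j hj)

open Classical in
/-- Where the choice about the free edge `x` leads: the action `0` follows the edge. The other
action goes on to the next free edge of the same node (and the last free edge is followed in any
case) or, if the node has also fixed edges, back to the node, which draws again. -/
noncomputable def dest (x : Edge G) (u : ℕ) : Node G :=
  if u = 0 then .node x.1.2
  else if G.AllFree x.1.1 then (next x).elim (.node x.1.2) .edge
  else .node x.1.1

open Classical in
/-- The cost of a choice: that of the edge, if it is followed. -/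
noncomputable def edgeCost (x : Edge G) (u : ℕ) : ℝ :=
  if u = 0 ∨ G.AllFree x.1.1 ∧ next x = none then G.K x.1.1 x.1.2 else 0

/-- The total weight of the edges that leave `i`. -/
def totalWeight (i : Fin G.n) : ℝ := ∑ j, G.W i j

open Classical in
/-- Transition probabilities. In a node with fixed edges, an edge is drawn as if all the free edges
were activated. -/
noncomputable def P : Node G → ℕ → Node G → ℝ
  | .node i, _, .node j =>
    if ¬ G.AllFree i ∧ (i, j) ∉ G.F then G.W i j / totalWeight i else 0
  | .node i, _, .edge x =>
    if G.AllFree i then if start i = some x then 1 else 0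
    else if x.1.1 = i then G.W i x.1.2 / totalWeight i else 0
  | .edge x, u, b => if b = dest x u then 1 else 0

/-- Transition costs. -/
noncomputable def C : Node G → ℕ → Node G → ℝ
  | .node i, _, .node j => G.K i j
  | .node _, _, .edge _ => 0
  | .edge x, u, _ => edgeCost x u

/-- Numbers of actions. -/
def acts : Node G → ℕ
  | .node _ => 1
  | .edge _ => 2

/-- The free edges, in lexicographic order. -/
def edges (G : GPRO) : List (Edge G) :=
  ((List.finRange G.n).product (List.finRange G.n)).filterMap fun x =>
    if h : x ∈ G.F then some ⟨x, h⟩ else none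

/-- The enumeration of the states. The nodes come first, with their own numbers. -/
def nodes (G : GPRO) : List (Node G) := (List.finRange G.n).map .node ++ (edges G).map .edge

lemma mem_edges (x : Edge G) : x ∈ edges G := by
  obtain ⟨⟨i, j⟩, h⟩ := x
  rw [edges, List.mem_filterMap]
  exact ⟨(i, j), List.mem_product.2 ⟨List.mem_finRange _, List.mem_finRange _⟩, dif_pos h⟩

lemma nodup_edges : (edges G).Nodup := by
  refine List.Nodup.filterMap (fun a a' b hb hb' => ?_)
    ((List.nodup_finRange _).product (List.nodup_finRange _))
  rw [Option.mem_def] at hb hb'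
  split_ifs at hb hb'
  cases hb
  cases hb'
  rfl

lemma mem_nodes (a : Node G) : a ∈ nodes G := by
  cases a <;> simp [nodes, mem_edges]

lemma nodup_nodes : (nodes G).Nodup := by
  rw [nodes, List.nodup_append']
  refine ⟨(List.nodup_finRange _).map fun a b h => by cases h; rfl,
    nodup_edges.map fun a b h => by cases h; rfl, ?_⟩
  intro a ha hb
  simp only [List.mem_map] at ha hb
  obtain ⟨p, -, rfl⟩ := ha
  obtain ⟨q, -, h⟩ := hb
  cases h

open Classical in
/-- The numbering of the states. -/
noncomputable def e (G : GPRO) : Fin (nodes G).length ≃ Node G :=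
  nodup_nodes.getEquivOfForallMemList _ mem_nodes

lemma e_apply (i : Fin (nodes G).length) : e G i = (nodes G)[i] := rfl

lemma val_symm_node (i : Fin G.n) : ((e G).symm (.node i)).val = i.val := by
  have h : i.val < (nodes G).length := by
    simp only [nodes, List.length_append, List.length_map, List.length_finRange]
    omega
  have : (e G).symm (.node i) = ⟨i.val, h⟩ := by
    rw [Equiv.symm_apply_eq, e_apply]
    simp [nodes, List.getElem_append_left]
  rw [this]

/-- A sum over the states. -/
lemma sum_e (g : Node G → ℝ) :
    ∑ s, g (e G s) = ∑ i, g (.node i) + ∑ x, g (.edge x) := by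
  let E : Fin G.n ⊕ Edge G ≃ Node G :=
    { toFun := Sum.elim .node .edge
      invFun := fun a => match a with
        | .node i => .inl i
        | .edge x => .inr x
      left_inv := by rintro (i | x) <;> rfl
      right_inv := by rintro (i | x) <;> rfl }
  rw [← (E.trans (e G).symm).sum_comp, Fintype.sum_sum_type]
  simp [E]

/-- A sum over the free edges that leave `i`. -/
lemma sum_edge (i : Fin G.n) (c : Edge G → ℝ) :
    ∑ x : Edge G, (if x.1.1 = i then c x else 0) =
      ∑ j, if h : (i, j) ∈ G.F then c ⟨(i, j), h⟩ else 0 := by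
  rw [← Finset.sum_filter]
  symm
  rw [← Finset.sum_filter_add_sum_filter_not Finset.univ fun j => (i, j) ∈ G.F]
  rw [Finset.sum_eq_zero (s := Finset.univ.filter fun j => (i, j) ∉ G.F)
    fun j hj => dif_neg (Finset.mem_filter.1 hj).2, add_zero]
  refine Finset.sum_bij (fun j hj => ⟨(i, j), (Finset.mem_filter.1 hj).2⟩) ?_ ?_ ?_ ?_
  · intro j hj
    simp
  · intro j hj j' hj' h
    simpa using h
  · rintro ⟨⟨i', j⟩, h⟩ hx
    obtain rfl : i' = i := by simpa using hx
    exact ⟨j, by simp [h], rfl⟩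
  · intro j hj
    exact dif_pos (Finset.mem_filter.1 hj).2

lemma totalWeight_pos (i : Fin G.n) : 0 < totalWeight i := by
  obtain ⟨j, hj⟩ := G.exists_edge i
  exact Finset.sum_pos' (fun k _ => G.W_nonneg i k) ⟨j, Finset.mem_univ j, hj⟩

/-- An expectation over the successors of a node with fixed edges. -/
lemma sum_P_node {i : Fin G.n} (hi : ¬ G.AllFree i) (u : ℕ) (g : Node G → ℝ) :
    totalWeight i * ∑ s, P (.node i) u (e G s) * g (e G s) =
      ∑ j, G.W i j * if h : (i, j) ∈ G.F then g (.edge ⟨(i, j), h⟩) else g (.node j) := by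
  classical
  have hS := (totalWeight_pos i).ne'
  rw [sum_e fun b => P (.node i) u b * g b]
  have h1 : ∑ x : Edge G, P (.node i) u (.edge x) * g (.edge x) =
      ∑ x : Edge G, if x.1.1 = i then G.W i x.1.2 / totalWeight i * g (.edge x) else 0 := by
    refine Finset.sum_congr rfl fun x _ => ?_
    rw [P, if_neg hi]
    split_ifs <;> simp
  rw [h1, sum_edge, ← Finset.sum_add_distrib, Finset.mul_sum]
  refine Finset.sum_congr rfl fun j _ => ?_
  by_cases h : (i, j) ∈ G.F
  · simp only [P, h, hi, not_true, and_false, if_false, dif_pos]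
    field_simp
    ring
  · simp only [P, h, hi, not_false_eq_true, and_self, if_true, dif_neg]
    field_simp
    ring

lemma sum_P_start {i : Fin G.n} (hi : G.AllFree i) {x : Edge G} (hx : start i = some x) (u : ℕ)
    (g : Node G → ℝ) : ∑ s, P (.node i) u (e G s) * g (e G s) = g (.edge x) := by
  classical
  rw [sum_e fun b => P (.node i) u b * g b]
  simp [P, hi, hx]

lemma sum_P_edge (x : Edge G) (u : ℕ) (g : Node G → ℝ) :
    ∑ s, P (.edge x) u (e G s) * g (e G s) = g (dest x u) := by
  rw [Finset.sum_eq_single ((e G).symm (dest x u))]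
  · simp [P]
  · intro s _ hs
    rw [P, if_neg fun h => hs (by rw [← h, Equiv.symm_apply_apply]), zero_mul]
  · simp

lemma P_nonneg (a : Node G) (u : ℕ) (b : Node G) : 0 ≤ P a u b := by
  have h : ∀ i j, 0 ≤ G.W i j / totalWeight i := fun i j =>
    div_nonneg (G.W_nonneg i j) (totalWeight_pos i).le
  cases a <;> cases b <;> simp only [P] <;> split_ifs <;>
    first
    | exact h _ _
    | norm_num

lemma P_sum (a : Node G) (u : ℕ) : ∑ s, P a u (e G s) = 1 := by
  cases a with
  | edge x => simpa using sum_P_edge x u fun _ => 1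
  | node i =>
    by_cases hi : G.AllFree i
    · obtain ⟨x, hx⟩ := exists_start hi
      simpa using sum_P_start hi hx u fun _ => 1
    · have h := sum_P_node hi u fun _ => 1
      simp only [mul_one, dite_eq_ite, ite_self] at h
      exact mul_left_cancel₀ (totalWeight_pos i).ne' (h.trans (mul_one _).symm)

lemma not_allFree_target : ¬ G.AllFree G.target := fun h =>
  G.target_fixed (h _ ((G.target_edge _).2 rfl))

lemma P_target (u : ℕ) : P (.node G.target) u (.node G.target) = 1 := by
  rw [P, if_pos ⟨not_allFree_target, G.target_fixed⟩]
  have : totalWeight G.target = G.W G.target G.target := by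
    refine Finset.sum_eq_single _ (fun j _ hj => ?_) (by simp)
    exact le_antisymm (not_lt.1 fun h => hj ((G.target_edge j).1 h)) (G.W_nonneg _ _)
  rw [this, div_self ((G.target_edge _).2 rfl).ne']

/-! Let `A` be the set of the free edges that are followed where they are considered. -/

/-- The choice about `x` ends with following it. -/
def Taken (A : Edge G → Prop) (x : Edge G) : Prop := A x ∨ next x = none

/-- The free edges that are activated if the choices are made according to `A`: where all edges are
free, the first one that is followed when it is considered. -/
def Selected (A : Edge G → Prop) (x : Edge G) : Prop :=
  (G.AllFree x.1.1 → Taken A x ∧ ∀ y : Edge G, y.1.1 = x.1.1 → y.1.2 < x.1.2 → ¬ A y) ∧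
    (¬ G.AllFree x.1.1 → A x)

open Classical in
/-- The set of the edges that are activated if the choices are made according to `A`. -/
noncomputable def edgeSet (A : Edge G → Prop) : Finset (Fin G.n × Fin G.n) :=
  G.F.filter fun x => ∃ h : x ∈ G.F, Selected A ⟨x, h⟩

lemma mem_edgeSet {A : Edge G → Prop} {x : Fin G.n × Fin G.n} :
    x ∈ edgeSet A ↔ ∃ h : x ∈ G.F, Selected A ⟨x, h⟩ := by
  classical
  rw [edgeSet, Finset.mem_filter]
  exact ⟨fun h => h.2, fun h => ⟨h.1, h⟩⟩

lemma mem_edgeSet_coe {A : Edge G → Prop} {x : Edge G} : x.1 ∈ edgeSet A ↔ Selected A x := by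
  rw [mem_edgeSet]
  exact ⟨fun h => h.2, fun h => ⟨x.2, h⟩⟩

lemma next_ne_none {x y : Edge G} (h1 : y.1.1 = x.1.1) (h2 : x.1.2 < y.1.2) : next x ≠ none := by
  rw [next, ne_eq, firstEdge_eq_none_iff]
  intro h
  refine h _ h2 ?_
  rw [← h1]
  exact y.2

lemma edge_ext {x y : Edge G} (h1 : x.1.1 = y.1.1) (h2 : x.1.2 = y.1.2) : x = y :=
  Subtype.ext (Prod.ext h1 h2)

lemma existsUnique_selected (A : Edge G → Prop) {i : Fin G.n} (hi : G.AllFree i) :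
    ∃ x : Edge G, (x.1.1 = i ∧ Selected A x) ∧
      ∀ y : Edge G, y.1.1 = i → Selected A y → y = x := by
  classical
  obtain ⟨x₀, hx₀⟩ := exists_start hi
  obtain ⟨h₀, -, -⟩ := firstEdge_eq_some_iff.1 hx₀
  -- the last free edge is followed in any case
  obtain ⟨z, hz, hzmax⟩ := Finset.exists_max_image (Finset.univ.filter fun x : Edge G => x.1.1 = i)
    (fun x => x.1.2) ⟨x₀, by simp [h₀]⟩
  rw [Finset.mem_filter_univ] at hz
  have hzT : Taken A z := by
    refine .inr (firstEdge_eq_none_iff.2 fun j hj hF => ?_)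
    have := hzmax ⟨(z.1.1, j), hF⟩ (by simp [hz])
    exact absurd hj this.not_gt
  obtain ⟨x, hx, hxmin⟩ := Finset.exists_min_image
    (Finset.univ.filter fun x : Edge G => x.1.1 = i ∧ Taken A x) (fun x => x.1.2)
    ⟨z, by simp [hz, hzT]⟩
  rw [Finset.mem_filter_univ] at hx
  have hlt : ∀ y : Edge G, y.1.1 = i → y.1.2 < x.1.2 → ¬ Taken A y := fun y hy hyx hyT =>
    absurd hyx (hxmin y (by simp [hy, hyT])).not_gt
  refine ⟨x, ⟨hx.1, fun _ => ⟨hx.2, fun y hy hyx hA => hlt y (hy.trans hx.1) hyx (.inl hA)⟩,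
    fun h => absurd (hx.1 ▸ hi) h⟩, fun y hy hyS => ?_⟩
  obtain ⟨hyT, hy'⟩ := hyS.1 (hy ▸ hi)
  refine edge_ext (hy.trans hx.1.symm) (le_antisymm (not_lt.1 fun h => ?_) (not_lt.1 fun h => ?_))
  · rcases hx.2 with hA | hN
    · exact hy' x (hx.1.trans hy.symm) h hA
    · exact next_ne_none (hy.trans hx.1.symm) h hN
  · exact hlt y hy h hyT

/-- Induction along the sequence of choices that leads to the selected edge. -/
lemma selected_induction {A : Edge G → Prop} {motive : Edge G → Prop} {x : Edge G}
    (hx : G.AllFree x.1.1) (hS : Selected A x) (base : motive x)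
    (step : ∀ y z, y.1.1 = x.1.1 → next y = some z → ¬ A y → motive z → motive y) {x₀ : Edge G}
    (hx₀ : start x.1.1 = some x₀) : motive x₀ := by
  have key : ∀ k, ∀ y : Edge G, y.1.1 = x.1.1 → y.1.2 ≤ x.1.2 → x.1.2.val - y.1.2.val ≤ k →
      motive y := by
    intro k
    induction k with
    | zero =>
      intro y hy hle hk
      rw [Fin.le_def] at hle
      rwa [edge_ext hy (Fin.ext (by omega))]
    | succ k ih =>
      intro y hy hle hk
      rcases hle.eq_or_lt with h | h
      · rwa [edge_ext hy h]
      obtain ⟨z, hz⟩ := Option.ne_none_iff_exists'.1 (next_ne_none hy.symm h)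
      obtain ⟨h1, h2, h3⟩ := firstEdge_eq_some_iff.1 hz
      have h4 : z.1.2 ≤ x.1.2 := not_lt.1 fun h' => h3 _ h' h (by rw [hy]; exact x.2)
      rw [Fin.lt_def] at h2
      rw [Fin.le_def] at h4
      exact step y z hy hz ((hS.1 hx).2 y hy h) (ih z (h1.trans hy) h4 (by omega))
  obtain ⟨h1, -, h3⟩ := firstEdge_eq_some_iff.1 hx₀
  exact key _ x₀ h1 (not_lt.1 fun h => h3 _ h trivial x.2) le_rfl

lemma weight_edgeSet_pos_iff {A : Edge G → Prop} {i j : Fin G.n} :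
    0 < G.weight (edgeSet A) i j ↔ 0 < G.W i j ∧ ∀ h : (i, j) ∈ G.F, Selected A ⟨(i, j), h⟩ := by
  rw [GPROData.weight_pos_iff, mem_edgeSet]
  exact and_congr_right fun _ => ⟨fun h h' => (h h').2, fun h h' => ⟨h', h h'⟩⟩

/-- Where all edges are free, the selected edge is the only one in use. -/
lemma weight_edgeSet_pos_iff_of_selected {A : Edge G → Prop} {x : Edge G} (hx : G.AllFree x.1.1)
    (hS : Selected A x) (j : Fin G.n) : 0 < G.weight (edgeSet A) x.1.1 j ↔ j = x.1.2 := by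
  obtain ⟨z, -, hz⟩ := existsUnique_selected A hx
  rw [weight_edgeSet_pos_iff]
  constructor
  · rintro ⟨h1, h2⟩
    have h3 := (hz ⟨(x.1.1, j), hx j h1⟩ rfl (h2 _)).trans (hz x rfl hS).symm
    rw [← h3]
  · rintro rfl
    exact ⟨G.free_edge _ _ x.2, fun _ => hS⟩

lemma admissible_edgeSet (A : Edge G → Prop) : G.Admissible (edgeSet A) := by
  refine ⟨fun x h => (mem_edgeSet.1 h).1, fun i => ?_, fun i hi => ?_⟩
  · by_cases hi : G.AllFree i
    · obtain ⟨x, ⟨rfl, hx⟩, -⟩ := existsUnique_selected A hi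
      exact ⟨x.1.2, weight_edgeSet_pos_iff.2 ⟨G.free_edge _ _ x.2, fun _ => hx⟩⟩
    · have hi' := hi
      simp only [GPROData.AllFree, not_forall] at hi'
      obtain ⟨j, hj, hF⟩ := hi'
      exact ⟨j, weight_edgeSet_pos_iff.2 ⟨hj, fun h => absurd h hF⟩⟩
  · obtain ⟨x, ⟨rfl, hx⟩, huniq⟩ := existsUnique_selected A (G.exclusive i hi).2
    refine ⟨x.1.2, mem_edgeSet_coe.2 hx, fun j hj => ?_⟩
    obtain ⟨h, hS⟩ := mem_edgeSet.1 hj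
    rw [← huniq ⟨(x.1.1, j), h⟩ rfl hS]

/-- The number of the action used in a state. -/
noncomputable def actionOf (A : Edge G → Prop) : Node G → ℕ
  | .node _ => 0
  | .edge x => open Classical in if A x then 0 else 1

lemma dest_of_selected {A : Edge G → Prop} {x : Edge G} (hx : G.AllFree x.1.1)
    (hS : Selected A x) : dest x (actionOf A (.edge x)) = .node x.1.2 := by
  rw [actionOf, dest]
  rcases (hS.1 hx).1 with h | h <;> simp +contextual [h, hx]

lemma edgeCost_of_selected {A : Edge G → Prop} {x : Edge G} (hx : G.AllFree x.1.1)
    (hS : Selected A x) : edgeCost x (actionOf A (.edge x)) = G.K x.1.1 x.1.2 := by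
  rw [actionOf, edgeCost]
  rcases (hS.1 hx).1 with h | h <;> simp [h, hx]

lemma dest_of_next {A : Edge G → Prop} {x y : Edge G} (hx : G.AllFree x.1.1)
    (hA : ¬ A x) (hy : next x = some y) : dest x (actionOf A (.edge x)) = .edge y := by
  simp [actionOf, dest, hA, hx, hy]

lemma edgeCost_of_next {A : Edge G → Prop} {x y : Edge G}
    (hA : ¬ A x) (hy : next x = some y) : edgeCost x (actionOf A (.edge x)) = 0 := by
  simp [actionOf, edgeCost, hA, hy]

/-- The transitions of positive probability. -/
def Step (A : Edge G → Prop) (a b : Node G) : Prop := 0 < P a (actionOf A a) b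

lemma step_edge_iff {A : Edge G → Prop} {x : Edge G} {b : Node G} :
    Step A (.edge x) b ↔ b = dest x (actionOf A (.edge x)) := by
  rw [Step, P]
  split_ifs with h <;> simp [h]

lemma reaches_node {A : Edge G → Prop} {i j : Fin G.n} (h : 0 < G.weight (edgeSet A) i j) :
    Relation.ReflTransGen (Step A) (.node i) (.node j) := by
  obtain ⟨hW, hsel⟩ := weight_edgeSet_pos_iff.1 h
  by_cases hi : G.AllFree i
  · have hF := hi j hW
    have hS := hsel hF
    obtain ⟨x₀, hx₀⟩ := exists_start hi
    refine .head (b := .edge x₀) (by simp [Step, P, hi, hx₀]) ?_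
    refine selected_induction (x := ⟨(i, j), hF⟩) (motive := fun y =>
      Relation.ReflTransGen (Step A) (.edge y) (.node j)) hi hS ?_ ?_ hx₀
    · exact .single (step_edge_iff.2 (dest_of_selected (x := ⟨(i, j), hF⟩) hi hS).symm)
    · intro y z hy hyz hA ih
      exact .head (step_edge_iff.2 (dest_of_next (by rw [hy]; exact hi) hA hyz).symm) ih
  · have hpos : 0 < G.W i j / totalWeight i := div_pos hW (totalWeight_pos i)
    by_cases hF : (i, j) ∈ G.F
    · have hA : A ⟨(i, j), hF⟩ := (hsel hF).2 hi
      refine .head (b := .edge ⟨(i, j), hF⟩) (by simpa [Step, P, hi] using hpos) ?_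
      exact .single (step_edge_iff.2 (by simp [dest, actionOf, hA]))
    · exact .single (by simpa [Step, P, hi, hF] using hpos)

lemma reaches_target (A : Edge G → Prop) (a : Node G) :
    Relation.ReflTransGen (Step A) a (.node G.target) := by
  have hnode : ∀ i, Relation.ReflTransGen (Step A) (.node i) (.node G.target) := by
    intro i
    induction G.target_reachable _ (admissible_edgeSet A) i
      using Relation.ReflTransGen.head_induction_on with
    | refl => exact .refl
    | head h _ ih => exact (reaches_node h).trans ih
  cases a with
  | node i => exact hnode i
  | edge x =>
    have key : ∀ k, ∀ y : Edge G, G.n - y.1.2.val ≤ k →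
        Relation.ReflTransGen (Step A) (.edge y) (.node G.target) := by
      intro k
      induction k with
      | zero =>
        intro y hy
        have := y.1.2.2
        omega
      | succ k ih =>
        intro y hy
        refine .head (step_edge_iff.2 rfl) ?_
        rw [dest]
        split_ifs
        · exact hnode _
        · cases hn : next y with
          | none => exact hnode _
          | some z =>
            obtain ⟨-, h, -⟩ := firstEdge_eq_some_iff.1 hn
            rw [Fin.lt_def] at h
            exact ih z (by omega)
        · exact hnode _
    exact key _ x le_rfl

/-- A choice of actions, as the set of the edges that are followed where they are considered. -/
def followed (μ : (s : Fin (nodes G).length) → Fin (acts (e G s))) (x : Edge G) : Prop :=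
  (μ ((e G).symm (.edge x))).val = 0

lemma val_eq_actionOf (μ : (s : Fin (nodes G).length) → Fin (acts (e G s))) (a : Node G) :
    (μ ((e G).symm a)).val = actionOf (followed μ) a := by
  have h := (μ ((e G).symm a)).2
  generalize hu : (μ ((e G).symm a)).val = u at h ⊢
  rw [Equiv.apply_symm_apply] at h
  cases a with
  | node i => exact Nat.lt_one_iff.1 h
  | edge x =>
    rw [acts] at h
    rw [actionOf]
    split_ifs with hA
    · exact hu ▸ hA
    · have : u ≠ 0 := fun h0 => hA (hu.trans h0)
      omega

/-- The SSP instance. -/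
noncomputable abbrev ssp (G : GPRO) : SSP where
  n := (nodes G).length
  target := (e G).symm (.node G.target)
  acts s := acts (e G s)
  P s u s' := P (e G s) u (e G s')
  C s u s' := C (e G s) u (e G s')
  acts_pos s := by cases e G s <;> simp [acts]
  P_nonneg _ _ _ := P_nonneg _ _ _
  P_sum _ _ := P_sum _ _
  target_absorbing u := by
    generalize u.val = k
    rw [Equiv.apply_symm_apply]
    exact P_target k
  target_cost_free u := by
    generalize u.val = k
    rw [Equiv.apply_symm_apply]
    exact G.target_cost_free
  target_reachable μ s := by
    obtain ⟨a, rfl⟩ := (e G).symm.surjective s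
    refine (reaches_target (followed μ) a).lift (e G).symm fun a b h => ?_
    rw [Function.onFun, val_eq_actionOf, Equiv.apply_symm_apply, Equiv.apply_symm_apply]
    exact h

lemma acts_eq (s : Fin (ssp G).n) : (ssp G).acts s = 1 ∨ (ssp G).acts s = 2 := by
  change acts (e G s) = 1 ∨ acts (e G s) = 2
  cases e G s <;> simp [acts]

lemma numStatesWith_one : (ssp G).numStatesWith 1 = G.n := by
  have : (Finset.univ.filter fun s => (ssp G).acts s = 1) =
      Finset.univ.image fun i => (e G).symm (.node i) := by
    ext s
    obtain ⟨a, rfl⟩ := (e G).symm.surjective s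
    rw [Finset.mem_filter_univ]
    change acts (e G ((e G).symm a)) = 1 ↔ _
    rw [Equiv.apply_symm_apply]
    cases a <;> simp [acts]
  rw [SSP.numStatesWith, this, Finset.card_image_of_injective _ fun i j h => by simpa using h,
    Finset.card_univ, Fintype.card_fin]

lemma numStatesWith_two : (ssp G).numStatesWith 2 = G.F.card := by
  have : (Finset.univ.filter fun s => (ssp G).acts s = 2) =
      Finset.univ.image fun x => (e G).symm (.edge x) := by
    ext s
    obtain ⟨a, rfl⟩ := (e G).symm.surjective s
    rw [Finset.mem_filter_univ]
    change acts (e G ((e G).symm a)) = 2 ↔ _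
    rw [Equiv.apply_symm_apply]
    cases a <;> simp [acts]
  rw [SSP.numStatesWith, this, Finset.card_image_of_injective _ fun i j h => by simpa using h,
    Finset.card_univ, Fintype.card_coe]

end GPROToSSP

/-! ### From GPRO to SSP: policies and values -/

namespace GPROToSSP

variable {G : GPRO}

/-- The state that stands for the node `i`. -/
noncomputable def nodeState (i : Fin G.n) : Fin (ssp G).n := (e G).symm (.node i)

lemma nodeState_injective : Function.Injective (nodeState (G := G)) := fun i j h => by
  simpa [nodeState] using h

lemma nodeState_target : nodeState G.target = (ssp G).target := rfl

/-- The policy of the GPRO instance that a policy of the SSP instance stands for. -/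
noncomputable def toPolicy (π : (ssp G).Policy) : G.Policy :=
  ⟨edgeSet (followed π), admissible_edgeSet _⟩

lemma singleChoice_toPolicy (π : (ssp G).Policy) : G.SingleChoice (toPolicy π) := by
  intro i hi
  obtain ⟨x, ⟨rfl, hx⟩, huniq⟩ := existsUnique_selected (followed π) hi
  refine ⟨x.1.2, mem_edgeSet_coe.2 hx, fun j hj => ?_⟩
  obtain ⟨h, hS⟩ := mem_edgeSet.1 hj
  rw [← huniq ⟨(x.1.1, j), h⟩ rfl hS]

open Classical in
/-- The policy that follows the edges in `A` where they are considered. -/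
noncomputable def policy (A : Edge G → Prop) : (ssp G).Policy := fun s =>
  ⟨if ∃ x, e G s = .edge x ∧ ¬ A x then 1 else 0, by
    change _ < acts (e G s)
    split_ifs with h
    · obtain ⟨x, hx, -⟩ := h
      rw [hx, acts]
      norm_num
    · cases e G s <;> simp [acts]⟩

lemma followed_policy (A : Edge G → Prop) : followed (policy A) = A := by
  funext x
  simp [followed, policy]

/-- Expected cost of using the action `u` in `a` once, followed by the terminal cost `f`. -/
noncomputable def qValue (f : Node G → ℝ) (a : Node G) (u : ℕ) : ℝ :=
  ∑ s, P a u (e G s) * (C a u (e G s) + f (e G s))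

lemma actionValue_eq (f : Node G → ℝ) (a : Node G) (u : Fin ((ssp G).acts ((e G).symm a))) :
    (ssp G).actionValue (fun s => f (e G s)) ((e G).symm a) u = qValue f a u.val := by
  rw [SSP.actionValue, qValue]
  refine Finset.sum_congr rfl fun s _ => ?_
  change P (e G ((e G).symm a)) u.val _ * (C (e G ((e G).symm a)) u.val _ + _) = _
  generalize u.val = k
  rw [Equiv.apply_symm_apply]

lemma qValue_edge (f : Node G → ℝ) (x : Edge G) (u : ℕ) :
    qValue f (.edge x) u = edgeCost x u + f (dest x u) :=
  sum_P_edge x u fun b => C (.edge x) u b + f b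

lemma qValue_start (f : Node G → ℝ) {i : Fin G.n} (hi : G.AllFree i) {x : Edge G}
    (hx : start i = some x) (u : ℕ) : qValue f (.node i) u = f (.edge x) :=
  (sum_P_start hi hx u fun b => C (.node i) u b + f b).trans (zero_add _)

/-- In a node with fixed edges: drawing among all edges and starting over when the edge drawn is
not activated amounts to drawing among the activated edges. -/
lemma totalWeight_mul_sub (A : Edge G → Prop) (f : Node G → ℝ) {i : Fin G.n}
    (hi : ¬ G.AllFree i) (u : ℕ)
    (h1 : ∀ x : Edge G, x.1.1 = i → A x → f (.edge x) = G.K i x.1.2 + f (.node x.1.2))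
    (h2 : ∀ x : Edge G, x.1.1 = i → ¬ A x → f (.edge x) = f (.node i)) :
    totalWeight i * (qValue f (.node i) u - f (.node i)) =
      ∑ j, G.weight (edgeSet A) i j * (G.K i j + f (.node j) - f (.node i)) := by
  have hq : totalWeight i * qValue f (.node i) u = _ :=
    sum_P_node hi u fun b => C (.node i) u b + f b
  rw [mul_sub, hq, totalWeight, Finset.sum_mul, ← Finset.sum_sub_distrib]
  refine Finset.sum_congr rfl fun j _ => ?_
  rw [GPROData.weight, ← mul_sub]
  by_cases hF : (i, j) ∈ G.F
  · have hiff : (i, j) ∈ G.F \ edgeSet A ↔ ¬ A ⟨(i, j), hF⟩ := by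
      rw [Finset.mem_sdiff, mem_edgeSet]
      simp [hF, Selected, hi]
    rw [dif_pos hF]
    by_cases hA : A ⟨(i, j), hF⟩
    · rw [if_neg fun h => hiff.1 h hA, h1 _ rfl hA]
      simp [C]
    · rw [if_pos (hiff.2 hA), h2 _ rfl hA]
      simp [C]
  · rw [dif_neg hF, if_neg fun h => hF (Finset.mem_sdiff.1 h).1]
    rfl

lemma nodeValue_sub (π : G.Policy) (v : Fin G.n → ℝ) (i : Fin G.n) :
    (∑ j, G.weight π.1 i j) * (GPRO.nodeValue π v i - v i) =
      ∑ j, G.weight π.1 i j * (G.K i j + v j - v i) := by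
  rw [mul_sub, GPRO.sum_weight_mul_nodeValue, Finset.sum_mul, ← Finset.sum_sub_distrib]
  exact Finset.sum_congr rfl fun j _ => (mul_sub _ _ _).symm

lemma sum_weight_eq_zero_iff (π : G.Policy) (v : Fin G.n → ℝ) (i : Fin G.n) :
    ∑ j, G.weight π.1 i j * (G.K i j + v j - v i) = 0 ↔ v i = GPRO.nodeValue π v i := by
  rw [← nodeValue_sub, mul_eq_zero, or_iff_right (GPRO.sum_weight_pos π i).ne', sub_eq_zero,
    eq_comm]

lemma sum_weight_nonneg_iff (π : G.Policy) (v : Fin G.n → ℝ) (i : Fin G.n) :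
    0 ≤ ∑ j, G.weight π.1 i j * (G.K i j + v j - v i) ↔ v i ≤ GPRO.nodeValue π v i := by
  rw [← nodeValue_sub, mul_nonneg_iff_of_pos_left (GPRO.sum_weight_pos π i), sub_nonneg]

lemma value_toPolicy (π : (ssp G).Policy) (i : Fin G.n) :
    G.value (toPolicy π) i = (ssp G).value π (nodeState i) := by
  set A := followed π with hA
  set f : Node G → ℝ := fun a => (ssp G).value π ((e G).symm a) with hf
  have hv : ∀ a, f a = qValue f a (actionOf A a) := fun a => by
    rw [hA, ← val_eq_actionOf, ← actionValue_eq]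
    simp only [hf, Equiv.symm_apply_apply]
    exact SSP.value_eq π _
  refine GPRO.value_unique (toPolicy π) (w := fun i => f (.node i)) (SSP.value_target π)
    (fun i _ => ?_) i
  by_cases hi : G.AllFree i
  · obtain ⟨x, ⟨rfl, hx⟩, -⟩ := existsUnique_selected A hi
    obtain ⟨x₀, hx₀⟩ := exists_start hi
    rw [GPRO.nodeValue_of_unique (toPolicy π) _ (weight_edgeSet_pos_iff_of_selected hi hx), hv,
      qValue_start f hi hx₀]
    refine selected_induction (motive := fun y => f (.edge y) = _) hi hx ?_ ?_ hx₀
    · rw [hv, qValue_edge, dest_of_selected hi hx, edgeCost_of_selected hi hx]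
    · intro y z hy hyz hAy ih
      rw [hv, qValue_edge, dest_of_next (by rw [hy]; exact hi) hAy hyz, edgeCost_of_next hAy hyz,
        zero_add, ih]
  · refine (sum_weight_eq_zero_iff (toPolicy π) (fun i => f (.node i)) i).1 ?_
    refine (totalWeight_mul_sub A f hi 0 ?_ ?_).symm.trans ?_
    · rintro x rfl hx
      rw [hv, qValue_edge]
      simp [actionOf, hx, edgeCost, dest]
    · rintro x rfl hx
      rw [hv, qValue_edge]
      simp [actionOf, hx, edgeCost, dest, hi]
    · rw [mul_eq_zero, sub_eq_zero]
      exact .inr (hv (.node i)).symm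

lemma toPolicy_policy {A : Edge G → Prop} {μ : G.Policy}
    (h : ∀ x, Selected A x ↔ x.1 ∈ μ.1) : toPolicy (policy A) = μ := by
  refine Subtype.ext (Finset.ext fun x => ?_)
  change x ∈ edgeSet (followed (policy A)) ↔ _
  rw [followed_policy, mem_edgeSet]
  constructor
  · rintro ⟨hF, hS⟩
    exact (h ⟨x, hF⟩).1 hS
  · intro hx
    exact ⟨μ.2.1 hx, (h ⟨x, μ.2.1 hx⟩).2 hx⟩

/-- A single-choice policy `μ` comes from `A` if, in each node, `A` agrees with `μ` up to the first
activated edge, and everywhere in a node with fixed edges. -/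
lemma selected_iff_mem {A : Edge G → Prop} {μ : G.Policy} (hμ : G.SingleChoice μ)
    (hmem : ∀ x : Edge G, x.1 ∈ μ.1 → A x)
    (hfix : ∀ x : Edge G, ¬ G.AllFree x.1.1 → A x → x.1 ∈ μ.1)
    (hbefore : ∀ x z : Edge G, z.1 ∈ μ.1 → z.1.1 = x.1.1 → x.1.2 < z.1.2 → G.AllFree x.1.1 → ¬ A x)
    (x : Edge G) : Selected A x ↔ x.1 ∈ μ.1 := by
  by_cases hx : G.AllFree x.1.1
  · obtain ⟨j, hj, -⟩ := hμ _ hx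
    set z : Edge G := ⟨(x.1.1, j), μ.2.1 hj⟩ with hz
    have hzS : Selected A z := by
      refine ⟨fun _ => ⟨.inl (hmem z hj), fun y hy hyz => ?_⟩, fun h => absurd hx h⟩
      exact hbefore y z hj hy.symm hyz (by rw [hy]; exact hx)
    obtain ⟨x', -, hx'⟩ := existsUnique_selected A hx
    constructor
    · intro hxS
      rw [(hx' x rfl hxS).trans (hx' z rfl hzS).symm]
      exact hj
    · intro hxμ
      have : x = z := edge_ext rfl ((hμ _ hx).unique hxμ hj)
      rwa [this]
  · exact ⟨fun h => hfix x hx (h.2 hx), fun h => ⟨fun h' => absurd h' hx, fun _ => hmem x h⟩⟩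

lemma exists_toPolicy_eq {μ : G.Policy} (hμ : G.SingleChoice μ) :
    ∃ π : (ssp G).Policy, toPolicy π = μ := by
  refine ⟨policy fun x => x.1 ∈ μ.1, toPolicy_policy (selected_iff_mem hμ (fun _ h => h)
    (fun _ _ h => h) fun x z hz hzx hlt hx h => hlt.ne ?_)⟩
  exact (hμ _ hx).unique h (by rw [← hzx]; exact hz)

/-! ### Optimality in GPRO -/

open Classical in
/-- Replace in `μ` the activated edges that leave `i` by those that lead to `T`. -/
noncomputable def replaceRow (μ : Finset (Fin G.n × Fin G.n)) (i : Fin G.n) (T : Fin G.n → Prop) :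
    Finset (Fin G.n × Fin G.n) :=
  G.F.filter fun x => if x.1 = i then T x.2 else x ∈ μ

lemma replaceRow_subset {μ : Finset (Fin G.n × Fin G.n)} {i : Fin G.n} {T : Fin G.n → Prop} :
    replaceRow μ i T ⊆ G.F := by
  classical exact Finset.filter_subset _ _

lemma mem_replaceRow_self {μ : Finset (Fin G.n × Fin G.n)} {i j : Fin G.n} {T : Fin G.n → Prop} :
    (i, j) ∈ replaceRow μ i T ↔ (i, j) ∈ G.F ∧ T j := by
  simp [replaceRow]

lemma mem_replaceRow_of_ne {μ : G.Policy} {i k j : Fin G.n} {T : Fin G.n → Prop}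
    (hk : k ≠ i) : (k, j) ∈ replaceRow μ.1 i T ↔ (k, j) ∈ μ.1 := by
  simp only [replaceRow, Finset.mem_filter, hk, if_false, and_iff_right_iff_imp]
  exact fun h => μ.2.1 h

lemma weight_replaceRow_of_ne {μ : G.Policy} {i k j : Fin G.n} {T : Fin G.n → Prop}
    (hk : k ≠ i) : G.weight (replaceRow μ.1 i T) k j = G.weight μ.1 k j := by
  simp only [GPROData.weight, Finset.mem_sdiff, mem_replaceRow_of_ne hk]

lemma singleChoice_row_replaceRow {μ : G.Policy} (hμ : G.SingleChoice μ) {i : Fin G.n}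
    {T : Fin G.n → Prop} (hT : G.AllFree i → ∃! j, (i, j) ∈ G.F ∧ T j) {k : Fin G.n}
    (hk : G.AllFree k) : ∃! j, (k, j) ∈ replaceRow μ.1 i T := by
  by_cases h : k = i
  · subst h
    simpa only [mem_replaceRow_self] using hT hk
  · simpa only [mem_replaceRow_of_ne h] using hμ k hk

lemma admissible_replaceRow {μ : G.Policy} (hμ : G.SingleChoice μ) {i : Fin G.n}
    {T : Fin G.n → Prop} (hT : G.AllFree i → ∃! j, (i, j) ∈ G.F ∧ T j) :
    G.Admissible (replaceRow μ.1 i T) := by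
  refine ⟨replaceRow_subset, fun k => ?_, fun k hk =>
    singleChoice_row_replaceRow hμ hT (G.exclusive k hk).2⟩
  by_cases hk : G.AllFree k
  · obtain ⟨j, hj, -⟩ := singleChoice_row_replaceRow hμ hT hk
    exact ⟨j, GPROData.weight_pos_iff.2
      ⟨G.free_edge _ _ (replaceRow_subset hj), fun _ => hj⟩⟩
  · simp only [GPROData.AllFree, not_forall] at hk
    obtain ⟨j, hj, hF⟩ := hk
    exact ⟨j, GPROData.weight_pos_iff.2 ⟨hj, fun h => absurd h hF⟩⟩

/-- The optimality condition in the node `i`, for a policy that is optimal among the single-choice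
policies: no other single choice of the activated edges `T` is better. -/
lemma sum_replaceRow_nonneg {μ : G.Policy} (hμ : G.SingleChoice μ)
    (hopt : ∀ ν : G.Policy, G.SingleChoice ν → ∀ i, G.value μ i ≤ G.value ν i) {i : Fin G.n}
    {T : Fin G.n → Prop} (hT : G.AllFree i → ∃! j, (i, j) ∈ G.F ∧ T j) :
    0 ≤ ∑ j, G.weight (replaceRow μ.1 i T) i j * (G.K i j + G.value μ j - G.value μ i) := by
  let ν : G.Policy := ⟨replaceRow μ.1 i T, admissible_replaceRow hμ hT⟩
  refine (sum_weight_nonneg_iff ν (G.value μ) i).2 ?_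
  refine (G.properChain μ).le_stepValue_of_update (G.properChain ν) i (fun k hk j => ?_)
    (hopt ν fun k hk => singleChoice_row_replaceRow hμ hT hk)
  refine ⟨?_, fun _ => rfl⟩
  simp only [Matrix.of_apply, GPROData.prob, ν, weight_replaceRow_of_ne hk]

/-- Where all edges are free, no edge is better than the activated one. -/
lemma value_le_of_allFree {μ : G.Policy} (hμ : G.SingleChoice μ)
    (hopt : ∀ ν : G.Policy, G.SingleChoice ν → ∀ i, G.value μ i ≤ G.value ν i) {i j : Fin G.n}
    (hi : G.AllFree i) (hj : (i, j) ∈ G.F) :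
    G.value μ i ≤ G.K i j + G.value μ j := by
  have h := sum_replaceRow_nonneg hμ hopt (i := i) (T := fun k => k = j)
    fun _ => ⟨j, ⟨hj, rfl⟩, fun k hk => hk.2⟩
  rw [Finset.sum_eq_single j] at h
  · have hW : 0 < G.weight (replaceRow μ.1 i fun k => k = j) i j :=
      GPROData.weight_pos_iff.2 ⟨G.free_edge _ _ hj, fun _ => mem_replaceRow_self.2 ⟨hj, rfl⟩⟩
    have := (mul_nonneg_iff_of_pos_left hW).1 h
    linarith
  · intro k _ hk
    have : G.weight (replaceRow μ.1 i fun k => k = j) i k = 0 := by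
      refine le_antisymm (not_lt.1 fun h' => ?_) (GPRO.weight_nonneg _ _ _)
      obtain ⟨h1, h2⟩ := GPROData.weight_pos_iff.1 h'
      exact hk (mem_replaceRow_self.1 (h2 (hi k h1))).2
    rw [this, zero_mul]
  · simp

/-- A policy that is optimal among the single-choice policies is optimal: where all edges are free,
activating several edges yields an average of the values of the single edges. -/
lemma optimal_of_singleChoice {μ : G.Policy} (hμ : G.SingleChoice μ)
    (hopt : ∀ ν : G.Policy, G.SingleChoice ν → ∀ i, G.value μ i ≤ G.value ν i) :
    G.Optimal μ := by
  refine GPRO.optimal_of_bellman μ (w := G.value μ) (GPRO.value_target μ)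
    (fun i _ => GPRO.value_eq μ i) fun ν i _ => ?_
  rw [← sum_weight_nonneg_iff]
  by_cases hi : G.AllFree i
  · refine Finset.sum_nonneg fun j _ => ?_
    rcases (GPRO.weight_nonneg ν.1 i j).eq_or_lt with h | h
    · rw [← h, zero_mul]
    · have := value_le_of_allFree hμ hopt hi (hi j (GPROData.weight_pos_iff.1 h).1)
      exact mul_nonneg h.le (by linarith)
  · have h := sum_replaceRow_nonneg hμ hopt (i := i) (T := fun j => (i, j) ∈ ν.1)
      fun h => absurd h hi
    refine h.trans_eq (Finset.sum_congr rfl fun j _ => ?_)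
    congr 1
    simp only [GPROData.weight, Finset.mem_sdiff, mem_replaceRow_self, not_and]
    by_cases hF : (i, j) ∈ G.F <;> simp [hF]

/-- Where an edge is fixed, an activated edge is not worse than starting over. -/
lemma le_value_of_mem {μ : G.Policy} (hμ : G.SingleChoice μ)
    (hopt : ∀ ν : G.Policy, G.SingleChoice ν → ∀ i, G.value μ i ≤ G.value ν i) {i j : Fin G.n}
    (hi : ¬ G.AllFree i) (hj : (i, j) ∈ μ.1) :
    G.K i j + G.value μ j ≤ G.value μ i := by
  have h := sum_replaceRow_nonneg hμ hopt (i := i) (T := fun k => (i, k) ∈ μ.1 ∧ k ≠ j)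
    fun h => absurd h hi
  have h0 := (sum_weight_eq_zero_iff μ (G.value μ) i).2 (GPRO.value_eq μ i)
  rw [← h0] at h
  rw [← Finset.add_sum_erase _ _ (Finset.mem_univ j), ← Finset.add_sum_erase _ _
    (Finset.mem_univ j), Finset.sum_congr rfl (s₂ := Finset.univ.erase j)
    (g := fun k => G.weight (replaceRow μ.1 i fun k => (i, k) ∈ μ.1 ∧ k ≠ j) i k *
      (G.K i k + G.value μ k - G.value μ i))] at h
  · have h1 := le_of_add_le_add_right h
    have h2 : G.weight (replaceRow μ.1 i fun k => (i, k) ∈ μ.1 ∧ k ≠ j) i j = 0 := by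
      rw [GPROData.weight, if_pos]
      rw [Finset.mem_sdiff, mem_replaceRow_self]
      exact ⟨μ.2.1 hj, fun h => h.2.2 rfl⟩
    have h3 : 0 < G.weight μ.1 i j :=
      GPROData.weight_pos_iff.2 ⟨G.free_edge _ _ (μ.2.1 hj), fun _ => hj⟩
    rw [h2, zero_mul] at h1
    by_contra! hlt
    have := mul_pos h3 (sub_pos.2 hlt)
    linarith
  · intro k hk
    have hkj := Finset.ne_of_mem_erase hk
    congr 1
    simp only [GPROData.weight, Finset.mem_sdiff, mem_replaceRow_self]
    by_cases hF : (i, k) ∈ G.F <;> simp [hF, hkj]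

/-- Where an edge is fixed, a free edge that is not activated is not better than starting over. -/
lemma value_le_of_notMem {μ : G.Policy} (hμ : G.SingleChoice μ)
    (hopt : ∀ ν : G.Policy, G.SingleChoice ν → ∀ i, G.value μ i ≤ G.value ν i) {i j : Fin G.n}
    (hi : ¬ G.AllFree i) (hF : (i, j) ∈ G.F)
    (hj : (i, j) ∉ μ.1) : G.value μ i ≤ G.K i j + G.value μ j := by
  have h := sum_replaceRow_nonneg hμ hopt (i := i) (T := fun k => (i, k) ∈ μ.1 ∨ k = j)
    fun h => absurd h hi
  have h0 := (sum_weight_eq_zero_iff μ (G.value μ) i).2 (GPRO.value_eq μ i)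
  rw [← h0] at h
  rw [← Finset.add_sum_erase _ _ (Finset.mem_univ j), ← Finset.add_sum_erase _ _
    (Finset.mem_univ j), Finset.sum_congr rfl (s₂ := Finset.univ.erase j)
    (g := fun k => G.weight (replaceRow μ.1 i fun k => (i, k) ∈ μ.1 ∨ k = j) i k *
      (G.K i k + G.value μ k - G.value μ i))] at h
  · have h1 := le_of_add_le_add_right h
    have h2 : G.weight μ.1 i j = 0 := by
      rw [GPROData.weight, if_pos (Finset.mem_sdiff.2 ⟨hF, hj⟩)]
    have h3 : 0 < G.weight (replaceRow μ.1 i fun k => (i, k) ∈ μ.1 ∨ k = j) i j :=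
      GPROData.weight_pos_iff.2 ⟨G.free_edge _ _ hF, fun _ => mem_replaceRow_self.2 ⟨hF, .inr rfl⟩⟩
    rw [h2, zero_mul] at h1
    have := (mul_nonneg_iff_of_pos_left h3).1 h1
    linarith
  · intro k hk
    have hkj := Finset.ne_of_mem_erase hk
    congr 1
    simp only [GPROData.weight, Finset.mem_sdiff, mem_replaceRow_self]
    by_cases hF : (i, k) ∈ G.F <;> simp [hF, hkj]

/-! ### From GPRO to SSP: optimal policies -/

lemma optimal_toPolicy {π : (ssp G).Policy} (h : (ssp G).Optimal π) : G.Optimal (toPolicy π) := by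
  refine optimal_of_singleChoice (singleChoice_toPolicy π) fun ν hν i => ?_
  obtain ⟨π', rfl⟩ := exists_toPolicy_eq hν
  rw [value_toPolicy, value_toPolicy]
  exact h π' _

/-- The value of following the edge `x`. -/
def followValue (v : Fin G.n → ℝ) (x : Edge G) : ℝ := G.K x.1.1 x.1.2 + v x.1.2

/-- The free edges that leave the same node as `x`, from `x` on. -/
def laterEdges (x : Edge G) : Finset (Edge G) :=
  Finset.univ.filter fun y => y.1.1 = x.1.1 ∧ x.1.2 ≤ y.1.2

lemma mem_laterEdges {x y : Edge G} : y ∈ laterEdges x ↔ y.1.1 = x.1.1 ∧ x.1.2 ≤ y.1.2 :=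
  Finset.mem_filter_univ _

/-- The least value of following `x` or a later free edge of the same node. -/
noncomputable def bestValue (v : Fin G.n → ℝ) (x : Edge G) : ℝ :=
  (laterEdges x).inf' ⟨x, mem_laterEdges.2 ⟨rfl, le_rfl⟩⟩ (followValue v)

lemma bestValue_le (v : Fin G.n → ℝ) {x y : Edge G} (h1 : y.1.1 = x.1.1) (h2 : x.1.2 ≤ y.1.2) :
    bestValue v x ≤ followValue v y :=
  Finset.inf'_le _ (mem_laterEdges.2 ⟨h1, h2⟩)

lemma le_bestValue {v : Fin G.n → ℝ} {x : Edge G} {r : ℝ}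
    (h : ∀ y : Edge G, y.1.1 = x.1.1 → x.1.2 ≤ y.1.2 → r ≤ followValue v y) : r ≤ bestValue v x :=
  Finset.le_inf' _ _ fun y hy => h y (mem_laterEdges.1 hy).1 (mem_laterEdges.1 hy).2

lemma bestValue_next (v : Fin G.n → ℝ) {x y : Edge G} (h : next x = some y) :
    bestValue v x = min (followValue v x) (bestValue v y) := by
  obtain ⟨h1, h2, h3⟩ := firstEdge_eq_some_iff.1 h
  refine le_antisymm (le_min (bestValue_le v rfl le_rfl) (le_bestValue fun z hz hyz =>
    bestValue_le v (hz.trans h1) (h2.le.trans hyz))) (le_bestValue fun z hz hxz => ?_)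
  rcases hxz.eq_or_lt with he | hlt
  · rw [edge_ext hz he.symm]
    exact min_le_left _ _
  · refine (min_le_right _ _).trans (bestValue_le v (hz.trans h1.symm) (not_lt.1 fun h' => ?_))
    exact h3 _ h' hlt (by rw [← hz]; exact z.2)

lemma bestValue_of_last (v : Fin G.n → ℝ) {x : Edge G} (h : next x = none) :
    bestValue v x = followValue v x := by
  refine le_antisymm (bestValue_le v rfl le_rfl) (le_bestValue fun z hz hxz => ?_)
  rcases hxz.eq_or_lt with he | hlt
  · rw [edge_ext hz he.symm]
  · exact absurd h (next_ne_none hz hlt)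

/-- Every optimal single-choice policy comes from an optimal policy of the SSP instance. The choices
that are not reached, those after the first activated edge, have to be made optimally, too. -/
lemma exists_optimal {μ : G.Policy} (hopt : G.Optimal μ) (hμ : G.SingleChoice μ) :
    ∃ π : (ssp G).Policy, (ssp G).Optimal π ∧ toPolicy π = μ := by
  classical
  have hopt' : ∀ ν : G.Policy, G.SingleChoice ν → ∀ i, G.value μ i ≤ G.value ν i :=
    fun ν _ => hopt ν
  set v := G.value μ with hv
  -- in a node with fixed edges, activate the edges of `μ`; elsewhere, follow the edge `z` of `μ`
  -- and those of the later edges that are best possible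
  let A : Edge G → Prop := fun x => x.1 ∈ μ.1 ∨ G.AllFree x.1.1 ∧
    (∃ z : Edge G, z.1 ∈ μ.1 ∧ z.1.1 = x.1.1 ∧ z.1.2 < x.1.2) ∧ followValue v x = bestValue v x
  have hSel : ∀ x, Selected A x ↔ x.1 ∈ μ.1 := by
    refine selected_iff_mem hμ (fun _ => .inl) (fun x hx h => h.resolve_right fun h' => hx h'.1) ?_
    rintro x z hz hzx hlt hx (h | ⟨-, ⟨z', hz', hzx', hlt'⟩, -⟩)
    · exact hlt.ne ((hμ _ hx).unique h (by rw [← hzx]; exact hz))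
    · have : z'.1.2 = z.1.2 := (hμ _ hx).unique (by rw [← hzx']; exact hz') (by rw [← hzx]; exact hz)
      exact lt_asymm hlt (this ▸ hlt')
  have hμe : (toPolicy (policy A)) = μ := toPolicy_policy hSel
  have hset : edgeSet A = μ.1 := by
    rw [← hμe, toPolicy]
    simp only [followed_policy]
  have hz : ∀ x : Edge G, x.1 ∈ μ.1 → G.AllFree x.1.1 → v x.1.1 = followValue v x := by
    intro x hx hfree
    rw [hv, GPRO.value_eq, GPRO.nodeValue_of_unique μ (G.value μ) (j₀ := x.1.2)]
    · rfl
    · rw [← hset]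
      exact weight_edgeSet_pos_iff_of_selected hfree ((hSel x).2 hx)
  have hle : ∀ x : Edge G, G.AllFree x.1.1 → v x.1.1 ≤ followValue v x := fun x hx =>
    value_le_of_allFree hμ hopt' hx x.2
  have hbest : ∀ x z : Edge G, G.AllFree x.1.1 → z.1 ∈ μ.1 → z.1.1 = x.1.1 → x.1.2 ≤ z.1.2 →
      bestValue v x = v x.1.1 := by
    intro x z hx hzμ hzx hxz
    refine le_antisymm ?_ (le_bestValue fun y hy _ => ?_)
    · rw [← hzx, hz z hzμ (by rw [hzx]; exact hx)]
      exact bestValue_le v hzx hxz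
    · rw [← hy]
      exact hle y (by rw [hy]; exact hx)
  -- the solution of the optimality equations
  let f : Node G → ℝ
    | .node i => v i
    | .edge x => if G.AllFree x.1.1 then bestValue v x else min (followValue v x) (v x.1.1)
  have hmixed : ∀ x : Edge G, ¬ G.AllFree x.1.1 →
      f (.edge x) = if A x then followValue v x else v x.1.1 := by
    intro x hx
    simp only [f, if_neg hx]
    split_ifs with hA
    · exact min_eq_left (le_value_of_mem hμ hopt' hx (hA.resolve_right fun h => hx h.1))
    · exact min_eq_right (value_le_of_notMem hμ hopt' hx x.2 fun h => hA (.inl h))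
  -- the optimality equations in the nodes, where there is a single action
  have hnode : ∀ i u, f (.node i) = qValue f (.node i) u := by
    intro i u
    by_cases hi : G.AllFree i
    · obtain ⟨x, hx⟩ := exists_start hi
      obtain ⟨rfl, -, h3⟩ := firstEdge_eq_some_iff.1 hx
      obtain ⟨j, hj, -⟩ := hμ _ hi
      rw [qValue_start f hi hx]
      simp only [f, if_pos hi]
      exact (hbest x ⟨(x.1.1, j), μ.2.1 hj⟩ hi hj rfl
        (not_lt.1 fun h => h3 _ h trivial (μ.2.1 hj))).symm
    · have h := totalWeight_mul_sub A f hi u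
        (by rintro x rfl hA; rw [hmixed x hi, if_pos hA]; rfl)
        (by rintro x rfl hA; rw [hmixed x hi, if_neg hA])
      rw [hset, (sum_weight_eq_zero_iff μ v i).2 (GPRO.value_eq μ i), mul_eq_zero,
        or_iff_right (totalWeight_pos i).ne', sub_eq_zero] at h
      exact h.symm
  have hedge : ∀ x : Edge G, f (.edge x) = qValue f (.edge x) (actionOf A (.edge x)) := by
    intro x
    rw [qValue_edge]
    by_cases hx : G.AllFree x.1.1
    · by_cases hA : A x
      · have h1 : bestValue v x = followValue v x := by
          rcases hA with h | h
          · rw [hbest x x hx h rfl le_rfl, hz x h hx]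
          · exact h.2.2.symm
        simp only [actionOf, if_pos hA, dest, edgeCost]
        simp only [f, if_pos hx, h1, true_or, if_true]
        rfl
      · cases hn : next x with
        | none =>
          simp only [actionOf, if_neg hA, dest, edgeCost]
          simp only [f, if_pos hx, hx, hn, bestValue_of_last v hn, one_ne_zero, if_false, if_true,
            and_self, or_true, Option.elim_none]
          rfl
        | some y =>
          rw [dest_of_next hx hA hn, edgeCost_of_next hA hn, zero_add]
          obtain ⟨h1, h2, h3⟩ := firstEdge_eq_some_iff.1 hn
          have hy : G.AllFree y.1.1 := by rw [h1]; exact hx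
          simp only [f, if_pos hx, if_pos hy]
          obtain ⟨j, hj, -⟩ := hμ _ hx
          rcases lt_trichotomy x.1.2 j with hlt | heq | hgt
          · rw [hbest x ⟨(x.1.1, j), μ.2.1 hj⟩ hx hj rfl hlt.le, hbest y ⟨(x.1.1, j), μ.2.1 hj⟩ hy
              hj h1.symm (not_lt.1 fun h => h3 _ h hlt (μ.2.1 hj)), h1]
          · exact absurd (.inl (by rw [← heq] at hj; exact hj)) hA
          · have hne : followValue v x ≠ bestValue v x := fun h =>
              hA (.inr ⟨hx, ⟨⟨(x.1.1, j), μ.2.1 hj⟩, hj, rfl, hgt⟩, h⟩)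
            have hmin := bestValue_next v hn
            rcases min_choice (followValue v x) (bestValue v y) with h | h
            · exact absurd (hmin.trans h).symm hne
            · exact hmin.trans h
    · rw [hmixed x hx]
      by_cases hA : A x
      · simp only [actionOf, if_pos hA, dest, edgeCost, true_or, if_true]
        rfl
      · simp [actionOf, hA, hx, dest, edgeCost, f]
  have hedge_le : ∀ (x : Edge G) (u : ℕ), f (.edge x) ≤ qValue f (.edge x) u := by
    intro x u
    rw [qValue_edge, dest, edgeCost]
    by_cases hu : u = 0
    · simp only [hu, true_or, if_true]
      simp only [f]
      split_ifs with hx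
      · exact bestValue_le v rfl le_rfl
      · exact min_le_left _ _
    · by_cases hx : G.AllFree x.1.1
      · cases hn : next x with
        | none =>
          simp only [f, hu, hx, false_or, and_self, if_true, if_false, Option.elim_none]
          exact bestValue_le v rfl le_rfl
        | some y =>
          obtain ⟨h1, h2, h3⟩ := firstEdge_eq_some_iff.1 hn
          have hy : G.AllFree y.1.1 := by rw [h1]; exact hx
          simp only [f, hu, hx, hy, false_or, true_and, reduceCtorEq, if_true, if_false,
            Option.elim_some, zero_add]
          exact (bestValue_next v hn).trans_le (min_le_right _ _)
      · simp [f, hu, hx]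
  refine ⟨policy A, ?_, hμe⟩
  refine SSP.optimal_of_bellman (policy A) (w := fun s => f (e G s)) ?_ (fun s _ => ?_)
    fun s _ u => ?_
  · change f (e G ((e G).symm (.node G.target))) = 0
    rw [Equiv.apply_symm_apply]
    exact GPRO.value_target μ
  · obtain ⟨a, rfl⟩ := (e G).symm.surjective s
    rw [actionValue_eq, val_eq_actionOf, followed_policy]
    simp only [Equiv.apply_symm_apply]
    cases a with
    | node i => exact hnode i _
    | edge x => exact hedge x
  · obtain ⟨a, rfl⟩ := (e G).symm.surjective s
    rw [actionValue_eq]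
    simp only [Equiv.apply_symm_apply]
    cases a with
    | node i => exact (hnode i _).le
    | edge x => exact hedge_le x _

end GPROToSSP

/-! ### From GPRO to SSP: the programs -/

namespace GPROToSSP

open Prog

variable {G : GPRO}

/-- The label of a state in the computation: its kind and the numbers that determine it. -/
def code : Node G → Data
  | .node i => .cons (.ofNat 0) (.cons (.ofNat i) .nil)
  | .edge x => .cons (.ofNat 1) (.cons (.ofNat x.1.1) (.ofNat x.1.2))

lemma code_injective : Function.Injective (code (G := G)) := by
  intro a b h
  cases a with
  | node i =>
    cases b <;> simp [code, Fin.val_inj] at h ⊢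
    exact h
  | edge x =>
    cases b <;> simp [code, Fin.val_inj] at h ⊢
    exact edge_ext h.1 h.2

/-! The arguments `x`, `i`, `j` of the following programs are programs that compute the GPRO
instance and the numbers of two nodes. Inside a loop over the nodes, the number of the current node
is `snd`, and `outer p` computes what `p` computes outside the loop. -/

/-- Inside a loop, what `p` computes outside of it. -/
def outer (p : Prog) : Prog := comp p fst

/-- The weight, the cost and the mark of free edges of a pair of nodes. -/
def datumProg (x i j : Prog) : Prog := nth j (comp snd (nth i (comp snd x)))

def weightProg (x i j : Prog) : Prog := comp fst (datumProg x i j)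

def costProg (x i j : Prog) : Prog := comp fst (comp snd (datumProg x i j))

def freeProg (x i j : Prog) : Prog := comp snd (comp snd (datumProg x i j))

/-- The numbers of the nodes. -/
def indexProg (x : Prog) : Prog := range (comp snd x)

/-- The test whether all the edges that leave `i` are free. -/
def allFreeProg (x i : Prog) : Prog :=
  not (any (and (lt (num 0) (weightProg (outer x) (outer i) snd))
    (not (freeProg (outer x) (outer i) snd))) (indexProg x))

/-- The total weight of the edges that leave `i`. -/
def totalProg (x i : Prog) : Prog := sum (weightProg (outer x) (outer i) snd) (indexProg x)

/-- The label of a node; as a unary number, the kind `0` is `nil`. -/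
def nodeProg (i : Prog) : Prog := cons nil (cons i nil)

/-- The label of a free edge; as a unary number, the kind `1` is `tt`. -/
def edgeProg (i j : Prog) : Prog := cons tt (cons i j)

/-- The list of the labels of the states. -/
def nodesProg (x : Prog) : Prog :=
  append (map (nodeProg snd) (indexProg x))
    (flatMap (flatMap (ite (freeProg (outer (outer x)) (outer snd) snd)
      (cons (edgeProg (outer snd) snd) nil) nil) (indexProg (outer x))) (indexProg x))

/-- The test whether a free edge leads from `i` to a node that passes the test `p`. -/
def hasEdgeProg (x i p : Prog) : Prog :=
  any (and p (freeProg (outer x) (outer i) snd)) (indexProg x)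

/-- The label of the first free edge that leads from `i` to a node that passes the test `p`. -/
def firstEdgeProg (x i p : Prog) : Prog :=
  edgeProg i (find (and p (freeProg (outer x) (outer i) snd)) nil (indexProg x))

/-- Inside a loop, the test whether the current node comes after `j`. -/
def afterProg (j : Prog) : Prog := drop (outer j) snd

section eval

variable {y : Data} {x i j : Prog}

lemma eval_outer (p : Prog) (a : Data) : eval (outer p) (.cons y a) = eval p y := rfl

lemma eval_outer_of {p : Prog} {d : Data} (h : eval p y = d) (a : Data) :
    eval (outer p) (.cons y a) = d := h

lemma eval_rows (hx : eval x y = G.encode) : eval (comp snd x) y =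
    .ofList (List.ofFn fun i => .cons (.ofBool (decide (i ∈ G.X)))
      (.ofList (List.ofFn fun j =>
        .cons (.num (G.W i j)) (.cons (.num (G.K i j)) (.ofBool (decide ((i, j) ∈ G.F))))))) := by
  rw [eval_comp, hx]
  rfl

lemma eval_indexProg (hx : eval x y = G.encode) :
    eval (indexProg x) y = .ofList ((List.finRange G.n).map fun i : Fin G.n => .ofNat i) :=
  eval_range (eval_rows hx)

lemma eval_datumProg (hx : eval x y = G.encode) {i' j' : Fin G.n} (hi : eval i y = .ofNat i')
    (hj : eval j y = .ofNat j') : eval (datumProg x i j) y =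
      .cons (.num (G.W i' j')) (.cons (.num (G.K i' j')) (.ofBool (decide ((i', j') ∈ G.F)))) := by
  rw [datumProg]
  refine eval_nth j' hj (c := fun j' => .cons (.num (G.W i' j')) (.cons (.num (G.K i' j'))
    (.ofBool (decide ((i', j') ∈ G.F))))) ?_
  rw [eval_comp, eval_nth i' hi (eval_rows hx)]
  rfl

lemma eval_weightProg (hx : eval x y = G.encode) {i' j' : Fin G.n} (hi : eval i y = .ofNat i')
    (hj : eval j y = .ofNat j') : eval (weightProg x i j) y = .num (G.W i' j') := by
  rw [weightProg, eval_comp, eval_datumProg hx hi hj]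
  rfl

lemma eval_costProg (hx : eval x y = G.encode) {i' j' : Fin G.n} (hi : eval i y = .ofNat i')
    (hj : eval j y = .ofNat j') : eval (costProg x i j) y = .num (G.K i' j') := by
  rw [costProg, eval_comp, eval_comp, eval_datumProg hx hi hj]
  rfl

lemma eval_freeProg (hx : eval x y = G.encode) {i' j' : Fin G.n} (hi : eval i y = .ofNat i')
    (hj : eval j y = .ofNat j') : eval (freeProg x i j) y ≠ .nil ↔ (i', j') ∈ G.F := by
  rw [freeProg, eval_comp, eval_comp, eval_datumProg hx hi hj, ne_eq, eval_snd, eval_snd,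
    Data.ofBool_eq_nil]
  simp

lemma eval_lt_ne_nil {f g : Prog} {a b : ℝ} (hf : eval f y = .num a) (hg : eval g y = .num b) :
    eval (lt f g) y ≠ .nil ↔ a < b := by
  simp [eval, hf, hg, Data.lt]

lemma eval_allFreeProg (hx : eval x y = G.encode) {i' : Fin G.n} (hi : eval i y = .ofNat i') :
    eval (allFreeProg x i) y ≠ .nil ↔ G.AllFree i' := by
  have h : ∀ j' : Fin G.n, eval (and (lt (num 0) (weightProg (outer x) (outer i) snd))
      (not (freeProg (outer x) (outer i) snd))) (.cons y (.ofNat j')) ≠ .nil ↔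
        0 < G.W i' j' ∧ (i', j') ∉ G.F := by
    intro j'
    rw [eval_and_ne_nil, eval_not_ne_nil, eval_freeProg (eval_outer_of hx _) (eval_outer_of hi _) (j' := j') rfl,
      eval_lt_ne_nil (eval_num 0)
        (eval_weightProg (eval_outer_of hx _) (eval_outer_of hi _) (j' := j') rfl),
      Rat.cast_zero]
  rw [allFreeProg, eval_not_ne_nil, eval_any_ne_nil (eval_indexProg hx), GPROData.AllFree]
  simp only [h, List.mem_finRange, true_and, not_exists, not_and, not_not]

lemma eval_totalProg (hx : eval x y = G.encode) {i' : Fin G.n} (hi : eval i y = .ofNat i') :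
    eval (totalProg x i) y = .num (totalWeight i') := by
  rw [totalProg, eval_sum (eval_indexProg hx) (v := G.W i')
    fun j' _ => eval_weightProg (eval_outer_of hx _) (eval_outer_of hi _) (j' := j') rfl, totalWeight,
    Fin.sum_univ_def]

lemma map_edges {β : Type*} (f : Edge G → β) :
    (edges G).map f = (List.finRange G.n).flatMap fun i => (List.finRange G.n).flatMap fun j =>
      if h : (i, j) ∈ G.F then [f ⟨(i, j), h⟩] else [] := by
  rw [edges, List.map_filterMap, List.product, List.filterMap_flatMap]
  refine List.flatMap_congr fun i _ => ?_
  rw [List.filterMap_map, List.filterMap_eq_flatMap_toList]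
  refine List.flatMap_congr fun j _ => ?_
  by_cases h : (i, j) ∈ G.F <;> simp [h]

lemma eval_nodesProg (hx : eval x y = G.encode) :
    eval (nodesProg x) y = .ofList ((nodes G).map code) := by
  rw [nodesProg, eval_append (eval_map (eval_indexProg hx))
    (eval_flatMap (eval_indexProg hx) (G := fun i => (List.finRange G.n).flatMap fun j =>
      if h : (i, j) ∈ G.F then [code (.edge ⟨(i, j), h⟩)] else []) fun i _ => ?_)]
  · rw [nodes, List.map_append, List.map_map, List.map_map, map_edges]
    rfl
  · refine eval_flatMap (eval_indexProg (eval_outer_of hx _)) fun j _ => ?_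
    rw [eval_ite_of (eval_freeProg (eval_outer_of (eval_outer_of hx _) _) (i' := i) (j' := j)
      (eval_outer_of rfl _) rfl)]
    split_ifs <;> rfl

lemma eval_after_ne_nil {j' : ℕ} (hj : eval j y = .ofNat j') (k : ℕ) :
    eval (afterProg j) (.cons y (.ofNat k)) ≠ .nil ↔ j' < k := by
  rw [afterProg, eval_drop_ofNat (L := List.replicate k .nil) (eval_outer_of hj _) rfl,
    Data.ofList_ne_nil_iff, ne_eq, List.drop_eq_nil_iff, List.length_replicate, not_le]

section firstEdge

variable {p : Prog} {i' : Fin G.n} {p' : Fin G.n → Prop}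

lemma eval_edge_test (hx : eval x y = G.encode) (hi : eval i y = .ofNat i')
    (hp : ∀ k : Fin G.n, eval p (.cons y (.ofNat k)) ≠ .nil ↔ p' k) (k : Fin G.n) :
    eval (and p (freeProg (outer x) (outer i) snd)) (.cons y (.ofNat k)) ≠ .nil ↔
      p' k ∧ (i', k) ∈ G.F := by
  rw [eval_and_ne_nil, hp, eval_freeProg (eval_outer_of hx _) (eval_outer_of hi _) (j' := k) rfl]

variable [DecidablePred p']

lemma eval_hasEdgeProg (hx : eval x y = G.encode) (hi : eval i y = .ofNat i')
    (hp : ∀ k : Fin G.n, eval p (.cons y (.ofNat k)) ≠ .nil ↔ p' k) :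
    eval (hasEdgeProg x i p) y ≠ .nil ↔ firstEdge G i' p' ≠ none := by
  rw [hasEdgeProg, eval_any_ne_nil (eval_indexProg hx), ne_eq, firstEdge_eq_none_iff]
  simp [eval_edge_test hx hi hp]

lemma eval_firstEdgeProg (hx : eval x y = G.encode) (hi : eval i y = .ofNat i')
    (hp : ∀ k : Fin G.n, eval p (.cons y (.ofNat k)) ≠ .nil ↔ p' k) {z : Edge G}
    (hz : firstEdge G i' p' = some z) : eval (firstEdgeProg x i p) y = code (.edge z) := by
  obtain ⟨h1, h2, h3⟩ := firstEdge_eq_some_iff.1 hz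
  have hfind : (List.finRange G.n).find? (fun k => p' k ∧ (i', k) ∈ G.F) = some z.1.2 := by
    rw [List.find?_finRange_eq_some_iff]
    simp only [decide_eq_true_eq, not_and]
    exact ⟨⟨h2, by rw [← h1]; exact z.2⟩, h3⟩
  rw [firstEdgeProg, edgeProg, eval_cons, eval_cons, eval_find (eval_indexProg hx)
    (p := fun k => p' k ∧ (i', k) ∈ G.F)
    fun k _ => by rw [eval_edge_test hx hi hp, decide_eq_true_iff], hfind, hi, ← h1]
  rfl

end firstEdge

end eval

/-! ### The matrices of the SSP instance

In the computation of a row, the label of the state is `snd`; in that of an entry, it is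
`outer snd`, and the label of the successor state is `snd`. -/

/-- The number of the node, or of the source of the edge, in a label. -/
def sourceOf (a : Prog) : Prog := comp fst (comp snd a)

/-- The number of the end of the edge in a label. -/
def endOf (a : Prog) : Prog := comp snd (comp snd a)

/-- The indicator of a test, as a number. -/
def oneIf (c : Prog) : Prog := ite c (num 1) (num 0)

/-- The transition probabilities out of a node. -/
def nodeProbProg : Prog :=
  ite (eq (comp fst snd) nil)
    (ite (or (allFreeProg (outer fst) (sourceOf (outer snd)))
        (freeProg (outer fst) (sourceOf (outer snd)) (sourceOf snd)))
      (num 0)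
      (arith .div (weightProg (outer fst) (sourceOf (outer snd)) (sourceOf snd))
        (totalProg (outer fst) (sourceOf (outer snd)))))
    (ite (allFreeProg (outer fst) (sourceOf (outer snd)))
      (oneIf (eq snd (firstEdgeProg (outer fst) (sourceOf (outer snd)) tt)))
      (ite (eq (sourceOf snd) (sourceOf (outer snd)))
        (arith .div (weightProg (outer fst) (sourceOf (outer snd)) (endOf snd))
          (totalProg (outer fst) (sourceOf (outer snd))))
        (num 0)))

/-- The transition costs out of a node. -/
def nodeCostProg : Prog :=
  ite (eq (comp fst snd) nil) (costProg (outer fst) (sourceOf (outer snd)) (sourceOf snd)) (num 0)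

/-- The destination of the second action of the edge labelled `a`. -/
def secondDestProg (x a : Prog) : Prog :=
  ite (allFreeProg x (sourceOf a))
    (ite (hasEdgeProg x (sourceOf a) (afterProg (endOf a)))
      (firstEdgeProg x (sourceOf a) (afterProg (endOf a))) (nodeProg (endOf a)))
    (nodeProg (sourceOf a))

/-- The cost of the second action of the edge labelled `a`. -/
def secondCostProg (x a : Prog) : Prog :=
  ite (and (allFreeProg x (sourceOf a)) (not (hasEdgeProg x (sourceOf a) (afterProg (endOf a)))))
    (costProg x (sourceOf a) (endOf a)) (num 0)

/-- The reduction. -/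
def reduction : Prog :=
  cons fst (map (ite (eq (comp fst snd) nil)
    (cons (map (cons nodeProbProg nodeCostProg) (nodesProg fst)) nil)
    (cons (map (cons (oneIf (eq snd (nodeProg (endOf (outer snd)))))
        (costProg (outer fst) (sourceOf (outer snd)) (endOf (outer snd)))) (nodesProg fst))
      (cons (map (cons (oneIf (eq snd (secondDestProg (outer fst) (outer snd))))
        (secondCostProg (outer fst) (outer snd))) (nodesProg fst)) nil)))
    (nodesProg .id))

section eval

variable {y : Data}

lemma eval_oneIf {c : Prog} {p : Prop} [Decidable p] (hc : eval c y ≠ .nil ↔ p) :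
    eval (oneIf c) y = .num (if p then 1 else 0) := by
  rw [oneIf, eval_ite_of hc]
  split_ifs <;> simp [eval]

lemma eval_div {f g : Prog} {a b : ℝ} (hf : eval f y = .num a) (hg : eval g y = .num b) :
    eval (arith .div f g) y = .num (a / b) := by
  simp [eval, hf, hg, Data.arith, ArithOp.apply]

lemma eval_nodeProbProg (i : Fin G.n) (u : ℕ) (b : Node G) :
    eval nodeProbProg (.cons (.cons G.encode (code (.node i))) (code b)) =
      .num (P (.node i) u b) := by
  classical
  set y : Data := .cons (.cons G.encode (code (.node i))) (code b) with hy
  have hx : eval (outer fst) y = G.encode := rfl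
  have hi : eval (sourceOf (outer snd)) y = .ofNat i := rfl
  rw [nodeProbProg, eval_ite_eq]
  cases b with
  | node j =>
    have hj : eval (sourceOf snd) y = .ofNat j := rfl
    rw [if_pos (by rfl), eval_ite_of ((eval_or_ne_nil _ _).trans
      (or_congr (eval_allFreeProg hx hi) (eval_freeProg hx hi hj))),
      eval_div (eval_weightProg hx hi hj) (eval_totalProg hx hi), P]
    by_cases h1 : G.AllFree i <;> by_cases h2 : (i, j) ∈ G.F <;> simp [h1, h2, eval]
  | edge x =>
    have hj : eval (endOf snd) y = .ofNat x.1.2 := rfl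
    have hb : eval snd y = code (.edge x) := rfl
    have hsrc : eval (sourceOf snd) y = .ofNat x.1.1 := rfl
    rw [if_neg (by rintro ⟨⟩), eval_ite_of (eval_allFreeProg hx hi), P]
    by_cases h1 : G.AllFree i
    · obtain ⟨z, hz⟩ := exists_start h1
      rw [if_pos h1, if_pos h1, eval_oneIf (eval_eq_ne_nil _ _),
        eval_firstEdgeProg hx hi (p' := fun _ => True) (fun _ => by simp [eval, tt]) hz, hb,
        code_injective.eq_iff, hz]
      simp [eq_comm]
    · rw [if_neg h1, if_neg h1, eval_ite_eq, hsrc, hi, Data.ofNat_inj, Fin.val_inj,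
        eval_div (eval_weightProg hx hi hj) (eval_totalProg hx hi)]
      split_ifs <;> simp [eval]

lemma eval_nodeCostProg (i : Fin G.n) (u : ℕ) (b : Node G) :
    eval nodeCostProg (.cons (.cons G.encode (code (.node i))) (code b)) =
      .num (C (.node i) u b) := by
  classical
  rw [nodeCostProg, eval_ite_eq]
  cases b with
  | node j =>
    rw [if_pos (by rfl), eval_costProg (G := G) (i' := i) (j' := j) rfl rfl rfl, C]
  | edge x =>
    rw [if_neg (by rintro ⟨⟩)]
    simp [C, eval]

lemma eval_secondDestProg {x a : Prog} {z : Edge G} (hx : eval x y = G.encode)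
    (ha : eval a y = code (.edge z)) : eval (secondDestProg x a) y = code (dest z 1) := by
  classical
  have hi : eval (sourceOf a) y = .ofNat z.1.1 := by
    rw [sourceOf, eval_comp, eval_comp, ha]
    rfl
  have hj : eval (endOf a) y = .ofNat z.1.2 := by
    rw [endOf, eval_comp, eval_comp, ha]
    rfl
  have hp : ∀ k : Fin G.n, eval (afterProg (endOf a)) (.cons y (.ofNat k)) ≠ .nil ↔ z.1.2 < k :=
    fun k => eval_after_ne_nil hj k
  rw [secondDestProg, eval_ite_of (eval_allFreeProg hx hi),
    eval_ite_of (eval_hasEdgeProg hx hi hp), dest, if_neg one_ne_zero]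
  by_cases h : G.AllFree z.1.1
  · rw [if_pos h, if_pos h]
    cases hn : next z with
    | none =>
      have hn' : firstEdge G z.1.1 (fun k => z.1.2 < k) = none := hn
      rw [if_neg (not_not.2 hn'), nodeProg, eval_cons, eval_cons, hj]
      rfl
    | some w =>
      have hn' : firstEdge G z.1.1 (fun k => z.1.2 < k) = some w := hn
      rw [if_pos (by rw [hn']; rintro ⟨⟩), eval_firstEdgeProg hx hi hp hn']
      rfl
  · rw [if_neg h, if_neg h, nodeProg, eval_cons, eval_cons, hi]
    rfl

lemma eval_secondCostProg {x a : Prog} {z : Edge G} (hx : eval x y = G.encode)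
    (ha : eval a y = code (.edge z)) : eval (secondCostProg x a) y = .num (edgeCost z 1) := by
  classical
  have hi : eval (sourceOf a) y = .ofNat z.1.1 := by
    rw [sourceOf, eval_comp, eval_comp, ha]
    rfl
  have hj : eval (endOf a) y = .ofNat z.1.2 := by
    rw [endOf, eval_comp, eval_comp, ha]
    rfl
  have hp : ∀ k : Fin G.n, eval (afterProg (endOf a)) (.cons y (.ofNat k)) ≠ .nil ↔ z.1.2 < k :=
    fun k => eval_after_ne_nil hj k
  have hcond : eval (and (allFreeProg x (sourceOf a))
      (not (hasEdgeProg x (sourceOf a) (afterProg (endOf a))))) y ≠ .nil ↔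
        G.AllFree z.1.1 ∧ next z = none := by
    rw [eval_and_ne_nil, eval_not_ne_nil, eval_allFreeProg hx hi, eval_hasEdgeProg hx hi hp,
      not_not]
    rfl
  rw [secondCostProg, eval_ite_of hcond, eval_costProg hx hi hj, edgeCost]
  simp only [one_ne_zero, false_or]
  split_ifs <;> simp [eval]

lemma encode_ssp : (ssp G).encode = .cons (.ofNat G.target) (.ofList ((nodes G).map fun a =>
    .ofList (List.ofFn fun u : Fin (acts a) => .ofList ((nodes G).map fun b =>
      .cons (.num (P a u b)) (.num (C a u b)))))) := by
  rw [SSP.encode]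
  congr 1
  · exact congrArg _ (val_symm_node G.target)
  · simp_rw [← List.ofFn_getElem_map (nodes G)]
    rfl

lemma eval_reduction : eval reduction G.encode = (ssp G).encode := by
  classical
  have hnodes : ∀ a : Node G, eval (nodesProg fst) (.cons G.encode (code a)) =
      .ofList ((nodes G).map code) := fun a => eval_nodesProg rfl
  rw [reduction, eval_cons, encode_ssp, eval_map (eval_nodesProg (G := G) rfl)]
  congr 2
  refine List.map_congr_left fun a _ => ?_
  rw [eval_ite_eq]
  cases a with
  | node i =>
    rw [if_pos (by rfl), eval_cons, eval_map (hnodes _)]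
    simp only [eval_cons, eval_nodeProbProg i 0, eval_nodeCostProg i 0]
    rfl
  | edge x =>
    rw [if_neg (by rintro ⟨⟩), eval_cons, eval_cons, eval_map (hnodes _), eval_map (hnodes _)]
    have h0 : ∀ b : Node G, eval (cons (oneIf (eq snd (nodeProg (endOf (outer snd)))))
        (costProg (outer fst) (sourceOf (outer snd)) (endOf (outer snd))))
        (.cons (.cons G.encode (code (.edge x))) (code b)) =
          .cons (.num (P (.edge x) 0 b)) (.num (C (.edge x) 0 b)) := by
      intro b
      have hb : eval (eq snd (nodeProg (endOf (outer snd))))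
          (.cons (.cons G.encode (code (.edge x))) (code b)) ≠ .nil ↔ b = .node x.1.2 := by
        rw [eval_eq_ne_nil]
        exact code_injective.eq_iff (a := b) (b := .node x.1.2)
      rw [eval_cons, eval_oneIf hb,
        eval_costProg (G := G) (i' := x.1.1) (j' := x.1.2) rfl rfl rfl]
      simp [P, C, dest, edgeCost]
    have h1 : ∀ b : Node G, eval (cons (oneIf (eq snd (secondDestProg (outer fst) (outer snd))))
        (secondCostProg (outer fst) (outer snd)))
        (.cons (.cons G.encode (code (.edge x))) (code b)) =
          .cons (.num (P (.edge x) 1 b)) (.num (C (.edge x) 1 b)) := by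
      intro b
      rw [eval_cons, eval_oneIf (eval_eq_ne_nil _ _), eval_secondCostProg (z := x) rfl rfl,
        eval_secondDestProg (z := x) rfl rfl]
      rw [P, C]
      congr 3
      exact propext code_injective.eq_iff
    simp only [h0, h1]
    rfl

end eval

/-! ### The translation of policies -/

/-- The test whether the entry labelled `a` of the list `vec` is `nil`. -/
def isNilAt (labels vec a : Prog) : Prog :=
  any (and (eq (nth snd (outer labels)) (outer a)) (not (nth snd (outer vec)))) (range labels)

lemma eval_isNilAt_ne_nil {y : Data} {labels vec a : Prog} {N : ℕ} {c m : Fin N → Data}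
    (hc : Function.Injective c) (hl : eval labels y = .ofList (List.ofFn c))
    (hm : eval vec y = .ofList (List.ofFn m)) {i : Fin N} (ha : eval a y = c i) :
    eval (isNilAt labels vec a) y ≠ .nil ↔ m i = .nil := by
  have inner : ∀ k : Fin N, eval (and (eq (nth snd (outer labels)) (outer a))
      (not (nth snd (outer vec)))) (.cons y (.ofNat k)) ≠ .nil ↔ k = i ∧ m k = .nil := by
    intro k
    rw [eval_and_ne_nil, eval_not_ne_nil, eval_eq_ne_nil,
      eval_nth k rfl ((eval_outer _ _).trans hl), eval_nth k rfl ((eval_outer _ _).trans hm),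
      eval_outer, ha, hc.eq_iff, not_not]
  rw [isNilAt, eval_any_ne_nil (eval_range hl)]
  simp [inner]

/-- The test whether the edge from `i` to `j` is followed where it is considered. -/
def followedProg (z i j : Prog) : Prog :=
  isNilAt (nodesProg (comp fst z)) (comp snd z) (edgeProg i j)

/-- The test whether the edge from `i` to `j` is activated. -/
def selectedProg (z i j : Prog) : Prog :=
  and (freeProg (comp fst z) i j)
    (ite (allFreeProg (comp fst z) i)
      (and (or (followedProg z i j) (not (hasEdgeProg (comp fst z) i (afterProg j))))
        (not (any (and (and (drop snd (outer j)) (freeProg (comp fst (outer z)) (outer i) snd))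
          (followedProg (outer z) (outer i) snd)) (indexProg (comp fst z)))))
      (followedProg z i j))

/-- The translation of policies: the matrix of the tests whether an edge is activated. -/
def decodeProg : Prog :=
  map (map (ite (selectedProg (outer fst) (outer snd) snd) tt nil)
    (indexProg (comp fst fst))) (indexProg fst)

section eval

variable {y : Data} {z i j : Prog} {π : (ssp G).Policy}

lemma eval_followedProg (hz : eval z y = .cons G.encode ((ssp G).encodePolicy π)) {x : Edge G}
    (hi : eval i y = .ofNat x.1.1) (hj : eval j y = .ofNat x.1.2) :
    eval (followedProg z i j) y ≠ .nil ↔ followed π x := by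
  have hl : eval (nodesProg (comp fst z)) y = .ofList (List.ofFn fun s => code (e G s)) := by
    rw [eval_nodesProg (G := G) (by rw [eval_comp, hz]; rfl), ← List.ofFn_getElem_map]
    rfl
  rw [followedProg, eval_isNilAt_ne_nil (code_injective.comp (e G).injective) hl
    (m := fun s => .ofNat (π s)) (i := (e G).symm (.edge x))]
  · rw [← Data.ofNat_zero, Data.ofNat_inj]
    rfl
  · rw [eval_comp, hz]
    rfl
  · rw [edgeProg, eval_cons, eval_cons, hi, hj, Function.comp_apply, Equiv.apply_symm_apply]
    rfl

lemma eval_selectedProg (hz : eval z y = .cons G.encode ((ssp G).encodePolicy π))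
    {i' j' : Fin G.n} (hi : eval i y = .ofNat i') (hj : eval j y = .ofNat j') :
    eval (selectedProg z i j) y ≠ .nil ↔ (i', j') ∈ (toPolicy π).1 := by
  classical
  have hx : eval (comp fst z) y = G.encode := by
    rw [eval_comp, hz]
    rfl
  rw [selectedProg, eval_and_ne_nil, eval_freeProg hx hi hj, toPolicy, mem_edgeSet,
    eval_ite_of (eval_allFreeProg hx hi), ← exists_prop]
  refine exists_congr fun hF => ?_
  set x : Edge G := ⟨(i', j'), hF⟩ with hxdef
  have hA : eval (followedProg z i j) y ≠ .nil ↔ followed π x :=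
    eval_followedProg hz (x := x) hi hj
  have hnext : eval (hasEdgeProg (comp fst z) i (afterProg j)) y ≠ .nil ↔ next x ≠ none :=
    eval_hasEdgeProg hx hi fun k => eval_after_ne_nil hj k
  by_cases h : G.AllFree i'
  · have hS : Selected (followed π) x ↔ Taken (followed π) x ∧
        ∀ w : Edge G, w.1.1 = i' → w.1.2 < j' → ¬ followed π w :=
      ⟨fun h' => h'.1 h, fun h' => ⟨fun _ => h', fun h'' => absurd h h''⟩⟩
    rw [if_pos h, hS, eval_and_ne_nil, eval_or_ne_nil, eval_not_ne_nil, eval_not_ne_nil, hA, hnext,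
      not_not, eval_any_ne_nil (eval_indexProg hx)]
    refine and_congr Iff.rfl ?_
    have inner : ∀ k : Fin G.n, eval (and (and (drop snd (outer j))
        (freeProg (comp fst (outer z)) (outer i) snd)) (followedProg (outer z) (outer i) snd))
        (.cons y (.ofNat k)) ≠ .nil ↔
          k < j' ∧ ∃ hk : (i', k) ∈ G.F, followed π ⟨(i', k), hk⟩ := by
      intro k
      rw [eval_and_ne_nil, eval_and_ne_nil,
        eval_freeProg (y := .cons y (.ofNat k)) (x := comp fst (outer z)) hx
          (eval_outer_of hi _) (j' := k) rfl,
        eval_drop_ofNat (K := k) (L := List.replicate j' .nil) rfl (eval_outer_of hj _), Data.ofList_ne_nil_iff,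
        ne_eq, List.drop_eq_nil_iff, List.length_replicate, not_le, Fin.val_fin_lt, and_assoc,
        ← exists_prop (a := (i', k) ∈ G.F)]
      refine and_congr Iff.rfl (exists_congr fun hk => ?_)
      exact eval_followedProg (x := ⟨(i', k), hk⟩) (eval_outer_of hz _) (eval_outer_of hi _) rfl
    simp only [inner, List.mem_finRange, true_and, not_exists, not_and]
    constructor
    · rintro h' ⟨⟨i'', k⟩, hk⟩ hi'' hlt
      dsimp only at hi''
      subst hi''
      exact h' k hlt hk
    · exact fun h' k hlt hk => h' ⟨(i', k), hk⟩ rfl hlt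
  · have hS : Selected (followed π) x ↔ followed π x :=
      ⟨fun h' => h'.2 h, fun h' => ⟨fun h'' => absurd h'' h, fun _ => h'⟩⟩
    rw [if_neg h, hS, hA]

lemma eval_decodeProg (π : (ssp G).Policy) :
    eval decodeProg (.cons G.encode ((ssp G).encodePolicy π)) = G.encodePolicy (toPolicy π) := by
  rw [decodeProg, eval_map (eval_indexProg (G := G) rfl), List.map_finRange, GPRO.encodePolicy]
  congr 2
  funext i
  rw [eval_map (eval_indexProg (G := G) rfl), List.map_finRange]
  congr 2
  funext j
  exact eval_bool (eval_selectedProg (z := outer fst) (i := outer snd) (j := snd) (π := π)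
    rfl rfl rfl)

end eval

/-! ### Running times -/

section PolyIn

variable {M : CostModel} {x i j a p z : Prog}

lemma polyIn_outer (hp : PolyIn M p) : PolyIn M (outer p) := .comp hp .fst

lemma polyIn_datumProg (hx : PolyIn M x) (hi : PolyIn M i) (hj : PolyIn M j) :
    PolyIn M (datumProg x i j) := .nth hj (.comp .snd (.nth hi (.comp .snd hx)))

lemma polyIn_weightProg (hx : PolyIn M x) (hi : PolyIn M i) (hj : PolyIn M j) :
    PolyIn M (weightProg x i j) := .comp .fst (polyIn_datumProg hx hi hj)

lemma polyIn_costProg (hx : PolyIn M x) (hi : PolyIn M i) (hj : PolyIn M j) :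
    PolyIn M (costProg x i j) := .comp .fst (.comp .snd (polyIn_datumProg hx hi hj))

lemma polyIn_freeProg (hx : PolyIn M x) (hi : PolyIn M i) (hj : PolyIn M j) :
    PolyIn M (freeProg x i j) := .comp .snd (.comp .snd (polyIn_datumProg hx hi hj))

lemma polyIn_indexProg (hx : PolyIn M x) : PolyIn M (indexProg x) := .range (.comp .snd hx)

lemma polyIn_allFreeProg (hx : PolyIn M x) (hi : PolyIn M i) : PolyIn M (allFreeProg x i) :=
  .not (.any (.and
    (.lt (.num 0) (polyIn_weightProg (polyIn_outer hx) (polyIn_outer hi) .snd))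
    (.not (polyIn_freeProg (polyIn_outer hx) (polyIn_outer hi) .snd))) (polyIn_indexProg hx))

lemma polyIn_totalProg (hx : PolyIn M x) (hi : PolyIn M i) : PolyIn M (totalProg x i) :=
  .sum (polyIn_weightProg (polyIn_outer hx) (polyIn_outer hi) .snd) (polyIn_indexProg hx)

lemma polyIn_nodeProg (hi : PolyIn M i) : PolyIn M (nodeProg i) := .cons .nil (.cons hi .nil)

lemma polyIn_edgeProg (hi : PolyIn M i) (hj : PolyIn M j) : PolyIn M (edgeProg i j) :=
  .cons .tt (.cons hi hj)

lemma polyIn_nodesProg (hx : PolyIn M x) : PolyIn M (nodesProg x) :=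
  .append (.map (polyIn_nodeProg .snd) (polyIn_indexProg hx))
    (.flatMap (.flatMap (.ite
      (polyIn_freeProg (polyIn_outer (polyIn_outer hx)) (polyIn_outer .snd) .snd)
      (.cons (polyIn_edgeProg (polyIn_outer .snd) .snd) .nil) .nil)
      (polyIn_indexProg (polyIn_outer hx))) (polyIn_indexProg hx))

lemma polyIn_hasEdgeProg (hx : PolyIn M x) (hi : PolyIn M i) (hp : PolyIn M p) :
    PolyIn M (hasEdgeProg x i p) :=
  .any (.and hp (polyIn_freeProg (polyIn_outer hx) (polyIn_outer hi) .snd)) (polyIn_indexProg hx)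

lemma polyIn_firstEdgeProg (hx : PolyIn M x) (hi : PolyIn M i) (hp : PolyIn M p) :
    PolyIn M (firstEdgeProg x i p) :=
  polyIn_edgeProg hi (.find (.and hp
    (polyIn_freeProg (polyIn_outer hx) (polyIn_outer hi) .snd)) .nil (polyIn_indexProg hx))

lemma polyIn_afterProg (hj : PolyIn M j) : PolyIn M (afterProg j) := .drop (polyIn_outer hj) .snd

lemma polyIn_sourceOf (ha : PolyIn M a) : PolyIn M (sourceOf a) := .comp .fst (.comp .snd ha)

lemma polyIn_endOf (ha : PolyIn M a) : PolyIn M (endOf a) := .comp .snd (.comp .snd ha)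

lemma polyIn_oneIf (hp : PolyIn M p) : PolyIn M (oneIf p) := .ite hp (.num 1) (.num 0)

lemma polyIn_secondDestProg (hx : PolyIn M x) (ha : PolyIn M a) :
    PolyIn M (secondDestProg x a) :=
  .ite (polyIn_allFreeProg hx (polyIn_sourceOf ha))
    (.ite (polyIn_hasEdgeProg hx (polyIn_sourceOf ha) (polyIn_afterProg (polyIn_endOf ha)))
      (polyIn_firstEdgeProg hx (polyIn_sourceOf ha) (polyIn_afterProg (polyIn_endOf ha)))
      (polyIn_nodeProg (polyIn_endOf ha)))
    (polyIn_nodeProg (polyIn_sourceOf ha))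

lemma polyIn_secondCostProg (hx : PolyIn M x) (ha : PolyIn M a) :
    PolyIn M (secondCostProg x a) :=
  .ite (.and (polyIn_allFreeProg hx (polyIn_sourceOf ha))
      (.not (polyIn_hasEdgeProg hx (polyIn_sourceOf ha) (polyIn_afterProg (polyIn_endOf ha)))))
    (polyIn_costProg hx (polyIn_sourceOf ha) (polyIn_endOf ha)) (.num 0)

lemma polyIn_reduction : PolyIn M reduction := by
  have hx : PolyIn M (outer fst) := polyIn_outer .fst
  have ha : PolyIn M (outer snd) := polyIn_outer .snd
  have hi := polyIn_sourceOf ha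
  have htag : PolyIn M (eq (comp fst snd) nil) := .eq (.comp .fst .snd) .nil
  have hall := polyIn_allFreeProg hx hi
  have htotal := polyIn_totalProg hx hi
  have hsrc : PolyIn M (sourceOf snd) := polyIn_sourceOf .snd
  have hend : PolyIn M (endOf snd) := polyIn_endOf .snd
  have hprob : PolyIn M nodeProbProg :=
    .ite htag
      (.ite (.or hall (polyIn_freeProg hx hi hsrc)) (.num 0)
        (.arith _ (polyIn_weightProg hx hi hsrc) htotal))
      (.ite hall (polyIn_oneIf (.eq .snd (polyIn_firstEdgeProg hx hi .tt)))
        (.ite (.eq hsrc hi) (.arith _ (polyIn_weightProg hx hi hend) htotal) (.num 0)))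
  have hcost : PolyIn M nodeCostProg := .ite htag (polyIn_costProg hx hi hsrc) (.num 0)
  have hnodes : PolyIn M (nodesProg fst) := polyIn_nodesProg .fst
  exact .cons .fst (.map (.ite htag (.cons (.map (.cons hprob hcost) hnodes) .nil)
    (.cons (.map (.cons (polyIn_oneIf (.eq .snd (polyIn_nodeProg (polyIn_endOf ha))))
        (polyIn_costProg hx hi (polyIn_endOf ha))) hnodes)
      (.cons (.map (.cons (polyIn_oneIf (.eq .snd (polyIn_secondDestProg hx ha)))
        (polyIn_secondCostProg hx ha)) hnodes) .nil))) (polyIn_nodesProg .id))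

lemma polyIn_followedProg (hz : PolyIn M z) (hi : PolyIn M i) (hj : PolyIn M j) :
    PolyIn M (followedProg z i j) := by
  have hl : PolyIn M (nodesProg (comp fst z)) := polyIn_nodesProg (.comp .fst hz)
  exact .any (.and (.eq (.nth .snd (polyIn_outer hl)) (polyIn_outer (polyIn_edgeProg hi hj)))
    (.not (.nth .snd (polyIn_outer (.comp .snd hz))))) (.range hl)

lemma polyIn_selectedProg (hz : PolyIn M z) (hi : PolyIn M i) (hj : PolyIn M j) :
    PolyIn M (selectedProg z i j) := by
  have hx : PolyIn M (comp fst z) := .comp .fst hz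
  have hA := polyIn_followedProg hz hi hj
  exact .and (polyIn_freeProg hx hi hj)
    (.ite (polyIn_allFreeProg hx hi)
      (.and (.or hA (.not (polyIn_hasEdgeProg hx hi (polyIn_afterProg hj))))
        (.not (.any (.and (.and (.drop .snd (polyIn_outer hj))
          (polyIn_freeProg (.comp .fst (polyIn_outer hz)) (polyIn_outer hi) .snd))
          (polyIn_followedProg (polyIn_outer hz) (polyIn_outer hi) .snd)) (polyIn_indexProg hx))))
      hA)

lemma polyIn_decodeProg : PolyIn M decodeProg :=
  .map (.map (.ite (polyIn_selectedProg (polyIn_outer .fst) (polyIn_outer .snd) .snd) .tt .nil)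
    (polyIn_indexProg (.comp .fst .fst))) (polyIn_indexProg .fst)

end PolyIn

end GPROToSSP

theorem theorem1 :
    ∃ c : ℕ,
      -- from SSP to GPRO
      (∃ (red dec : Prog) (T : Polynomial ℕ), ∀ I : SSP,
        ∃ (G : GPRO) (ι : Fin I.n → Fin G.n) (D : G.Policy → I.Policy),
          -- `red` computes the instance `G`, in polynomial time
          red.eval I.encode = G.encode ∧ red.RunsInTime T I.encode ∧
          -- size of `G`; every choice in `G` is made at an exclusivity constraint
          G.n ≤ c * I.numActions ∧ G.F.card ≤ c * I.numActions ∧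
          (∀ e ∈ G.F, e.1 ∈ G.X) ∧
          -- states are nodes, and policies of `G` yield all policies of `I`, with the same costs
          Function.Injective ι ∧ ι I.target = G.target ∧
          Function.Surjective D ∧
          (∀ (π : G.Policy) (s : Fin I.n), I.value (D π) s = G.value π (ι s)) ∧
          -- optimal policies of `G` yield exactly the optimal policies of `I`
          (∀ π : G.Policy, G.Optimal π → I.Optimal (D π)) ∧
          (∀ μ : I.Policy, I.Optimal μ → ∃ π : G.Policy, G.Optimal π ∧ D π = μ) ∧
          -- `dec` computes this translation of policies, in polynomial time
          (∀ π : G.Policy,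
            dec.eval (.cons I.encode (G.encodePolicy π)) = I.encodePolicy (D π) ∧
            dec.RunsInTime T (.cons I.encode (G.encodePolicy π)))) ∧
      -- from GPRO to SSP
      (∃ (red dec : Prog) (T : Polynomial ℕ), ∀ G : GPRO,
        ∃ (I : SSP) (ι : Fin G.n → Fin I.n) (D : I.Policy → G.Policy),
          -- `red` computes the instance `I`, in polynomial time
          red.eval G.encode = I.encode ∧ red.RunsInTime T G.encode ∧
          -- size of `I`
          (∀ s, I.acts s = 1 ∨ I.acts s = 2) ∧
          I.numStatesWith 1 ≤ c * G.n ∧ I.numStatesWith 2 = G.F.card ∧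
          -- nodes are states, and policies of `I` yield all policies of `G` that activate a single
          -- edge wherever all outgoing edges are free, with the same costs
          Function.Injective ι ∧ ι G.target = I.target ∧
          (∀ π : I.Policy, G.SingleChoice (D π)) ∧
          (∀ μ : G.Policy, G.SingleChoice μ → ∃ π : I.Policy, D π = μ) ∧
          (∀ (π : I.Policy) (i : Fin G.n), G.value (D π) i = I.value π (ι i)) ∧
          -- optimal policies of `I` yield policies of `G` that are optimal among all policies, and
          -- all those of them that activate a single edge wherever all outgoing edges are free
          (∀ π : I.Policy, I.Optimal π → G.Optimal (D π)) ∧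
          (∀ μ : G.Policy, G.Optimal μ → G.SingleChoice μ →
            ∃ π : I.Policy, I.Optimal π ∧ D π = μ) ∧
          -- `dec` computes this translation of policies, in polynomial time
          (∀ π : I.Policy,
            dec.eval (.cons G.encode (I.encodePolicy π)) = G.encodePolicy (D π) ∧
            dec.RunsInTime T (.cons G.encode (I.encodePolicy π)))) := by
  -- the GPRO instance has at most `3 m` nodes, and two free edges leave each exclusivity constraint
  refine ⟨6, ?_, ?_⟩
  · obtain ⟨T, hT⟩ := Prog.exists_runsInTime (p := SSPToGPRO.reduction)
      (q := SSPToGPRO.decodeProg) (fun _ => SSPToGPRO.polyIn_reduction)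
      fun _ => SSPToGPRO.polyIn_decodeProg
    refine ⟨_, _, T, fun I => ⟨SSPToGPRO.gpro I, SSPToGPRO.stateNode, SSPToGPRO.toPolicy,
      SSPToGPRO.eval_reduction, (hT _).1,
      SSPToGPRO.length_nodes_le.trans (Nat.mul_le_mul_right _ (by norm_num)),
      SSPToGPRO.card_F_le, fun e he => SSPToGPRO.mem_X_of_mem_F he, SSPToGPRO.stateNode_injective,
      SSPToGPRO.stateNode_target, SSPToGPRO.toPolicy_surjective, SSPToGPRO.value_toPolicy,
      fun _ => SSPToGPRO.optimal_toPolicy, fun _ => SSPToGPRO.exists_optimal,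
      fun π => ⟨SSPToGPRO.eval_decodeProg π, (hT _).2⟩⟩⟩
  · obtain ⟨T, hT⟩ := Prog.exists_runsInTime (p := GPROToSSP.reduction)
      (q := GPROToSSP.decodeProg) (fun _ => GPROToSSP.polyIn_reduction)
      fun _ => GPROToSSP.polyIn_decodeProg
    refine ⟨_, _, T, fun G => ⟨GPROToSSP.ssp G, GPROToSSP.nodeState, GPROToSSP.toPolicy,
      GPROToSSP.eval_reduction, (hT _).1, GPROToSSP.acts_eq,
      GPROToSSP.numStatesWith_one.trans_le (Nat.le_mul_of_pos_left _ (by norm_num)),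
      GPROToSSP.numStatesWith_two, GPROToSSP.nodeState_injective, GPROToSSP.nodeState_target,
      GPROToSSP.singleChoice_toPolicy, fun _ => GPROToSSP.exists_toPolicy_eq,
      GPROToSSP.value_toPolicy, fun _ => GPROToSSP.optimal_toPolicy,
      fun _ => GPROToSSP.exists_optimal, fun π => ⟨GPROToSSP.eval_decodeProg π, (hT _).2⟩⟩⟩
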